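/- Let $B$ be a $\sigma$-unital $C^*$-algebra and let $(X,D)$ be an even unbounded Kasparov module over $B$: $X \neq \{0\}$ is a countably generated Hilbert $C^*$-module over $B$ with a $\mathbb{Z}/2\mathbb{Z}$-grading given by a selfadjoint unitary $\gamma$ in the $C^*$-algebra $\mathbb{L}(X)$ of bounded adjointable operators, and $D : \mathrm{Dom}(D) \to X$ is a selfadjoint and regular unbounded operator with $D\gamma = -\gamma D$ whose resolvent $(i+D)^{-1}$ belongs to the ideal $\mathbb{K}(X) \subseteq \mathbb{L}(X)$ of compact operators. Let $\mathrm{Lip}_D^{\mathrm{ev}}(X)$ be the algebra of all $T \in \mathbb{L}(X)$ such that $T\gamma = \gamma T$, $T(\mathrm{Dom}(D)) \subseteq \mathrm{Dom}(D)$ and $[D,T] : \mathrm{Dom}(D) \to X$ extends to an operator $d(T) \in \mathbb{L}(X)$; it is equipped with the norm $\|T\|_1 = \|T\| + \|d(T)\|$. For a unital $C^*$-algebra $L$ and a closed $*$-ideal $A \subseteq L$ put $D(L,A) = \{(x,y) \in L \oplus L : x - y \in A\}$. Let $W_n(L,A)$, $n \geq 1$, be the space of selfadjoint invertible elements of $M_n(D(L,A))$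 with the norm topology. Then $K_0^{\mathrm{inv}}(L,A)$ is the quotient of $\bigsqcup_{n \geq 1} W_n(L,A)$ by stable homotopy: $H_0 \in W_n(L,A)$ and $H_1 \in W_m(L,A)$ are equivalent if for some $k \geq n,m$ there are selfadjoint invertible $G_0 \in M_{k-n}(L)$ and $G_1 \in M_{k-m}(L)$ such that $H_0 \oplus (G_0,G_0)$ and $H_1 \oplus (G_1,G_1)$ are joined by a continuous path in $W_k(L,A)$. A localizing function is an even continuous $L^1$-function $\phi : \mathbb{R} \to [0,1]$ with support in $[-1,1]$, equal to $1$ on $[-\tfrac12,\tfrac12]$, non-increasing on $[0,\infty)$, and such that $p \mapsto p\,\widehat{\phi}(p)$ is in $L^1(\mathbb{R})$, where $\widehat{\phi}(p) = \frac{1}{\sqrt{2\pi}} \int_{\mathbb{R}} \phi(x) e^{-ixp}\,dx$. For $\rho > 0$ put $\Phi_\rho = \phi(D/\rho)$, defined by continuous functional calculus, and for a selfadjoint $H \in \mathrm{Lip}_D^{\mathrm{ev}}(X)$ which is invertible in $\mathbb{L}(X)$ and $\kappa, \rho > 0$ put $$L_{\kappa,\rho}(H,D,\phi) = \Phi_\rho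 \gamma H \Phi_\rho + \kappa\, \Phi_{2\rho} D \Phi_{2\rho} - (1 - \Phi_{2\rho}^4)^{1/2} \gamma .$$ With $c_\phi = \frac{2}{\sqrt{2\pi}} \| p\,\widehat{\phi}(p) \|_1$ and $g = \|H^{-1}\|^{-1}$, the pair $(\kappa,\rho)$ is admissible with respect to $(H,D,\phi)$ if $$\Big(\kappa + \frac{c_\phi \|H\|}{\rho}\Big) \|d(H)\| < \min\Big\{ g^2, \frac{\kappa^2\rho^2}{4} \Big\} .$$ (1) Let $H \in \mathrm{Lip}_D^{\mathrm{ev}}(X)$ be selfadjoint and invertible. For every localizing function $\phi$ there is a pair $(\kappa,\rho)$ which is admissible with respect to $(H,D,\phi)$. For every localizing function $\phi$ and every such admissible pair, $(-\gamma, L_{\kappa,\rho}(H,D,\phi))$ is a selfadjoint invertible element of $D(\mathbb{L}(X),\mathbb{K}(X))$, and its class $$L(H,D) := \big[(-\gamma, L_{\kappa,\rho}(H,D,\phi))\big] \in K_0^{\mathrm{inv}}(\mathbb{L}(X),\mathbb{K}(X)),$$ the spectral localizer class, is independent of the choice of the localizing function $\phi$ and of the admissible pair $(\kappa,\rho)$.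 In other words, there is exactly one class that equals $[(-\gamma, L_{\kappa,\rho}(H,D,\phi))]$ for all such $\phi$ and $(\kappa,\rho)$. (2) Let $\alpha : [0,1] \to \mathrm{Lip}_D^{\mathrm{ev}}(X)$ be a map which is continuous with respect to the norm $\|\cdot\|_1$ and such that $\alpha(t)$ is selfadjoint and invertible for all $t \in [0,1]$. Then $L(\alpha(0),D) = L(\alpha(1),D)$ in $K_0^{\mathrm{inv}}(\mathbb{L}(X),\mathbb{K}(X))$. -/

import Mathlib

open Filter Topology MeasureTheory
open scoped InnerProductSpace

noncomputable section

namespace SpecLoc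

/-!
### Bounded adjointable operators on a Hilbert C⋆-module

Hilbert C⋆-modules are those of Mathlib, `CStarModule B X`: the `B`-valued inner product
`⟪x, y⟫_B` is conjugate linear in `x` and linear in `y`, and the action of `b : B` on `x : X`
is written `b • x`, with `⟪x, b • y⟫_B = b * ⟪x, y⟫_B`. A right Hilbert C⋆-module over a
C⋆-algebra is the same thing as such a module over the opposite C⋆-algebra, with the same
bounded adjointable operators and the same compact operators.
-/

section Adjointable

variable (B X : Type*) [NonUnitalCStarAlgebra B] [PartialOrder B] [StarOrderedRing B]
  [SMul B X] [NormedAddCommGroup X] [NormedSpace ℂ X] [CStarModule B X]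

/-- Two vectors with the same `B`-valued inner products agree. -/
theorem ext_inner {B X : Type*} [NonUnitalCStarAlgebra B] [PartialOrder B]
    [SMul B X] [NormedAddCommGroup X] [NormedSpace ℂ X] [CStarModule B X] {x y : X}
    (h : ∀ z : X, ⟪z, x⟫_B = ⟪z, y⟫_B) : x = y := by
  have h1 : ⟪x - y, x - y⟫_B = 0 := by
    rw [CStarModule.inner_sub_right, h (x - y), sub_self]
  exact sub_eq_zero.1 (CStarModule.inner_self.1 h1)

/-- The algebra `𝕃(X)` of bounded adjointable operators on `X`, with the operator norm. -/
def adjointable : Subalgebra ℂ (X →L[ℂ] X) where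
  carrier := {T | ∃ S : X →L[ℂ] X, ∀ x y : X, ⟪T x, y⟫_B = ⟪x, S y⟫_B}
  mul_mem' := by
    rintro T T' ⟨S, hS⟩ ⟨S', hS'⟩
    exact ⟨S' * S, fun x y => by simp [hS, hS']⟩
  add_mem' := by
    rintro T T' ⟨S, hS⟩ ⟨S', hS'⟩
    exact ⟨S + S', fun x y => by simp [hS, hS']⟩
  algebraMap_mem' := by
    intro c
    refine ⟨algebraMap ℂ _ (star c), fun x y => ?_⟩
    simp [Algebra.algebraMap_eq_smul_one]

/-- Bounded adjointable operators, as a subtype of the bounded operators. -/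
abbrev AdjSub : Type _ := ↥(adjointable B X)

variable {B X}

/-- The adjoint of a bounded adjointable operator. -/
def adjoint (T : AdjSub B X) : X →L[ℂ] X := Classical.choose T.2

theorem inner_adjoint (T : AdjSub B X) (x y : X) : ⟪T.1 x, y⟫_B = ⟪x, adjoint T y⟫_B :=
  Classical.choose_spec T.2 x y

theorem adjoint_mem (T : AdjSub B X) : adjoint T ∈ adjointable B X := by
  refine ⟨T.1, fun x y => ?_⟩
  rw [← CStarModule.star_inner, ← inner_adjoint, CStarModule.star_inner]

instance instStarAdj : Star (AdjSub B X) := ⟨fun T => ⟨adjoint T, adjoint_mem T⟩⟩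

theorem inner_star_right_aux (T : AdjSub B X) (x y : X) : ⟪x, (star T).1 y⟫_B = ⟪T.1 x, y⟫_B :=
  (inner_adjoint T x y).symm

theorem inner_star_left_aux (T : AdjSub B X) (x y : X) : ⟪(star T).1 x, y⟫_B = ⟪x, T.1 y⟫_B := by
  rw [← CStarModule.star_inner, inner_star_right_aux, CStarModule.star_inner]

/-- The adjoint is determined by its defining relation. -/
theorem star_eq_of_aux {T S : AdjSub B X} (h : ∀ x y : X, ⟪T.1 x, y⟫_B = ⟪x, S.1 y⟫_B) :
    star T = S := by
  apply Subtype.ext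
  ext y
  exact ext_inner (B := B) fun z => by rw [inner_star_right_aux, h]

theorem norm_star_le (T : AdjSub B X) : ‖star T‖ ≤ ‖T‖ := by
  refine ContinuousLinearMap.opNorm_le_bound _ (norm_nonneg _) fun x => ?_
  by_cases hx : ‖(star T).1 x‖ = 0
  · change ‖(star T).1 x‖ ≤ _
    rw [hx]; positivity
  have h1 : ‖(star T).1 x‖ ^ 2 ≤ ‖T‖ * ‖x‖ * ‖(star T).1 x‖ := by
    rw [CStarModule.norm_sq_eq B, inner_star_right_aux]
    calc _ ≤ ‖T.1 ((star T).1 x)‖ * ‖x‖ := CStarModule.norm_inner_le X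
      _ ≤ (‖T‖ * ‖(star T).1 x‖) * ‖x‖ := by
        gcongr; exact T.1.le_opNorm _
      _ = _ := by ring
  have h2 : 0 < ‖(star T).1 x‖ := lt_of_le_of_ne (norm_nonneg _) (Ne.symm hx)
  rw [pow_two] at h1
  exact le_of_mul_le_mul_right h1 h2

theorem isClosed_adjointable [CompleteSpace X] :
    IsClosed (adjointable B X : Set (X →L[ℂ] X)) := by
  refine IsSeqClosed.isClosed fun T T₀ hT hlim => ?_
  let T' : ℕ → AdjSub B X := fun n => ⟨T n, hT n⟩
  have hc : CauchySeq fun n => (star (T' n)).1 := by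
    have hT' : CauchySeq T := hlim.cauchySeq
    rw [Metric.cauchySeq_iff] at hT' ⊢
    intro ε hε
    obtain ⟨N, hN⟩ := hT' ε hε
    refine ⟨N, fun m hm n hn => lt_of_le_of_lt ?_ (hN m hm n hn)⟩
    rw [dist_eq_norm, dist_eq_norm]
    have h1 : star (T' m - T' n) = star (T' m) - star (T' n) := star_eq_of_aux fun x y => by
      have e1 : (T' m - T' n).1 x = (T' m).1 x - (T' n).1 x := rfl
      have e2 : (star (T' m) - star (T' n)).1 y = (star (T' m)).1 y - (star (T' n)).1 y := rfl
      rw [e1, e2, CStarModule.inner_sub_left, CStarModule.inner_sub_right, inner_star_right_aux,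
        inner_star_right_aux]
    have h2 := norm_star_le (T' m - T' n)
    rw [h1] at h2
    exact h2
  obtain ⟨S, hS⟩ := cauchySeq_tendsto_of_complete hc
  refine ⟨S, fun x y => ?_⟩
  have a1 : Tendsto (fun n => ⟪T n x, y⟫_B) atTop (𝓝 ⟪T₀ x, y⟫_B) := by
    have : Tendsto (fun n => T n x) atTop (𝓝 (T₀ x)) :=
      ((ContinuousLinearMap.apply ℂ X x).continuous.tendsto T₀).comp hlim
    exact (CStarModule.continuous_inner (A := B) (E := X)).tendsto (T₀ x, y) |>.comp
      (this.prodMk_nhds tendsto_const_nhds)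
  have a2 : Tendsto (fun n => ⟪x, (star (T' n)).1 y⟫_B) atTop (𝓝 ⟪x, S y⟫_B) := by
    have : Tendsto (fun n => (star (T' n)).1 y) atTop (𝓝 (S y)) :=
      ((ContinuousLinearMap.apply ℂ X y).continuous.tendsto S).comp hS
    exact (CStarModule.continuous_inner (A := B) (E := X)).tendsto (x, S y) |>.comp
      (tendsto_const_nhds.prodMk_nhds this)
  refine tendsto_nhds_unique a1 (a2.congr fun n => ?_)
  rw [inner_star_right_aux]

instance instStarRingAdj : StarRing (AdjSub B X) where
  star_involutive T := star_eq_of_aux fun x y => inner_star_left_aux T x y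
  star_mul S T := star_eq_of_aux fun x y => by
    have e1 : (S * T).1 x = S.1 (T.1 x) := rfl
    have e2 : (star T * star S).1 y = (star T).1 ((star S).1 y) := rfl
    rw [e1, e2, inner_star_right_aux, inner_star_right_aux]
  star_add S T := star_eq_of_aux fun x y => by
    have e1 : (S + T).1 x = S.1 x + T.1 x := rfl
    have e2 : (star S + star T).1 y = (star S).1 y + (star T).1 y := rfl
    rw [e1, e2, CStarModule.inner_add_left, CStarModule.inner_add_right, inner_star_right_aux,
      inner_star_right_aux]

instance instStarModuleAdj : StarModule ℂ (AdjSub B X) where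
  star_smul c T := star_eq_of_aux fun x y => by
    have e1 : (c • T).1 x = c • T.1 x := rfl
    have e2 : (star c • star T).1 y = star c • (star T).1 y := rfl
    rw [e1, e2, CStarModule.inner_smul_left_complex, CStarModule.inner_smul_right_complex,
      inner_star_right_aux]

instance instCStarRingAdj : CStarRing (AdjSub B X) where
  norm_mul_self_le T := by
    have h0 : (0 : ℝ) ≤ ‖star T * T‖ := norm_nonneg _
    have h1 : ‖T‖ ≤ Real.sqrt ‖star T * T‖ := by
      refine ContinuousLinearMap.opNorm_le_bound _ (Real.sqrt_nonneg _) fun x => ?_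
      have h2 : ‖T.1 x‖ ^ 2 ≤ ‖star T * T‖ * ‖x‖ ^ 2 := by
        rw [CStarModule.norm_sq_eq B, ← inner_star_right_aux]
        calc _ ≤ ‖x‖ * ‖(star T * T).1 x‖ := CStarModule.norm_inner_le X
          _ ≤ ‖x‖ * (‖star T * T‖ * ‖x‖) := by
            gcongr; exact (star T * T).1.le_opNorm _
          _ = _ := by ring
      refine (pow_le_pow_iff_left₀ (norm_nonneg _) (by positivity) two_ne_zero).1 ?_
      rw [mul_pow, Real.sq_sqrt h0]
      exact h2
    calc ‖T‖ * ‖T‖ ≤ Real.sqrt ‖star T * T‖ * Real.sqrt ‖star T * T‖ := by gcongr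
      _ = _ := Real.mul_self_sqrt h0

instance instCompleteSpaceAdj [CompleteSpace X] : CompleteSpace (AdjSub B X) :=
  (isClosed_adjointable (B := B) (X := X)).completeSpace_coe

/-- Bounded adjointable operators on a Hilbert C⋆-module form a unital C⋆-algebra. -/
instance instCStarAlgebraAdj [CompleteSpace X] : CStarAlgebra (AdjSub B X) where

variable (B X) in
/-- The unital C⋆-algebra `𝕃(X)` of bounded adjointable operators on `X`. -/
def Adj [CompleteSpace X] : Type _ := AdjSub B X

variable [CompleteSpace X]

instance instCStarAlgebra : CStarAlgebra (Adj B X) := instCStarAlgebraAdj (B := B) (X := X)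

theorem inner_star_right (T : Adj B X) (x y : X) : ⟪x, (star T).1 y⟫_B = ⟪T.1 x, y⟫_B :=
  inner_star_right_aux T x y

theorem inner_star_left (T : Adj B X) (x y : X) : ⟪(star T).1 x, y⟫_B = ⟪x, T.1 y⟫_B :=
  inner_star_left_aux T x y

theorem star_eq_of {T S : Adj B X} (h : ∀ x y : X, ⟪T.1 x, y⟫_B = ⟪x, S.1 y⟫_B) :
    star T = S := star_eq_of_aux h

end Adjointable

/-! ### Compact operators -/

/-- A norm-closed two-sided `*`-ideal of a unital C⋆-algebra. -/
structure ClosedStarIdeal (L : Type*) [CStarAlgebra L] where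
  /-- the underlying linear subspace -/
  carrier : Submodule ℂ L
  mul_mem_left : ∀ (x : L) {a : L}, a ∈ carrier → x * a ∈ carrier
  mul_mem_right : ∀ (x : L) {a : L}, a ∈ carrier → a * x ∈ carrier
  star_mem : ∀ {a : L}, a ∈ carrier → star a ∈ carrier
  isClosed : IsClosed (carrier : Set L)

section Compact

variable {B X : Type*} [NonUnitalCStarAlgebra B] [PartialOrder B] [StarOrderedRing B]
  [SMul B X] [NormedAddCommGroup X] [NormedSpace ℂ X] [CStarModule B X]
  [CompleteSpace X]

/-- The operator `z ↦ x ⟨y, z⟩` (with the module action written as in Mathlib). -/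
def rankOne (x y : X) : Adj B X :=
  ⟨LinearMap.mkContinuous
    { toFun := fun z => ⟪y, z⟫_B • x
      map_add' := fun z w => ext_inner (B := B) fun v => by simp [add_mul]
      map_smul' := fun c z => ext_inner (B := B) fun v => by simp [smul_mul_assoc] }
    (‖y‖ * ‖x‖) (fun z => by
      change ‖⟪y, z⟫_B • x‖ ≤ ‖y‖ * ‖x‖ * ‖z‖
      refine (pow_le_pow_iff_left₀ (norm_nonneg _) (by positivity) two_ne_zero).1 ?_
      rw [CStarModule.norm_sq_eq B, CStarModule.inner_op_smul_right,
        CStarModule.inner_op_smul_left]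
      calc _ ≤ ‖⟪y, z⟫_B‖ * (‖⟪x, x⟫_B‖ * ‖star ⟪y, z⟫_B‖) :=
            (norm_mul_le _ _).trans (by gcongr; exact norm_mul_le _ _)
        _ ≤ (‖y‖ * ‖z‖) * (‖x‖ ^ 2 * (‖y‖ * ‖z‖)) := by
            rw [norm_star, ← CStarModule.norm_sq_eq B]
            gcongr <;> exact CStarModule.norm_inner_le X
        _ = _ := by ring),
    LinearMap.mkContinuous
    { toFun := fun z => ⟪x, z⟫_B • y
      map_add' := fun z w => ext_inner (B := B) fun v => by simp [add_mul]
      map_smul' := fun c z => ext_inner (B := B) fun v => by simp [smul_mul_assoc] }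
    (‖x‖ * ‖y‖) (fun z => by
      change ‖⟪x, z⟫_B • y‖ ≤ ‖x‖ * ‖y‖ * ‖z‖
      refine (pow_le_pow_iff_left₀ (norm_nonneg _) (by positivity) two_ne_zero).1 ?_
      rw [CStarModule.norm_sq_eq B, CStarModule.inner_op_smul_right,
        CStarModule.inner_op_smul_left]
      calc _ ≤ ‖⟪x, z⟫_B‖ * (‖⟪y, y⟫_B‖ * ‖star ⟪x, z⟫_B‖) :=
            (norm_mul_le _ _).trans (by gcongr; exact norm_mul_le _ _)
        _ ≤ (‖x‖ * ‖z‖) * (‖y‖ ^ 2 * (‖x‖ * ‖z‖)) := by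
            rw [norm_star, ← CStarModule.norm_sq_eq B]
            gcongr <;> exact CStarModule.norm_inner_le X
        _ = _ := by ring),
    fun z w => by
      change ⟪⟪y, z⟫_B • x, w⟫_B = ⟪z, ⟪x, w⟫_B • y⟫_B
      simp⟩

theorem rankOne_apply (x y z : X) : (rankOne x y : Adj B X).1 z = ⟪y, z⟫_B • x := rfl

theorem mul_rankOne (T : Adj B X) (x y : X) :
    T * rankOne x y = rankOne (T.1 x) y := by
  apply Subtype.ext
  ext z
  refine ext_inner (B := B) fun v => ?_
  have e : (T * rankOne x y).1 z = T.1 (⟪y, z⟫_B • x) := rfl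
  change ⟪v, (T * rankOne x y).1 z⟫_B = ⟪v, ⟪y, z⟫_B • T.1 x⟫_B
  rw [e, ← inner_star_left, CStarModule.inner_op_smul_right, CStarModule.inner_op_smul_right,
    inner_star_left]

theorem star_rankOne (x y : X) : star (rankOne x y : Adj B X) = rankOne y x :=
  star_eq_of fun z w => by
    rw [rankOne_apply, rankOne_apply]; simp

variable (B X) in
/-- The operators of finite rank: the linear span of the operators `z ↦ x ⟨y, z⟩`. -/
def finiteRank : Submodule ℂ (Adj B X) :=
  Submodule.span ℂ {T : Adj B X | ∃ x y : X, T = rankOne x y}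

theorem mul_mem_finiteRank (T : Adj B X) {S : Adj B X} (hS : S ∈ finiteRank B X) :
    T * S ∈ finiteRank B X := by
  induction hS using Submodule.span_induction with
  | mem S hS =>
    obtain ⟨x, y, rfl⟩ := hS
    exact Submodule.subset_span ⟨T.1 x, y, mul_rankOne T x y⟩
  | zero => rw [mul_zero]; exact Submodule.zero_mem _
  | add u v _ _ hu hv => rw [mul_add]; exact Submodule.add_mem _ hu hv
  | smul c u _ hu => rw [mul_smul_comm]; exact Submodule.smul_mem _ c hu

theorem star_mem_finiteRank {S : Adj B X} (hS : S ∈ finiteRank B X) :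
    star S ∈ finiteRank B X := by
  induction hS using Submodule.span_induction with
  | mem S hS =>
    obtain ⟨x, y, rfl⟩ := hS
    exact Submodule.subset_span ⟨y, x, star_rankOne x y⟩
  | zero => rw [star_zero]; exact Submodule.zero_mem _
  | add u v _ _ hu hv => rw [star_add]; exact Submodule.add_mem _ hu hv
  | smul c u _ hu => rw [star_smul]; exact Submodule.smul_mem _ _ hu

variable (B X) in
/-- The compact operators `𝕂(X)`: the closed linear span of the operators `z ↦ x ⟨y, z⟩`. -/
def compacts : ClosedStarIdeal (Adj B X) where
  carrier := (finiteRank B X).topologicalClosure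
  mul_mem_left T _ ha :=
    map_mem_closure (f := fun a => T * a) (by fun_prop) ha fun _ hb => mul_mem_finiteRank T hb
  mul_mem_right T _ ha :=
    map_mem_closure (f := fun a => a * T) (by fun_prop) ha fun b hb => by
      have h := star_mem_finiteRank (mul_mem_finiteRank (star T) (star_mem_finiteRank hb))
      rwa [star_mul, star_star, star_star] at h
  star_mem ha :=
    map_mem_closure (f := fun a => star a) continuous_star ha fun _ hb => star_mem_finiteRank hb
  isClosed := Submodule.isClosed_topologicalClosure _

end Compact

/-! ### Selfadjoint regular unbounded operators and their functional calculus -/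

section Unbounded

variable (B : Type*) {X : Type*} [NonUnitalCStarAlgebra B] [PartialOrder B] [StarOrderedRing B]
  [SMul B X] [NormedAddCommGroup X] [NormedSpace ℂ X] [CStarModule B X]
  [CompleteSpace X]

/-- `D` is a selfadjoint and regular unbounded operator on the Hilbert C⋆-module `X`: it is a
symmetric `B`-linear operator, defined on a dense `B`-submodule, such that `D + i` and `D - i`
are surjective. -/
structure IsSelfAdjointRegular (D : X →ₗ.[ℂ] X) : Prop where
  dense_domain : Dense (D.domain : Set X)
  smul_mem : ∀ (b : B) (x : D.domain), b • (x : X) ∈ D.domain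
  map_smul : ∀ (b : B) (x : D.domain), D ⟨b • (x : X), smul_mem b x⟩ = b • D x
  symmetric : ∀ x y : D.domain, ⟪D x, (y : X)⟫_B = ⟪(x : X), D y⟫_B
  surjective_add : ∀ y : X, ∃ x : D.domain, D x + Complex.I • (x : X) = y
  surjective_sub : ∀ y : X, ∃ x : D.domain, D x - Complex.I • (x : X) = y

variable {B}
variable {D : X →ₗ.[ℂ] X}

/-- The basic estimate `‖x‖ ≤ ‖(D + c) x‖` for `c = i` and `c = -i`. -/
theorem IsSelfAdjointRegular.norm_le (hD : IsSelfAdjointRegular B D) (c : ℂ)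
    (hc : c = Complex.I ∨ c = -Complex.I) (x : D.domain) : ‖(x : X)‖ ≤ ‖D x + c • (x : X)‖ := by
  refine (pow_le_pow_iff_left₀ (norm_nonneg _) (norm_nonneg _) two_ne_zero).1 ?_
  rw [CStarModule.norm_sq_eq B, CStarModule.norm_sq_eq B]
  have hcc : star c = -c := by rcases hc with rfl | rfl <;> simp
  have hc2 : -(c * c) = 1 := by rcases hc with rfl | rfl <;> simp
  have key : ⟪D x + c • (x : X), D x + c • (x : X)⟫_B = ⟪D x, D x⟫_B + ⟪(x : X), (x : X)⟫_B := by
    have h3 : c * -c = 1 := by rw [← hc2]; ring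
    have h4 : ⟪(x : X), D x⟫_B = ⟪D x, (x : X)⟫_B := (hD.symmetric x x).symm
    simp only [CStarModule.inner_add_left, CStarModule.inner_add_right,
      CStarModule.inner_smul_left_complex, CStarModule.inner_smul_right_complex, hcc, h4,
      smul_add, smul_smul, h3, one_smul]
    module
  rw [key]
  refine CStarAlgebra.norm_le_norm_of_nonneg_of_le CStarModule.inner_self_nonneg ?_
  exact le_add_of_nonneg_left CStarModule.inner_self_nonneg

theorem IsSelfAdjointRegular.surjective (hD : IsSelfAdjointRegular B D) (c : ℂ)
    (hc : c = Complex.I ∨ c = -Complex.I) (y : X) : ∃ x : D.domain, D x + c • (x : X) = y := by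
  rcases hc with rfl | rfl
  · exact hD.surjective_add y
  · obtain ⟨x, hx⟩ := hD.surjective_sub y
    exact ⟨x, by rw [neg_smul, ← sub_eq_add_neg, hx]⟩

/-- The inverse of `D + c : Dom(D) → X` for `c = i` and `c = -i`, as a map into the domain. -/
def IsSelfAdjointRegular.inv (hD : IsSelfAdjointRegular B D) (c : ℂ)
    (hc : c = Complex.I ∨ c = -Complex.I) (y : X) : D.domain :=
  Classical.choose (hD.surjective c hc y)

theorem IsSelfAdjointRegular.inv_spec (hD : IsSelfAdjointRegular B D) (c : ℂ)
    (hc : c = Complex.I ∨ c = -Complex.I) (y : X) :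
    D (hD.inv c hc y) + c • (hD.inv c hc y : X) = y :=
  Classical.choose_spec (hD.surjective c hc y)

theorem IsSelfAdjointRegular.inv_unique (hD : IsSelfAdjointRegular B D) (c : ℂ)
    (hc : c = Complex.I ∨ c = -Complex.I) {y : X} {x : D.domain}
    (h : D x + c • (x : X) = y) : hD.inv c hc y = x := by
  have h1 : D (hD.inv c hc y - x) + c • ((hD.inv c hc y - x : D.domain) : X) = 0 := by
    have h2 := hD.inv_spec c hc y
    rw [LinearPMap.map_sub, Submodule.coe_sub, smul_sub, ← sub_eq_zero.2 (h2.trans h.symm)]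
    abel
  have h3 := hD.norm_le c hc (hD.inv c hc y - x)
  rw [h1, norm_zero] at h3
  have h4 : ((hD.inv c hc y - x : D.domain) : X) = 0 :=
    norm_eq_zero.1 (le_antisymm h3 (norm_nonneg _))
  exact sub_eq_zero.1 (Subtype.ext h4)

/-- The bounded operator `(D + c)⁻¹` for `c = i` and `c = -i`. -/
def IsSelfAdjointRegular.invCLM (hD : IsSelfAdjointRegular B D) (c : ℂ)
    (hc : c = Complex.I ∨ c = -Complex.I) : X →L[ℂ] X :=
  LinearMap.mkContinuous
    { toFun := fun y => (hD.inv c hc y : X)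
      map_add' := fun y z => by
        rw [← Submodule.coe_add]
        refine congrArg _ (hD.inv_unique c hc ?_)
        rw [LinearPMap.map_add, Submodule.coe_add, smul_add]
        nth_rewrite 3 [← hD.inv_spec c hc y]
        nth_rewrite 3 [← hD.inv_spec c hc z]
        abel
      map_smul' := fun a y => by
        rw [RingHom.id_apply, ← Submodule.coe_smul]
        refine congrArg _ (hD.inv_unique c hc ?_)
        rw [LinearPMap.map_smul, Submodule.coe_smul, smul_comm c a, ← smul_add,
          hD.inv_spec c hc y] }
    1 (fun y => by
      change ‖(hD.inv c hc y : X)‖ ≤ 1 * ‖y‖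
      have h := hD.norm_le c hc (hD.inv c hc y)
      rwa [hD.inv_spec c hc y, ← one_mul ‖y‖] at h)

theorem IsSelfAdjointRegular.inner_inv (hD : IsSelfAdjointRegular B D) (c : ℂ)
    (hc : c = Complex.I ∨ c = -Complex.I) (hc' : -c = Complex.I ∨ -c = -Complex.I) (y z : X) :
    ⟪(hD.inv c hc y : X), z⟫_B = ⟪y, (hD.inv (-c) hc' z : X)⟫_B := by
  have hcc : star c = -c := by rcases hc with rfl | rfl <;> simp
  calc ⟪(hD.inv c hc y : X), z⟫_B
      = ⟪(hD.inv c hc y : X), D (hD.inv (-c) hc' z) + (-c) • (hD.inv (-c) hc' z : X)⟫_B := by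
        rw [hD.inv_spec (-c) hc' z]
    _ = ⟪D (hD.inv c hc y) + c • (hD.inv c hc y : X), (hD.inv (-c) hc' z : X)⟫_B := by
        rw [CStarModule.inner_add_left, CStarModule.inner_add_right, hD.symmetric,
          CStarModule.inner_smul_left_complex, CStarModule.inner_smul_right_complex, hcc]
    _ = _ := by rw [hD.inv_spec c hc y]

/-- The resolvent `(D + i)⁻¹ ∈ 𝕃(X)`. -/
def resolvent (hD : IsSelfAdjointRegular B D) : Adj B X :=
  ⟨hD.invCLM Complex.I (.inl rfl), hD.invCLM (-Complex.I) (.inr rfl),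
    fun y z => hD.inner_inv Complex.I (.inl rfl) (.inr rfl) y z⟩

theorem resolvent_mem (hD : IsSelfAdjointRegular B D) (x : X) :
    (resolvent hD).1 x ∈ D.domain := (hD.inv Complex.I (.inl rfl) x).2

theorem resolvent_spec (hD : IsSelfAdjointRegular B D) (x : X) :
    D ⟨(resolvent hD).1 x, resolvent_mem hD x⟩ + Complex.I • (resolvent hD).1 x = x :=
  hD.inv_spec Complex.I (.inl rfl) x

theorem star_resolvent_apply (hD : IsSelfAdjointRegular B D) (x : X) :
    (star (resolvent hD)).1 x = (hD.inv (-Complex.I) (.inr rfl) x : X) := by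
  refine ext_inner (B := B) fun z => ?_
  rw [inner_star_right]
  exact hD.inner_inv Complex.I (.inl rfl) (.inr rfl) z x

/-- The Cayley transform `C_D = (D - i)(D + i)⁻¹ = 1 - 2 i (D + i)⁻¹`. -/
def cayley (hD : IsSelfAdjointRegular B D) : Adj B X :=
  1 - (2 * Complex.I) • resolvent hD

theorem cayley_apply (hD : IsSelfAdjointRegular B D) (x : X) :
    (cayley hD).1 x =
      D ⟨(resolvent hD).1 x, resolvent_mem hD x⟩ - Complex.I • (resolvent hD).1 x := by
  have h : (cayley hD).1 x = x - (2 * Complex.I) • (resolvent hD).1 x := rfl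
  rw [h]
  nth_rewrite 1 [← resolvent_spec hD x]
  rw [mul_smul, two_smul]
  abel

/-- The resolvent identity `(D - i)⁻¹ - (D + i)⁻¹ = 2 i (D - i)⁻¹ (D + i)⁻¹`, in both orders. -/
theorem star_resolvent_sub (hD : IsSelfAdjointRegular B D) :
    star (resolvent hD) - resolvent hD = (2 * Complex.I) • (star (resolvent hD) * resolvent hD) ∧
    star (resolvent hD) - resolvent hD =
      (2 * Complex.I) • (resolvent hD * star (resolvent hD)) := by
  constructor
  · apply Subtype.ext
    ext x
    change (star (resolvent hD)).1 x - (resolvent hD).1 x =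
      (2 * Complex.I) • (star (resolvent hD)).1 ((resolvent hD).1 x)
    rw [star_resolvent_apply, star_resolvent_apply, sub_eq_iff_eq_add]
    have := hD.inv_unique (-Complex.I) (.inr rfl) (y := x)
      (x := (2 * Complex.I) • hD.inv (-Complex.I) (.inr rfl) ((resolvent hD).1 x) +
        ⟨(resolvent hD).1 x, resolvent_mem hD x⟩) (by
        rw [LinearPMap.map_add, LinearPMap.map_smul, Submodule.coe_add, Submodule.coe_smul,
          smul_add, smul_comm (-Complex.I)]
        have h1 := hD.inv_spec (-Complex.I) (.inr rfl) ((resolvent hD).1 x)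
        rw [add_add_add_comm, ← smul_add, h1]
        have h2 := resolvent_spec hD x
        rw [← eq_sub_iff_add_eq] at h2
        rw [h2, neg_smul, mul_smul, two_smul]
        abel)
    rw [this]; rfl
  · apply Subtype.ext
    ext x
    change (star (resolvent hD)).1 x - (resolvent hD).1 x =
      (2 * Complex.I) • (resolvent hD).1 ((star (resolvent hD)).1 x)
    rw [star_resolvent_apply]
    have := hD.inv_unique Complex.I (.inl rfl) (y := x)
      (x := hD.inv (-Complex.I) (.inr rfl) x -
        (2 * Complex.I) • hD.inv Complex.I (.inl rfl) (hD.inv (-Complex.I) (.inr rfl) x)) (by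
        rw [LinearPMap.map_sub, LinearPMap.map_smul, Submodule.coe_sub, Submodule.coe_smul,
          smul_sub, smul_comm (Complex.I)]
        have h1 := hD.inv_spec Complex.I (.inl rfl) (hD.inv (-Complex.I) (.inr rfl) x : X)
        rw [sub_add_sub_comm, ← smul_add, h1]
        have h2 := hD.inv_spec (-Complex.I) (.inr rfl) x
        rw [← eq_sub_iff_add_eq] at h2
        rw [h2, neg_smul, mul_smul, two_smul]
        abel)
    have h2 : (resolvent hD).1 x = (hD.inv Complex.I (.inl rfl) x : X) := rfl
    rw [h2, this, Submodule.coe_sub, sub_sub_cancel]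
    rfl

theorem cayley_mem_unitary (hD : IsSelfAdjointRegular B D) :
    cayley hD ∈ unitary (Adj B X) := by
  obtain ⟨h1, h2⟩ := star_resolvent_sub hD
  have hs : star (cayley hD) = 1 + (2 * Complex.I) • star (resolvent hD) := by
    rw [cayley, star_sub, star_one, star_smul]
    simp [sub_eq_add_neg, ← neg_smul]
  have h4 : (2 * Complex.I) * (2 * Complex.I) = -4 := by
    linear_combination 4 * Complex.I_mul_I
  rw [Unitary.mem_iff, hs, cayley]
  constructor
  · have : (1 + (2 * Complex.I) • star (resolvent hD)) * (1 - (2 * Complex.I) • resolvent hD) =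
        1 + (2 * Complex.I) • (star (resolvent hD) - resolvent hD) -
        ((2 * Complex.I) * (2 * Complex.I)) • (star (resolvent hD) * resolvent hD) := by
      simp only [add_mul, mul_sub, one_mul, mul_one, smul_mul_smul_comm, smul_sub]
      abel
    rw [this, h1, smul_smul, add_sub_cancel_right]
  · have : (1 - (2 * Complex.I) • resolvent hD) * (1 + (2 * Complex.I) • star (resolvent hD)) =
        1 + (2 * Complex.I) • (star (resolvent hD) - resolvent hD) -
        ((2 * Complex.I) * (2 * Complex.I)) • (resolvent hD * star (resolvent hD)) := by
      simp only [sub_mul, mul_add, one_mul, mul_one, smul_mul_smul_comm, smul_sub]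
      abel
    rw [this, h2, smul_smul, add_sub_cancel_right]

/-- The function on the unit circle corresponding to `f : ℝ → ℂ` under the Cayley map
`c(t) = (t - i)/(t + i)`, with inverse `z ↦ -i (z + 1)/(z - 1)`. At `z = 1` it takes the limit
of `f` at `±∞`. -/
def onCircle (f : ℝ → ℂ) (z : ℂ) : ℂ :=
  open Classical in
  if z = 1 then limUnder (cocompact ℝ) f else f (-Complex.I * (z + 1) / (z - 1)).re

/-- The functional calculus `f(D)`, for continuous functions `f : ℝ → ℂ` which have a limit
at `±∞`: it is the continuous functional calculus of the Cayley transform. -/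
def funcCalc (hD : IsSelfAdjointRegular B D) (f : ℝ → ℂ) : Adj B X :=
  cfc (onCircle f) (cayley hD)

/-- On the unit circle, the inverse Cayley map takes real values. -/
theorem inv_cayley_real {z : ℂ} (hz : ‖z‖ = 1) (h1 : z ≠ 1) :
    (((-Complex.I * (z + 1) / (z - 1)).re : ℝ) : ℂ) = -Complex.I * (z + 1) / (z - 1) := by
  have h0 : z ≠ 0 := by rintro rfl; simp at hz
  have hc : (starRingEnd ℂ) z = z⁻¹ := by
    rw [Complex.inv_def, Complex.normSq_eq_norm_sq, hz]; simp
  have h2 : z - 1 ≠ 0 := sub_ne_zero.2 h1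
  have h3 : z⁻¹ - 1 ≠ 0 := sub_ne_zero.2 fun h => h1 (by rw [← inv_inv z, h, inv_one])
  refine Complex.conj_eq_iff_re.1 ?_
  simp only [map_div₀, map_mul, map_neg, map_add, map_sub, map_one, Complex.conj_I, hc]
  rw [div_eq_div_iff h3 h2]
  field_simp
  ring

/-- A continuous function on `ℝ` with a limit at `±∞` gives a continuous function on the
circle. -/
theorem continuousOn_onCircle {f : ℝ → ℂ} (hf : Continuous f) {l : ℂ}
    (hl : Tendsto f (cocompact ℝ) (𝓝 l)) : ContinuousOn (onCircle f) (Metric.sphere 0 1) := by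
  intro z hz
  rw [mem_sphere_zero_iff_norm] at hz
  by_cases h1 : z = 1
  · subst h1
    have hval : onCircle f 1 = l := by
      simp only [onCircle, if_true]
      exact hl.limUnder_eq
    rw [← continuousWithinAt_sdiff_self, ContinuousWithinAt, hval]
    have hT : Tendsto (fun z : ℂ => (-Complex.I * (z + 1) / (z - 1)).re)
        (𝓝[Metric.sphere (0 : ℂ) 1 \ {1}] 1) (cocompact ℝ) := by
      rw [← Metric.cobounded_eq_cocompact, ← comap_norm_atTop, tendsto_comap_iff]
      have h2 : Tendsto (fun z : ℂ => ‖z + 1‖ * ‖z - 1‖⁻¹)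
          (𝓝[Metric.sphere (0 : ℂ) 1 \ {1}] 1) atTop := by
        refine Tendsto.pos_mul_atTop (C := 2) two_pos ?_ ?_
        · have : Continuous fun z : ℂ => ‖z + 1‖ := by fun_prop
          have h3 := this.tendsto 1
          norm_num at h3
          exact h3.mono_left nhdsWithin_le_nhds
        · refine Tendsto.inv_tendsto_nhdsGT_zero ?_
          refine tendsto_nhdsWithin_of_tendsto_nhds_of_eventually_within _ ?_ ?_
          · have : Continuous fun z : ℂ => ‖z - 1‖ := by fun_prop
            have h3 := this.tendsto 1
            norm_num at h3
            exact h3.mono_left nhdsWithin_le_nhds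
          · filter_upwards [self_mem_nhdsWithin] with z hz
            exact norm_pos_iff.2 (sub_ne_zero.2 hz.2)
      refine h2.congr' ?_
      filter_upwards [self_mem_nhdsWithin] with z hz
      have h4 := inv_cayley_real (mem_sphere_zero_iff_norm.1 hz.1) hz.2
      rw [Function.comp_apply, ← Complex.norm_real, h4]
      simp [div_eq_mul_inv]
    refine (hl.comp hT).congr' ?_
    filter_upwards [self_mem_nhdsWithin] with z hz
    have h5 : z ≠ 1 := hz.2
    simp [onCircle, h5]
  · refine ContinuousAt.continuousWithinAt ?_
    have h2 : z - 1 ≠ 0 := sub_ne_zero.2 h1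
    have h3 : ContinuousAt (fun z : ℂ => f (-Complex.I * (z + 1) / (z - 1)).re) z := by
      refine hf.continuousAt.comp (Complex.continuous_re.continuousAt.comp ?_)
      exact ContinuousAt.div (by fun_prop) (by fun_prop) h2
    refine h3.congr ?_
    filter_upwards [isOpen_ne.mem_nhds h1] with w hw
    have hw' : w ≠ 1 := hw
    simp [onCircle, hw']

theorem spectrum_cayley_subset (hD : IsSelfAdjointRegular B D) :
    spectrum ℂ (cayley hD) ⊆ Metric.sphere 0 1 :=
  spectrum.subset_circle_of_unitary (cayley_mem_unitary hD)

theorem isStarNormal_cayley (hD : IsSelfAdjointRegular B D) : IsStarNormal (cayley hD) := by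
  have h := cayley_mem_unitary hD
  rw [Unitary.mem_iff] at h
  exact ⟨h.1.trans h.2.symm⟩

/-- If `f` is continuous with compact support, then `f(D)` maps `X` into `Dom(D)` and
`D f(D) = (t f)(D)`. -/
theorem funcCalc_mem_domain (hD : IsSelfAdjointRegular B D) {f : ℝ → ℂ} (hf : Continuous f)
    (hc : HasCompactSupport f) (x : X) :
    ∃ h : (funcCalc hD f).1 x ∈ D.domain,
      D ⟨(funcCalc hD f).1 x, h⟩ = (funcCalc hD fun t => (t : ℂ) * f t).1 x := by
  have hn := isStarNormal_cayley hD
  have hsub := spectrum_cayley_subset hD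
  set g : ℝ → ℂ := fun t => ((t : ℂ) + Complex.I) * f t with hg
  have hgc : Continuous g := by fun_prop
  have htc : Continuous fun t : ℝ => (t : ℂ) * f t := by fun_prop
  have hfl := hc.is_zero_at_infty
  have hgl : Tendsto g (cocompact ℝ) (𝓝 0) :=
    (hc.mul_left (f := fun t : ℝ => (t : ℂ) + Complex.I)).is_zero_at_infty
  have htl : Tendsto (fun t : ℝ => (t : ℂ) * f t) (cocompact ℝ) (𝓝 0) :=
    (hc.mul_left (f := fun t : ℝ => (t : ℂ))).is_zero_at_infty
  have cf := (continuousOn_onCircle hf hfl).mono hsub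
  have cg := (continuousOn_onCircle hgc hgl).mono hsub
  have ct := (continuousOn_onCircle htc htl).mono hsub
  have hres : resolvent hD = cfc (fun z : ℂ => (2 * Complex.I)⁻¹ * (1 - z)) (cayley hD) := by
    rw [cfc_const_mul _ _ _ (by fun_prop), cfc_sub _ _ _ (by fun_prop) (by fun_prop),
      cfc_const_one ℂ (cayley hD), cfc_id' ℂ (cayley hD), cayley, sub_sub_cancel, smul_smul, inv_mul_cancel₀ (by simp),
      one_smul]
  have e1 : funcCalc hD f = resolvent hD * funcCalc hD g := by
    rw [hres, funcCalc, funcCalc, ← cfc_mul _ _ _ (by fun_prop) cg]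
    refine cfc_congr fun z hz => ?_
    by_cases h1 : z = 1
    · subst h1
      simp only [onCircle, if_true, hfl.limUnder_eq, sub_self, mul_zero, zero_mul]
    · have hr := inv_cayley_real (mem_sphere_zero_iff_norm.1 (hsub hz)) h1
      simp only [onCircle, h1, if_false, hg]
      rw [hr, ← mul_assoc]
      have h2 : z - 1 ≠ 0 := sub_ne_zero.2 h1
      have h3 : (2 * Complex.I)⁻¹ * (1 - z) * (-Complex.I * (z + 1) / (z - 1) + Complex.I) = 1 := by
        field_simp
        ring
      rw [h3, one_mul]
  have e2 : funcCalc hD (fun t : ℝ => (t : ℂ) * f t) =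
      funcCalc hD g - Complex.I • funcCalc hD f := by
    rw [funcCalc, funcCalc, funcCalc, ← cfc_smul Complex.I _ _ cf,
      ← cfc_sub (onCircle g) (fun z => Complex.I • onCircle f z) _ cg (cf.const_smul Complex.I)]
    refine cfc_congr fun z hz => ?_
    by_cases h1 : z = 1
    · subst h1
      simp only [onCircle, if_true, hfl.limUnder_eq, hgl.limUnder_eq, htl.limUnder_eq]
      simp
    · simp only [onCircle, h1, if_false, hg, smul_eq_mul]
      ring
  have e3 : (funcCalc hD f).1 x = (resolvent hD).1 ((funcCalc hD g).1 x) := by rw [e1]; rfl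
  refine ⟨by rw [e3]; exact resolvent_mem hD _, ?_⟩
  have e4 : (funcCalc hD fun t : ℝ => (t : ℂ) * f t).1 x =
      (funcCalc hD g).1 x - Complex.I • (funcCalc hD f).1 x := by rw [e2]; rfl
  rw [e4]
  have h := resolvent_spec hD ((funcCalc hD g).1 x)
  rw [eq_sub_iff_add_eq]
  simp only [e3]
  exact h

end Unbounded

/-! ### Relative K-theory by selfadjoint invertibles -/

section KTheory

variable (L : Type*) [CStarAlgebra L] (A : ClosedStarIdeal L)

/-- The double `D(L, A) = {(x, y) ∈ L ⊕ L : x - y ∈ A}`. -/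
def double : StarSubalgebra ℂ (L × L) where
  carrier := {p | p.1 - p.2 ∈ A.carrier}
  mul_mem' {p q} hp hq := by
    have h : (p * q).1 - (p * q).2 = p.1 * (q.1 - q.2) + (p.1 - p.2) * q.2 := by
      simp only [Prod.fst_mul, Prod.snd_mul]; noncomm_ring
    change (p * q).1 - (p * q).2 ∈ A.carrier
    rw [h]
    exact A.carrier.add_mem (A.mul_mem_left _ hq) (A.mul_mem_right _ hp)
  add_mem' {p q} hp hq := by
    have h : (p + q).1 - (p + q).2 = (p.1 - p.2) + (q.1 - q.2) := by
      simp only [Prod.fst_add, Prod.snd_add]; abel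
    change (p + q).1 - (p + q).2 ∈ A.carrier
    rw [h]
    exact A.carrier.add_mem hp hq
  algebraMap_mem' c := by
    change algebraMap ℂ L c - algebraMap ℂ L c ∈ A.carrier
    rw [sub_self]; exact A.carrier.zero_mem
  star_mem' {p} hp := by
    change star p.1 - star p.2 ∈ A.carrier
    rw [← star_sub]; exact A.star_mem hp

variable {L}

/-- The selfadjoint invertible matrices over a `*`-ring, indexed by a finite type. -/
def SelfAdjInv (ι R : Type*) [Fintype ι] [DecidableEq ι] [Ring R] [StarRing R] : Type _ :=
  {H : Matrix ι ι R // star H = H ∧ IsUnit H}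

instance (ι R : Type*) [Fintype ι] [DecidableEq ι] [Ring R] [StarRing R] [TopologicalSpace R] :
    TopologicalSpace (SelfAdjInv ι R) :=
  inferInstanceAs (TopologicalSpace {H : Matrix ι ι R // star H = H ∧ IsUnit H})

section Blocks

variable {ι κ μ R S : Type*} [Fintype ι] [DecidableEq ι] [Fintype κ] [DecidableEq κ]
  [Fintype μ] [DecidableEq μ] [Ring R] [StarRing R] [Ring S] [StarRing S]

/-- Relabelling the rows and columns of a selfadjoint invertible matrix. -/
def SelfAdjInv.reindex (e : ι ≃ κ) (H : SelfAdjInv ι R) : SelfAdjInv κ R :=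
  ⟨Matrix.reindex e e H.1, by
    refine ⟨?_, ?_⟩
    · ext i j
      exact congrFun (congrFun H.2.1 (e.symm i)) (e.symm j)
    · obtain ⟨u, hu⟩ := H.2.2
      refine ⟨⟨Matrix.reindex e e u, Matrix.reindex e e (u⁻¹ : Units _), ?_, ?_⟩,
        congrArg (Matrix.reindex e e) hu⟩ <;> simp⟩

/-- The block diagonal sum `H ⊕ G` of two selfadjoint invertible matrices. -/
def SelfAdjInv.sum (H : SelfAdjInv ι R) (G : SelfAdjInv κ R) : SelfAdjInv (ι ⊕ κ) R :=
  ⟨Matrix.fromBlocks H.1 0 0 G.1, by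
    refine ⟨?_, ?_⟩
    · have h1 : H.1.conjTranspose = H.1 := H.2.1
      have h2 : G.1.conjTranspose = G.1 := G.2.1
      rw [Matrix.star_eq_conjTranspose, Matrix.fromBlocks_conjTranspose, h1, h2,
        Matrix.conjTranspose_zero, Matrix.conjTranspose_zero]
    · obtain ⟨u, hu⟩ := H.2.2
      obtain ⟨v, hv⟩ := G.2.2
      refine ⟨⟨Matrix.fromBlocks u 0 0 v,
        Matrix.fromBlocks (u⁻¹ : Units _) 0 0 (v⁻¹ : Units _), ?_, ?_⟩, by simp [hu, hv]⟩ <;>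
      simp [Matrix.fromBlocks_multiply]⟩

/-- Applying a unital `*`-homomorphism to the entries. -/
def SelfAdjInv.map (f : R →+* S) (hf : ∀ x, f (star x) = star (f x)) (H : SelfAdjInv ι R) :
    SelfAdjInv ι S :=
  ⟨f.mapMatrix H.1, by
    refine ⟨?_, H.2.2.map f.mapMatrix⟩
    ext i j
    have h : star (H.1 j i) = H.1 i j := congrFun (congrFun H.2.1 i) j
    change star (f (H.1 j i)) = f (H.1 i j)
    rw [← hf, h]⟩

variable [TopologicalSpace R]

theorem SelfAdjInv.continuous_reindex (e : ι ≃ κ) :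
    Continuous (SelfAdjInv.reindex e : SelfAdjInv ι R → SelfAdjInv κ R) := by
  refine Continuous.subtype_mk ?_ _
  exact continuous_subtype_val.matrix_reindex e e

theorem SelfAdjInv.continuous_sum_left (G : SelfAdjInv κ R) :
    Continuous (fun H : SelfAdjInv ι R => H.sum G) := by
  refine Continuous.subtype_mk ?_ _
  exact continuous_subtype_val.matrix_fromBlocks continuous_const continuous_const
    continuous_const

end Blocks

/-- `W_n(L, A)`: the selfadjoint invertible matrices in `M_n(D(L, A))`. It carries the topology
of entrywise convergence, which is the topology of the C⋆-norm of `M_n(D(L, A))`. -/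
abbrev W (n : ℕ) : Type _ := SelfAdjInv (Fin n) (double L A)

/-- The diagonal map `Δ : L → D(L, A)`, `x ↦ (x, x)`. -/
def diag : L →+* double L A where
  toFun x := ⟨(x, x), by change x - x ∈ A.carrier; rw [sub_self]; exact A.carrier.zero_mem⟩
  map_one' := rfl
  map_mul' _ _ := rfl
  map_zero' := rfl
  map_add' _ _ := rfl

/-- The diagonal map on selfadjoint invertible matrices. -/
def diagMap {ι : Type*} [Fintype ι] [DecidableEq ι] (G : SelfAdjInv ι L) :
    SelfAdjInv ι (double L A) :=
  G.map (diag A) fun _ => rfl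

/-- The stabilization `H ⊕ Δ(G) ∈ W_k(L, A)` of `H ∈ W_n(L, A)` by `G`, where `n + p = k`. -/
def stabilize {n p k : ℕ} (h : n + p = k) (H : W A n) (G : SelfAdjInv (Fin p) L) : W A k :=
  (H.sum (diagMap A G)).reindex (finSumFinEquiv.trans (finCongr h))

/-- `H₀ ∈ W_n(L, A)` and `H₁ ∈ W_m(L, A)` are stably homotopic if, for some `k ≥ n, m`, they
become homotopic in `W_k(L, A)` after stabilizing with `Δ(G₀)` and `Δ(G₁)` for selfadjoint
invertible matrices `G₀`, `G₁` over `L` of sizes `k - n`, `k - m`. -/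
def StablyHomotopic {n m : ℕ} (H₀ : W A n) (H₁ : W A m) : Prop :=
  ∃ (k p q : ℕ) (hp : n + p = k) (hq : m + q = k)
    (G₀ : SelfAdjInv (Fin p) L) (G₁ : SelfAdjInv (Fin q) L),
    Joined (stabilize A hp H₀ G₀) (stabilize A hq H₁ G₁)

section Perm

variable {ι : Type} [Fintype ι] [DecidableEq ι]

/-- Conjugation by a transposition is homotopic to the identity. -/
theorem joined_swap {R : Type*} [Ring R] [StarRing R] [Algebra ℂ R] [StarModule ℂ R]
    [TopologicalSpace R] [ContinuousAdd R] [ContinuousMul R] [ContinuousSMul ℂ R]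
    (a b : ι) (H : SelfAdjInv ι R) :
    Joined H (H.reindex (Equiv.swap a b)) := by
  let P : Matrix ι ι R := (Equiv.swap a b).toPEquiv.toMatrix
  have hPl : ∀ M : Matrix ι ι R, P * M = M.submatrix (Equiv.swap a b) id := fun M =>
    PEquiv.toMatrix_toPEquiv_mul _ _
  have hPr : ∀ M : Matrix ι ι R, M * P = M.submatrix id (Equiv.swap a b) := fun M => by
    have := PEquiv.mul_toMatrix_toPEquiv M (Equiv.swap a b)
    rwa [Equiv.symm_swap] at this
  have hP1 : ∀ i j, P i j = if Equiv.swap a b i = j then 1 else 0 := fun i j => by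
    simp [P, PEquiv.toMatrix_apply]
  have hPP : P * P = 1 := by
    rw [hPl]
    ext1 i j
    simp [hP1, Matrix.one_apply]
  have hPs : star P = P := by
    ext1 i j
    rw [Matrix.star_apply, hP1, hP1]
    have : Equiv.swap a b j = i ↔ Equiv.swap a b i = j := by
      constructor <;> rintro rfl <;> simp
    by_cases h : Equiv.swap a b i = j
    · simp [h, this.2 h]
    · rw [if_neg h, if_neg (fun h' => h (this.1 h')), star_zero]
  let E : Matrix ι ι R := (2⁻¹ : ℂ) • (1 + P)
  let F : Matrix ι ι R := (2⁻¹ : ℂ) • (1 - P)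
  have hEE : E * E = E := by
    have : (1 + P) * (1 + P) = (2 : ℂ) • (1 + P) := by
      rw [add_mul, mul_add, mul_add, hPP, two_smul]; simp; abel
    simp only [E, smul_mul_smul_comm, this, smul_smul]
    norm_num
  have hFF : F * F = F := by
    have : (1 - P) * (1 - P) = (2 : ℂ) • (1 - P) := by
      rw [sub_mul, mul_sub, mul_sub, hPP, two_smul]; simp; abel
    simp only [F, smul_mul_smul_comm, this, smul_smul]
    norm_num
  have hEF : E * F = 0 := by
    have : (1 + P) * (1 - P) = 0 := by
      rw [add_mul, mul_sub, mul_sub, hPP]; simp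
    simp only [E, F, smul_mul_smul_comm, this, smul_zero]
  have hFE : F * E = 0 := by
    have : (1 - P) * (1 + P) = 0 := by
      rw [sub_mul, mul_add, mul_add, hPP]; simp; abel
    simp only [E, F, smul_mul_smul_comm, this, smul_zero]
  have hEaF : E + F = 1 := by
    simp only [E, F, ← smul_add]
    rw [show (1 + P) + (1 - P) = (2 : ℂ) • (1 : Matrix ι ι R) by rw [two_smul]; abel, smul_smul]
    norm_num
  have hEsF : E - F = P := by
    simp only [E, F, ← smul_sub]
    rw [show (1 + P) - (1 - P) = (2 : ℂ) • P by rw [two_smul]; abel, smul_smul]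
    norm_num
  have hEs : star E = E := by
    simp only [E]; rw [star_smul, star_add, star_one, hPs]; simp
  have hFs : star F = F := by
    simp only [F]; rw [star_smul, star_sub, star_one, hPs]; simp
  let u : unitInterval → ℂ := fun t => Complex.exp ((Real.pi * (t : ℝ) : ℝ) * Complex.I)
  have hu : ∀ t, u t * star (u t) = 1 := fun t => by
    have h1 : ‖u t‖ = 1 := Complex.norm_exp_ofReal_mul_I _
    have h2 := Complex.mul_conj (u t)
    rw [Complex.normSq_eq_norm_sq, h1] at h2
    simpa using h2
  let U : unitInterval → Matrix ι ι R := fun t => E + u t • F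
  have hUs : ∀ t, star (U t) = E + star (u t) • F := fun t => by
    have h1 : star (U t) = star E + star (u t) • star F := by
      rw [← star_smul, ← star_add]
    rw [h1, hEs, hFs]
  have hUU : ∀ t, U t * star (U t) = 1 := fun t => by
    rw [hUs]
    simp only [U, add_mul, mul_add, mul_smul_comm, smul_mul_assoc, smul_smul, hEE,
      hFF, hEF, hFE, smul_zero, add_zero, zero_add, mul_comm (star (u t)), hu, one_smul, hEaF]
  have hUU' : ∀ t, star (U t) * U t = 1 := fun t => by
    rw [hUs]
    simp only [U, add_mul, mul_add, mul_smul_comm, smul_mul_assoc, smul_smul, hEE,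
      hFF, hEF, hFE, smul_zero, add_zero, zero_add, hu, one_smul, hEaF]
  have hUc : Continuous U := by
    have : Continuous u := by fun_prop
    fun_prop
  let α : unitInterval → SelfAdjInv ι R := fun t => ⟨U t * H.1 * star (U t), by
    refine ⟨?_, ?_⟩
    · rw [star_mul, star_mul, star_star, H.2.1, mul_assoc]
    · exact (IsUnit.mul ⟨⟨U t, star (U t), hUU t, hUU' t⟩, rfl⟩ H.2.2).mul
        ⟨⟨star (U t), U t, hUU' t, hUU t⟩, rfl⟩⟩
  have hα : Continuous α := by
    refine Continuous.subtype_mk ?_ _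
    have h2 : Continuous fun t => star (U t) := by
      simp only [hUs]
      have : Continuous u := by fun_prop
      fun_prop
    exact (hUc.matrix_mul continuous_const).matrix_mul h2
  refine ⟨⟨⟨α, hα⟩, ?_, ?_⟩⟩
  · apply Subtype.ext
    have h0 : U 0 = 1 := by simp [U, u, hEaF]
    simp [α, h0]
  · apply Subtype.ext
    have h1 : U 1 = P := by
      simp only [U, u]
      rw [← hEsF]; simp [sub_eq_add_neg]
    change U 1 * H.1 * star (U 1) = Matrix.reindex (Equiv.swap a b) (Equiv.swap a b) H.1
    rw [h1, hPs, hPl, hPr]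
    ext1 i j
    simp

/-- Conjugation by a permutation is homotopic to the identity. -/
theorem joined_perm (σ : Equiv.Perm ι) (H : SelfAdjInv ι (double L A)) :
    Joined H (H.reindex σ) := by
  induction σ using Equiv.Perm.swap_induction_on with
  | one => exact Joined.refl _
  | swap_mul f a b _ ih => exact ih.trans (joined_swap a b _)

variable {κ : Type} [Fintype κ] [DecidableEq κ]

theorem joined_reindex (e e' : ι ≃ κ) (H : SelfAdjInv ι (double L A)) :
    Joined (H.reindex e) (H.reindex e') := by
  have h := joined_perm A (e.symm.trans e') (H.reindex e)
  have h2 : (H.reindex e).reindex (e.symm.trans e') = H.reindex e' := by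
    apply Subtype.ext
    ext1 i j
    change H.1 _ _ = H.1 _ _
    simp
  rwa [h2] at h

theorem joined_map {Y Z : Type*} [TopologicalSpace Y] [TopologicalSpace Z] {f : Y → Z}
    (hf : Continuous f) {x y : Y} (h : Joined x y) : Joined (f x) (f y) :=
  ⟨h.somePath.map hf⟩

/-- Stable homotopy can be tested with arbitrary finite index sets. -/
theorem stablyHomotopic_of_joined {n m : ℕ} {H₀ : W A n} {H₁ : W A m}
    {κ₀ κ₁ : Type} [Fintype κ₀] [DecidableEq κ₀] [Fintype κ₁] [DecidableEq κ₁]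
    (e₀ : Fin n ⊕ κ₀ ≃ ι) (e₁ : Fin m ⊕ κ₁ ≃ ι) (G₀ : SelfAdjInv κ₀ L) (G₁ : SelfAdjInv κ₁ L)
    (h : Joined ((H₀.sum (diagMap A G₀)).reindex e₀) ((H₁.sum (diagMap A G₁)).reindex e₁)) :
    StablyHomotopic A H₀ H₁ := by
  have c₀ : n + Fintype.card κ₀ = Fintype.card ι := by
    rw [← Fintype.card_congr e₀]; simp
  have c₁ : m + Fintype.card κ₁ = Fintype.card ι := by
    rw [← Fintype.card_congr e₁]; simp
  refine ⟨Fintype.card ι, Fintype.card κ₀, Fintype.card κ₁, c₀, c₁,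
    G₀.reindex (Fintype.equivFin κ₀), G₁.reindex (Fintype.equivFin κ₁), ?_⟩
  have key : ∀ {r : ℕ} (H : W A r) {μ : Type} [Fintype μ] [DecidableEq μ] (e : Fin r ⊕ μ ≃ ι)
      (G : SelfAdjInv μ L) (c : r + Fintype.card μ = Fintype.card ι),
      Joined (((H.sum (diagMap A G)).reindex e).reindex (Fintype.equivFin ι))
        (stabilize A c H (G.reindex (Fintype.equivFin μ))) := by
    intro r H μ _ _ e G c
    have h1 := joined_reindex A (e.trans (Fintype.equivFin ι))
      ((Equiv.sumCongr (Equiv.refl _) (Fintype.equivFin μ)).trans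
        (finSumFinEquiv.trans (finCongr c))) (H.sum (diagMap A G))
    have h2 : (H.sum (diagMap A G)).reindex
        ((Equiv.sumCongr (Equiv.refl _) (Fintype.equivFin μ)).trans
        (finSumFinEquiv.trans (finCongr c))) =
        stabilize A c H (G.reindex (Fintype.equivFin μ)) := by
      have h3 : H.sum (diagMap A (G.reindex (Fintype.equivFin μ))) =
          (H.sum (diagMap A G)).reindex
            (Equiv.sumCongr (Equiv.refl _) (Fintype.equivFin μ)) := by
        apply Subtype.ext
        ext1 i j
        rcases i with i | i <;> rcases j with j | j <;> rfl
      rw [stabilize, h3]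
      rfl
    rw [h2] at h1
    exact h1
  exact ((key H₀ e₀ G₀ c₀).symm.trans
    (joined_map (SelfAdjInv.continuous_reindex (Fintype.equivFin ι)) h)).trans
    (key H₁ e₁ G₁ c₁)

end Perm

theorem StablyHomotopic.refl {n : ℕ} (H : W A n) : StablyHomotopic A H H :=
  ⟨n + 0, 0, 0, rfl, rfl, ⟨1, star_one _, isUnit_one⟩, ⟨1, star_one _, isUnit_one⟩,
    Joined.refl _⟩

variable {A}

theorem StablyHomotopic.symm {n m : ℕ} {H₀ : W A n} {H₁ : W A m}
    (h : StablyHomotopic A H₀ H₁) : StablyHomotopic A H₁ H₀ := by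
  obtain ⟨k, p, q, hp, hq, G₀, G₁, h⟩ := h
  exact ⟨k, q, p, hq, hp, G₁, G₀, h.symm⟩

theorem StablyHomotopic.trans {n m r : ℕ} {H₀ : W A n} {H₁ : W A m} {H₂ : W A r}
    (h : StablyHomotopic A H₀ H₁) (h' : StablyHomotopic A H₁ H₂) :
    StablyHomotopic A H₀ H₂ := by
  obtain ⟨k, p, q, hp, hq, G₀, G₁, h⟩ := h
  obtain ⟨l, p', q', hp', hq', G₁', G₂, h'⟩ := h'
  have c : l + q = k + p' := by omega
  let ε : Fin l ⊕ Fin q ≃ Fin k ⊕ Fin p' :=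
    (finSumFinEquiv.trans (finCongr c)).trans finSumFinEquiv.symm
  let a₀ : Fin n ⊕ (Fin p ⊕ Fin p') ≃ Fin k ⊕ Fin p' := (Equiv.sumAssoc _ _ _).symm.trans
    (Equiv.sumCongr (finSumFinEquiv.trans (finCongr hp)) (Equiv.refl _))
  let a₁ : Fin m ⊕ (Fin q ⊕ Fin p') ≃ Fin k ⊕ Fin p' := (Equiv.sumAssoc _ _ _).symm.trans
    (Equiv.sumCongr (finSumFinEquiv.trans (finCongr hq)) (Equiv.refl _))
  let b₁ : Fin m ⊕ (Fin p' ⊕ Fin q) ≃ Fin l ⊕ Fin q := (Equiv.sumAssoc _ _ _).symm.trans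
    (Equiv.sumCongr (finSumFinEquiv.trans (finCongr hp')) (Equiv.refl _))
  let b₂ : Fin r ⊕ (Fin q' ⊕ Fin q) ≃ Fin l ⊕ Fin q := (Equiv.sumAssoc _ _ _).symm.trans
    (Equiv.sumCongr (finSumFinEquiv.trans (finCongr hq')) (Equiv.refl _))
  have assoc : ∀ {x y z w : ℕ} (hx : x + y = w) (H : W A x) (G : SelfAdjInv (Fin y) L)
      (G' : SelfAdjInv (Fin z) L),
      (stabilize A hx H G).sum (diagMap A G') =
      (H.sum (diagMap A (G.sum G'))).reindex ((Equiv.sumAssoc _ _ _).symm.trans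
        (Equiv.sumCongr (finSumFinEquiv.trans (finCongr hx)) (Equiv.refl _))) := by
    intro x y z w hx H G G'
    apply Subtype.ext
    subst hx
    have hd : diagMap A (G.sum G') = (diagMap A G).sum (diagMap A G') := by
      apply Subtype.ext
      ext1 i j
      rcases i with i | i <;> rcases j with j | j <;> rfl
    rw [hd]
    ext1 i j
    rcases i with i | i
    · obtain ⟨i, rfl⟩ := finSumFinEquiv.surjective i
      rcases j with j | j
      · obtain ⟨j, rfl⟩ := finSumFinEquiv.surjective j
        rcases i with i | i <;> rcases j with j | j <;>
          simp [SelfAdjInv.sum, SelfAdjInv.reindex, stabilize]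
      · rcases i with i | i <;> simp [SelfAdjInv.sum, SelfAdjInv.reindex, stabilize]
    · rcases j with j | j
      · obtain ⟨j, rfl⟩ := finSumFinEquiv.surjective j
        rcases j with j | j <;> simp [SelfAdjInv.sum, SelfAdjInv.reindex, stabilize]
      · simp [SelfAdjInv.sum, SelfAdjInv.reindex, stabilize]
  refine stablyHomotopic_of_joined A a₀ (b₂.trans ε) (G₀.sum G₁') (G₂.sum G₁) ?_
  have s1 : Joined ((H₀.sum (diagMap A (G₀.sum G₁'))).reindex a₀)
      ((H₁.sum (diagMap A (G₁.sum G₁'))).reindex a₁) := by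
    have := joined_map (SelfAdjInv.continuous_sum_left (diagMap A G₁')) h
    rwa [assoc hp, assoc hq] at this
  have s2 : Joined ((H₁.sum (diagMap A (G₁'.sum G₁))).reindex b₁)
      ((H₂.sum (diagMap A (G₂.sum G₁))).reindex b₂) := by
    have := joined_map (SelfAdjInv.continuous_sum_left (diagMap A G₁)) h'
    rwa [assoc hp', assoc hq'] at this
  have s3 : Joined (((H₁.sum (diagMap A (G₁'.sum G₁))).reindex b₁).reindex ε)
      (((H₂.sum (diagMap A (G₂.sum G₁))).reindex b₂).reindex ε) :=
    joined_map (SelfAdjInv.continuous_reindex ε) s2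
  have swap : H₁.sum (diagMap A (G₁'.sum G₁)) =
      (H₁.sum (diagMap A (G₁.sum G₁'))).reindex
        (Equiv.sumCongr (Equiv.refl _) (Equiv.sumComm _ _)) := by
    apply Subtype.ext
    ext1 i j
    rcases i with i | i | i <;> rcases j with j | j | j <;> rfl
  rw [swap] at s3
  exact (s1.trans (joined_reindex A a₁ (((Equiv.sumCongr (Equiv.refl _)
    (Equiv.sumComm _ _)).trans b₁).trans ε) _)).trans s3

variable (A)

/-- Stable homotopy as an equivalence relation on the disjoint union `W(L, A)` of the sets
`W_n(L, A)`, `n ≥ 1`. -/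
def stableSetoid : Setoid (Σ n : ℕ+, W A n) where
  r H₀ H₁ := StablyHomotopic A H₀.2 H₁.2
  iseqv := ⟨fun H => .refl A H.2, fun h => h.symm, fun h h' => h.trans h'⟩

/-- `K₀^inv(L, A)`: the stable homotopy classes of selfadjoint invertible matrices over
`D(L, A)`. -/
def K0inv : Type _ := Quotient (stableSetoid A)

/-- The pair `(x, y)` is a selfadjoint invertible element of `D(L, A)`. -/
def IsDoubleInv (x y : L) : Prop :=
  ∃ h : (x, y) ∈ double L A,
    IsSelfAdjoint (⟨(x, y), h⟩ : double L A) ∧ IsUnit (⟨(x, y), h⟩ : double L A)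

variable {A}

/-- A selfadjoint invertible element `(x, y)` of `D(L, A)` as an element of `W_1(L, A)`. -/
def IsDoubleInv.toW {x y : L} (h : IsDoubleInv A x y) : W A ((1 : ℕ+) : ℕ) :=
  ⟨Matrix.diagonal fun _ => ⟨(x, y), h.1⟩, by
    refine ⟨?_, ?_⟩
    · rw [Matrix.star_eq_conjTranspose, Matrix.diagonal_conjTranspose]
      exact congrArg Matrix.diagonal (funext fun _ => h.2.1)
    · obtain ⟨u, hu⟩ := h.2.2
      refine ⟨⟨Matrix.diagonal fun _ => (u : double L A),
        Matrix.diagonal fun _ => ((u⁻¹ : Units _) : double L A), ?_, ?_⟩, ?_⟩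
      · rw [Matrix.diagonal_mul_diagonal, Units.mul_inv, Matrix.diagonal_one]
      · rw [Matrix.diagonal_mul_diagonal, Units.inv_mul, Matrix.diagonal_one]
      · exact congrArg Matrix.diagonal (funext fun _ => hu)⟩

/-- The class `[(x, y)] ∈ K₀^inv(L, A)` of a selfadjoint invertible element of `D(L, A)`. -/
def IsDoubleInv.toK0 {x y : L} (h : IsDoubleInv A x y) : K0inv A :=
  Quotient.mk (stableSetoid A) ⟨1, h.toW⟩

end KTheory

/-! ### Even unbounded Kasparov modules and Lipschitz operators -/

section Kasparov

/-- A C⋆-algebra is `σ`-unital if it has a countable approximate unit. -/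
def IsSigmaUnital (B : Type*) [NonUnitalCStarAlgebra B] [PartialOrder B] : Prop :=
  ∃ e : ℕ → B, Monotone e ∧ (∀ n, 0 ≤ e n ∧ ‖e n‖ ≤ 1) ∧
    ∀ b : B, Tendsto (fun n => e n * b) atTop (𝓝 b) ∧ Tendsto (fun n => b * e n) atTop (𝓝 b)

variable (B X : Type*) [NonUnitalCStarAlgebra B] [PartialOrder B] [StarOrderedRing B]
  [SMul B X] [NormedAddCommGroup X] [NormedSpace ℂ X] [CStarModule B X] [CompleteSpace X]

/-- An even unbounded Kasparov module `(X, D)` over `B`: a countably generated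
`ℤ/2ℤ`-graded Hilbert C⋆-module `X` over `B`, with grading operator `γ`, and an odd selfadjoint
and regular unbounded operator `D` with compact resolvent. -/
structure KasparovModule where
  /-- the abstract Dirac operator -/
  D : X →ₗ.[ℂ] X
  /-- the grading operator -/
  γ : Adj B X
  countablyGenerated : ∃ s : Set X, s.Countable ∧
    Dense (Submodule.span ℂ {y : X | ∃ (b : B) (x : X), x ∈ s ∧ y = b • x} : Set X)
  isSelfAdjoint_γ : IsSelfAdjoint γ
  γ_mul_γ : γ * γ = 1
  regular : IsSelfAdjointRegular B D
  γ_mem : ∀ x : D.domain, γ.1 (x : X) ∈ D.domain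
  anticomm : ∀ x : D.domain, D ⟨γ.1 (x : X), γ_mem x⟩ = -γ.1 (D x)
  compact_resolvent : resolvent regular ∈ (compacts B X).carrier

variable {B X}

/-- `S` is the bounded adjointable extension of the commutator `[D, T] : Dom(D) → X`, where `T`
preserves the domain of `D`. -/
def IsCommutator (D : X →ₗ.[ℂ] X) (T S : Adj B X) : Prop :=
  ∃ h : ∀ x : D.domain, T.1 (x : X) ∈ D.domain,
    ∀ x : D.domain, D ⟨T.1 (x : X), h x⟩ - T.1 (D x) = S.1 (x : X)

/-- Lipschitz operators with respect to `D`. -/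
def IsLipschitz (D : X →ₗ.[ℂ] X) (T : Adj B X) : Prop := ∃ S : Adj B X, IsCommutator D T S

/-- The even Lipschitz operators `Lip_D^ev(X)`. -/
def LipEv (K : KasparovModule B X) : Type _ :=
  {T : Adj B X // IsLipschitz K.D T ∧ T * K.γ = K.γ * T}

/-- The operator underlying an even Lipschitz operator. -/
def LipEv.op {K : KasparovModule B X} (T : LipEv K) : Adj B X := T.1

/-- The derivation `d`: `d(T)` is the bounded adjointable extension of `[D, T]`. -/
def LipEv.d {K : KasparovModule B X} (T : LipEv K) : Adj B X := Classical.choose T.2.1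

theorem LipEv.d_spec {K : KasparovModule B X} (T : LipEv K) : IsCommutator K.D T.op T.d :=
  Classical.choose_spec T.2.1

/-- `d(T)` is the only bounded adjointable extension of `[D, T]`. -/
theorem LipEv.d_unique {K : KasparovModule B X} (T : LipEv K) {S : Adj B X}
    (hS : IsCommutator K.D T.op S) : S = T.d := by
  obtain ⟨h, hS⟩ := hS
  obtain ⟨h', hd⟩ := T.d_spec
  apply Subtype.ext
  refine ContinuousLinearMap.ext_on (s := (K.D.domain : Set X)) ?_ fun x hx => ?_
  · exact K.regular.dense_domain.mono Submodule.subset_span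
  · rw [← hS ⟨x, hx⟩, ← hd ⟨x, hx⟩]

/-- The topology on `Lip_D^ev(X)` is that of the norm `‖T‖₁ = ‖T‖ + ‖d(T)‖`. -/
instance (K : KasparovModule B X) : TopologicalSpace (LipEv K) :=
  TopologicalSpace.induced (fun T : LipEv K => (T.op, T.d)) inferInstance

end Kasparov

/-! ### Spectral localizers -/

section Localizer

/-- The Fourier transform `f̂(p) = (2π)^(-1/2) ∫ f(x) e^(-ixp) dx`. -/
def fourierT (f : ℝ → ℝ) (p : ℝ) : ℂ :=
  (1 / Real.sqrt (2 * Real.pi) : ℝ) * ∫ x : ℝ, (f x : ℂ) * Complex.exp (-Complex.I * x * p)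

/-- Localizing functions. -/
structure IsLocalizing (φ : ℝ → ℝ) : Prop where
  continuous : Continuous φ
  integrable : Integrable φ
  mem_Icc : ∀ x, φ x ∈ Set.Icc (0 : ℝ) 1
  even : ∀ x, φ (-x) = φ x
  support_subset : Function.support φ ⊆ Set.Icc (-1) 1
  eq_one : ∀ x ∈ Set.Icc (-(1 / 2) : ℝ) (1 / 2), φ x = 1
  antitone : ∀ x₀ x₁ : ℝ, 0 ≤ x₀ → x₀ ≤ x₁ → φ x₁ ≤ φ x₀
  integrable_fourier : Integrable fun p : ℝ => (p : ℂ) * fourierT φ p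

variable {B X : Type*} [NonUnitalCStarAlgebra B] [PartialOrder B] [StarOrderedRing B]
  [SMul B X] [NormedAddCommGroup X] [NormedSpace ℂ X] [CStarModule B X] [CompleteSpace X]

/-- `Φ_ρ = φ_ρ(D)`, where `φ_ρ(x) = φ(x / ρ)`. -/
def Phi (K : KasparovModule B X) (φ : ℝ → ℝ) (ρ : ℝ) : Adj B X :=
  funcCalc K.regular fun x => (φ (x / ρ) : ℂ)

/-- The bounded operator `D Φ_ρ = (t φ_ρ)(D)`. -/
def DPhi (K : KasparovModule B X) (φ : ℝ → ℝ) (ρ : ℝ) : Adj B X :=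
  funcCalc K.regular fun x => (x : ℂ) * (φ (x / ρ) : ℂ)

/-- `DPhi` is indeed the composition of `D` and `Φ_ρ`. -/
theorem DPhi_apply (K : KasparovModule B X) {φ : ℝ → ℝ} (hφ : IsLocalizing φ) {ρ : ℝ}
    (hρ : 0 < ρ) (x : X) :
    ∃ h : (Phi K φ ρ).1 x ∈ K.D.domain, K.D ⟨(Phi K φ ρ).1 x, h⟩ = (DPhi K φ ρ).1 x := by
  have hc : Continuous fun x : ℝ => ((φ (x / ρ) : ℝ) : ℂ) :=
    Complex.continuous_ofReal.comp (hφ.continuous.comp (by fun_prop))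
  refine funcCalc_mem_domain K.regular hc ?_ x
  refine HasCompactSupport.intro (isCompact_Icc (a := -ρ) (b := ρ)) fun x hx => ?_
  by_contra h0
  have h1 : x / ρ ∈ Set.Icc (-1 : ℝ) 1 :=
    hφ.support_subset fun h => h0 (by rw [h, Complex.ofReal_zero])
  rw [Set.mem_Icc, le_div_iff₀ hρ, div_le_iff₀ hρ] at h1
  exact hx ⟨by linarith [h1.1], by linarith [h1.2]⟩

/-- The spectral localizer
`L_{κ,ρ}(H, D, φ) = Φ_ρ γ H Φ_ρ + κ Φ_{2ρ} D Φ_{2ρ} - (1 - Φ_{2ρ}⁴)^{1/2} γ`. -/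
def localizer (K : KasparovModule B X) (H : Adj B X) (φ : ℝ → ℝ) (κ ρ : ℝ) : Adj B X :=
  Phi K φ ρ * K.γ * H * Phi K φ ρ + (κ : ℂ) • (Phi K φ (2 * ρ) * DPhi K φ (2 * ρ)) -
    cfc Real.sqrt (1 - Phi K φ (2 * ρ) ^ 4) * K.γ

/-- The constant `c_φ = 2 ‖p φ̂(p)‖₁ / (2π)^{1/2}`. -/
def cConst (φ : ℝ → ℝ) : ℝ :=
  2 * (∫ p : ℝ, ‖(p : ℂ) * fourierT φ p‖) / Real.sqrt (2 * Real.pi)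

/-- The quantity `C_{κ,ρ} = (κ + c_φ ‖H‖ / ρ) ‖d(H)‖`. -/
def CConst {K : KasparovModule B X} (H : LipEv K) (φ : ℝ → ℝ) (κ ρ : ℝ) : ℝ :=
  (κ + cConst φ * ‖H.op‖ / ρ) * ‖H.d‖

/-- The gap `g = ‖H⁻¹‖⁻¹` of an invertible operator. -/
def gap (H : Adj B X) : ℝ := ‖Ring.inverse H‖⁻¹

/-- Admissibility of `(κ, ρ)` with respect to `(H, D, φ)`. -/
def Admissible {K : KasparovModule B X} (H : LipEv K) (φ : ℝ → ℝ) (κ ρ : ℝ) : Prop :=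
  0 < κ ∧ 0 < ρ ∧ CConst H φ κ ρ < min (gap H.op ^ 2) (κ ^ 2 * ρ ^ 2 / 4)

/-- `c` is the spectral localizer class of `H`: for every localizing function `φ` and every
admissible pair `(κ, ρ)`, the pair `(-γ, L_{κ,ρ}(H, D, φ))` is a selfadjoint invertible element
of `D(𝕃(X), 𝕂(X))`, whose class in `K₀^inv(𝕃(X), 𝕂(X))` is `c`. -/
def IsLocalizerClass {K : KasparovModule B X} (H : LipEv K) (c : K0inv (compacts B X)) : Prop :=
  ∀ (φ : ℝ → ℝ) (κ ρ : ℝ), IsLocalizing φ → Admissible H φ κ ρ →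
    ∃ h : IsDoubleInv (compacts B X) (-K.γ) (localizer K H.op φ κ ρ), h.toK0 = c

end Localizer

end SpecLoc
end

open SpecLoc

noncomputable section

/-! The heart of the matter is that the square of the localizer `L` is bounded below by a strictly
positive function of `D`. Write F = Φ_ρ. In `localizer_sq` the tail term decouples from F γ H F,
because φ_{2ρ} = 1 on the support of φ_ρ, and from the Dirac term, because γ anticommutes with `D`.
The cross terms of F γ H F with κ D Φ_{2ρ}² add up to -κ F γ d(H) F, a commutator instead of an
anticommutator, again because γ anticommutes with `D`. What remains besides F² H² F² is F E F, where
E consists of commutators [F, H] and κ γ d(H).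

The estimate ‖[Φ_ρ, H]‖ ≤ c_φ ‖d(H)‖ / (2ρ) (`norm_Phi_commutator_le`) gives ‖E‖ ≤ C with C = (κ +
c_φ ‖H‖ / ρ) ‖d(H)‖. It comes from writing φ(b/ρ) as a Fourier integral of unitaries exp(ipb/ρ),
each of whose commutators is bounded by the mean value inequality; bounded truncations `b` of `D`
reduce the unbounded case to this one. Since H² ≥ g², it follows that L² ≥ g² Φ_ρ⁴ - C Φ_ρ² + κ² D²
Φ_{2ρ}⁴ + (1 - Φ_{2ρ}⁴), and admissibility is what keeps this function of `D` away from zero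
(`IsLocalizing.lower_bound`, `isUnit_localizer`). Compactness of -γ - L holds because every other
term contains a function of `D` vanishing at infinity.

Independence of the choices is a homotopy argument. The localizer is norm continuous in φ, κ, ρ and
H together (`continuous_localizer`), so a path of admissible data fixes the class. Localizing
functions form a convex set on which c_φ is convex. Enlarging ρ preserves admissibility, and for
large ρ the only remaining constraint is κ ‖d(H)‖ < g², which is convex in κ. Hence any two
admissible choices are joined by first enlarging ρ, then moving φ and κ along a segment, then
shrinking ρ (`toK0_localizer_eq`). For a path of operators, compactness of [0,1] provides one pair
(κ, ρ) admissible throughout (`exists_admissible_path`). -/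

namespace SpecLoc

/-! ### Functions on the line with a limit at infinity, seen on the circle. -/

section LimAt

/-- `f` is continuous on the real line with limit `l` at infinity. -/
def LimAt (f : ℝ → ℂ) (l : ℂ) : Prop := Continuous f ∧ Tendsto f (cocompact ℝ) (𝓝 l)

variable {f g : ℝ → ℂ} {l m : ℂ}

theorem LimAt.add (hf : LimAt f l) (hg : LimAt g m) : LimAt (fun x => f x + g x) (l + m) :=
  ⟨hf.1.add hg.1, hf.2.add hg.2⟩

theorem LimAt.sub (hf : LimAt f l) (hg : LimAt g m) : LimAt (fun x => f x - g x) (l - m) :=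
  ⟨hf.1.sub hg.1, hf.2.sub hg.2⟩

theorem LimAt.mul (hf : LimAt f l) (hg : LimAt g m) : LimAt (fun x => f x * g x) (l * m) :=
  ⟨hf.1.mul hg.1, hf.2.mul hg.2⟩

theorem LimAt.const (c : ℂ) : LimAt (fun _ => c) c := ⟨continuous_const, tendsto_const_nhds⟩

theorem LimAt.comp (hf : LimAt f l) {k : ℂ → ℂ} (hk : Continuous k) :
    LimAt (fun x => k (f x)) (k l) := ⟨hk.comp hf.1, (hk.tendsto l).comp hf.2⟩

theorem LimAt.comp_neg (hf : LimAt f l) : LimAt (fun x => f (-x)) l :=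
  ⟨hf.1.comp continuous_neg, hf.2.comp (Homeomorph.neg ℝ).isClosedEmbedding.tendsto_cocompact⟩

theorem LimAt.of_hasCompactSupport (hf : Continuous f) (hc : HasCompactSupport f) : LimAt f 0 :=
  ⟨hf, hc.is_zero_at_infty⟩

theorem hasCompactSupport_of_abs_gt {α : Type*} [Zero α] {f : ℝ → α} {R : ℝ}
    (h : ∀ x, R < |x| → f x = 0) : HasCompactSupport f := by
  refine HasCompactSupport.intro (isCompact_Icc (a := -R) (b := R)) fun x hx => h x ?_
  by_contra h'
  exact hx (abs_le.1 (not_lt.1 h'))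

theorem limAt_of_abs_gt (hf : Continuous f) {R : ℝ} (h : ∀ x, R < |x| → f x = 0) : LimAt f 0 :=
  .of_hasCompactSupport hf (hasCompactSupport_of_abs_gt h)

theorem add_I_ne_zero (x : ℝ) : (x : ℂ) + Complex.I ≠ 0 := by
  intro h
  simpa using congrArg Complex.im h

theorem norm_add_I_ge (x : ℝ) : |x| ≤ ‖(x : ℂ) + Complex.I‖ := by
  simpa using Complex.abs_re_le_norm ((x : ℂ) + Complex.I)

theorem limAt_inv_add_I : LimAt (fun x : ℝ => ((x : ℂ) + Complex.I)⁻¹) 0 := by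
  refine ⟨Continuous.inv₀ (by fun_prop) add_I_ne_zero, ?_⟩
  refine tendsto_inv₀_cobounded.comp ?_
  rw [← tendsto_norm_atTop_iff_cobounded]
  exact tendsto_atTop_mono norm_add_I_ge tendsto_norm_cocompact_atTop

/-- The value at the point `1` of the circle is a `limUnder`, which is meaningless unless the limit
exists; for this reason `LimAt` accompanies the functions to which the calculus is applied. -/
theorem onCircle_one (hf : LimAt f l) : onCircle f 1 = l := by
  simp only [onCircle, if_true, hf.2.limUnder_eq]

theorem onCircle_ne_one (f : ℝ → ℂ) {z : ℂ} (h : z ≠ 1) :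
    onCircle f z = f (-Complex.I * (z + 1) / (z - 1)).re := by
  simp only [onCircle, h, if_false]

theorem onCircle_comp (hf : LimAt f l) {k : ℂ → ℂ} (hk : Continuous k) (z : ℂ) :
    onCircle (fun x => k (f x)) z = k (onCircle f z) := by
  by_cases h : z = 1
  · subst h; rw [onCircle_one hf, onCircle_one (hf.comp hk)]
  · simp only [onCircle_ne_one _ h]

theorem onCircle_add (hf : LimAt f l) (hg : LimAt g m) (z : ℂ) :
    onCircle (fun x => f x + g x) z = onCircle f z + onCircle g z := by
  by_cases h : z = 1
  · subst h; rw [onCircle_one hf, onCircle_one hg, onCircle_one (hf.add hg)]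
  · simp only [onCircle_ne_one _ h]

theorem onCircle_mul (hf : LimAt f l) (hg : LimAt g m) (z : ℂ) :
    onCircle (fun x => f x * g x) z = onCircle f z * onCircle g z := by
  by_cases h : z = 1
  · subst h; rw [onCircle_one hf, onCircle_one hg, onCircle_one (hf.mul hg)]
  · simp only [onCircle_ne_one _ h]

theorem LimAt.norm_lim_le (hf : LimAt f l) {C : ℝ} (h : ∀ x, ‖f x‖ ≤ C) : ‖l‖ ≤ C :=
  le_of_tendsto hf.2.norm (Eventually.of_forall h)

end LimAt

/-! ### Functional calculus of `D`: homomorphism rules, commutators, compactness, continuity. -/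

section FuncCalc

variable {B X : Type*} [NonUnitalCStarAlgebra B] [PartialOrder B] [StarOrderedRing B]
  [SMul B X] [NormedAddCommGroup X] [NormedSpace ℂ X] [CStarModule B X]
  [CompleteSpace X] {D : X →ₗ.[ℂ] X} (hD : IsSelfAdjointRegular B D)
  {f g : ℝ → ℂ} {l m : ℂ}

theorem LimAt.continuousOn (hf : LimAt f l) :
    ContinuousOn (onCircle f) (spectrum ℂ (cayley hD)) :=
  (continuousOn_onCircle hf.1 hf.2).mono (spectrum_cayley_subset hD)

theorem funcCalc_add (hf : LimAt f l) (hg : LimAt g m) :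
    funcCalc hD (fun x => f x + g x) = funcCalc hD f + funcCalc hD g := by
  rw [funcCalc, funcCalc, funcCalc, ← cfc_add _ _ _ (hf.continuousOn hD) (hg.continuousOn hD)]
  exact cfc_congr fun z _ => onCircle_add hf hg z

theorem funcCalc_mul (hf : LimAt f l) (hg : LimAt g m) :
    funcCalc hD (fun x => f x * g x) = funcCalc hD f * funcCalc hD g := by
  rw [funcCalc, funcCalc, funcCalc, ← cfc_mul _ _ _ (hf.continuousOn hD) (hg.continuousOn hD)]
  exact cfc_congr fun z _ => onCircle_mul hf hg z

theorem funcCalc_const (c : ℂ) : funcCalc hD (fun _ => c) = algebraMap ℂ (Adj B X) c := by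
  have := isStarNormal_cayley hD
  rw [funcCalc, ← cfc_const c (cayley hD)]
  exact cfc_congr fun z _ => onCircle_comp (LimAt.const 0) continuous_const z

theorem funcCalc_one : funcCalc hD (fun _ => 1) = 1 := by
  rw [funcCalc_const, map_one]

theorem funcCalc_smul (c : ℂ) (hf : LimAt f l) :
    funcCalc hD (fun x => c * f x) = c • funcCalc hD f := by
  rw [funcCalc_mul hD (.const c) hf, funcCalc_const, Algebra.smul_def]

theorem funcCalc_sub (hf : LimAt f l) (hg : LimAt g m) :
    funcCalc hD (fun x => f x - g x) = funcCalc hD f - funcCalc hD g := by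
  rw [eq_sub_iff_add_eq, ← funcCalc_add hD (hf.sub hg) hg]
  simp

theorem funcCalc_star (hf : LimAt f l) :
    star (funcCalc hD f) = funcCalc hD (fun x => star (f x)) := by
  rw [funcCalc, funcCalc, ← cfc_star]
  exact cfc_congr fun z _ => (onCircle_comp hf continuous_star z).symm

theorem isSelfAdjoint_funcCalc {f : ℝ → ℝ} (hf : LimAt (fun x => (f x : ℂ)) l) :
    IsSelfAdjoint (funcCalc hD fun x => (f x : ℂ)) := by
  rw [IsSelfAdjoint, funcCalc_star hD hf]
  simp

theorem funcCalc_commute (hf : LimAt f l) (hg : LimAt g m) :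
    Commute (funcCalc hD f) (funcCalc hD g) := by
  rw [Commute, SemiconjBy, ← funcCalc_mul hD hf hg, ← funcCalc_mul hD hg hf]
  simp only [mul_comm]

theorem norm_funcCalc_le (hf : LimAt f l) {C : ℝ} (h : ∀ x, ‖f x‖ ≤ C) :
    ‖funcCalc hD f‖ ≤ C := by
  refine norm_cfc_le ((norm_nonneg _).trans (h 0)) fun z _ => ?_
  by_cases h1 : z = 1
  · subst h1; rw [onCircle_one hf]; exact hf.norm_lim_le h
  · rw [onCircle_ne_one _ h1]; exact h _

theorem funcCalc_comp (hf : LimAt f l) {k : ℂ → ℂ} (hk : Continuous k) :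
    funcCalc hD (fun x => k (f x)) = cfc k (funcCalc hD f) := by
  have := isStarNormal_cayley hD
  rw [funcCalc, funcCalc, ← cfc_comp' k (onCircle f) (cayley hD) hk.continuousOn
    (hf.continuousOn hD)]
  exact cfc_congr fun z _ => onCircle_comp hf hk z

/-- The Cayley transform is affine in the resolvent, so the resolvent is the function (1 - z) / 2i
of it, and this is 1 / (t + i) in the coordinate of the line. The lemma links the calculus to `D`
itself. -/
theorem resolvent_eq_funcCalc :
    resolvent hD = funcCalc hD (fun x : ℝ => ((x : ℂ) + Complex.I)⁻¹) := by
  have hn := isStarNormal_cayley hD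
  have hres : resolvent hD = cfc (fun z : ℂ => (2 * Complex.I)⁻¹ * (1 - z)) (cayley hD) := by
    rw [cfc_const_mul _ _ _ (by fun_prop), cfc_sub _ _ _ (by fun_prop) (by fun_prop),
      cfc_const_one ℂ (cayley hD), cfc_id' ℂ (cayley hD), cayley, sub_sub_cancel, smul_smul,
      inv_mul_cancel₀ (by simp), one_smul]
  rw [hres, funcCalc]
  refine cfc_congr fun z hz => ?_
  by_cases h1 : z = 1
  · subst h1; rw [onCircle_one limAt_inv_add_I]; simp
  · have hr := inv_cayley_real (mem_sphere_zero_iff_norm.1 (spectrum_cayley_subset hD hz)) h1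
    rw [onCircle_ne_one _ h1, hr]
    have h2 : z - 1 ≠ 0 := sub_ne_zero.2 h1
    refine eq_inv_of_mul_eq_one_left ?_
    field_simp
    ring

/-- Since γ D γ = -D, conjugation by γ takes (D + i)⁻¹ to -(D - i)⁻¹ and hence the Cayley transform
to its adjoint. Complex conjugation on the circle corresponds to t ↦ -t on the line. -/
theorem funcCalc_comp_neg_of_anticomm (hf : LimAt f l) {γ : Adj B X} (hγ : IsSelfAdjoint γ)
    (hγγ : γ * γ = 1) (hmem : ∀ x : D.domain, γ.1 (x : X) ∈ D.domain)
    (hanti : ∀ x : D.domain, D ⟨γ.1 (x : X), hmem x⟩ = -γ.1 (D x)) :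
    γ * funcCalc hD f = funcCalc hD (fun x => f (-x)) * γ := by
  have hγγ' (x : X) : γ.1 (γ.1 x) = x := congrArg (fun T : Adj B X => T.1 x) hγγ
  have hres : γ * resolvent hD * γ = - star (resolvent hD) := by
    apply Subtype.ext
    ext x
    change γ.1 ((resolvent hD).1 (γ.1 x)) = -(star (resolvent hD)).1 x
    have h1 := resolvent_spec hD (γ.1 x)
    set r : D.domain := ⟨(resolvent hD).1 (γ.1 x), resolvent_mem hD (γ.1 x)⟩ with hr
    rw [star_resolvent_apply, eq_comm, neg_eq_iff_eq_neg,
      hD.inv_unique (-Complex.I) (.inr rfl) (x := -⟨γ.1 (r : X), hmem r⟩)]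
    · rfl
    · rw [LinearPMap.map_neg, hanti, neg_neg, Submodule.coe_neg, smul_neg, neg_smul, neg_neg,
        ← map_smul, ← map_add, ← hγγ' x]
      exact congrArg _ h1
  have hcay : γ * cayley hD * γ = star (cayley hD) := by
    have h2 : γ * cayley hD * γ = γ * γ - (2 * Complex.I) • (γ * resolvent hD * γ) := by
      rw [cayley, mul_sub, sub_mul, mul_one, mul_smul_comm, smul_mul_assoc]
    rw [h2, hres, hγγ, cayley, star_sub, star_one, star_smul]
    simp
  have hu : γ ∈ unitary (Adj B X) := by
    rw [Unitary.mem_iff, hγ.star_eq]; exact ⟨hγγ, hγγ⟩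
  have hn := isStarNormal_cayley hD
  have key : γ * funcCalc hD f * γ = funcCalc hD (fun x => f (-x)) := by
    let ψ := Unitary.conjStarAlgAut ℂ (Adj B X) ⟨γ, hu⟩
    have hψ (T : Adj B X) : ψ T = γ * T * γ := by
      change γ * T * star γ = _
      rw [hγ.star_eq]
    have hψc : Continuous ψ := by
      have : (ψ : Adj B X → Adj B X) = fun T => γ * T * γ := funext hψ
      rw [this]; fun_prop
    rw [← hψ, funcCalc, StarAlgHomClass.map_cfc ψ (onCircle f) (cayley hD)
      (hf.continuousOn hD) hψc hn (by rw [hψ, hcay]; infer_instance), hψ, hcay]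
    have hc : ContinuousOn (onCircle f) (star '' spectrum ℂ (cayley hD)) := by
      refine (continuousOn_onCircle hf.1 hf.2).mono ?_
      rintro _ ⟨z, hz, rfl⟩
      simpa using spectrum_cayley_subset hD hz
    rw [← cfc_comp_star (onCircle f) (cayley hD) hc hn]
    refine cfc_congr fun z hz => ?_
    by_cases h1 : z = 1
    · subst h1; rw [star_one, onCircle_one hf, onCircle_one hf.comp_neg]
    · have h1' : star z ≠ 1 := fun h => h1 (by rw [← star_star z, h, star_one])
      rw [onCircle_ne_one _ h1, onCircle_ne_one _ h1']
      congr 1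
      have e : -Complex.I * (star z + 1) / (star z - 1) =
          -star (-Complex.I * (z + 1) / (z - 1)) := by
        simp [neg_div]
      rw [e, Complex.neg_re, Complex.star_def, Complex.conj_re]
  rw [← key, mul_assoc, hγγ, mul_one]

theorem coe_mul_apply (S T : Adj B X) (x : X) : (S * T).1 x = S.1 (T.1 x) := rfl

theorem coe_sub_apply (S T : Adj B X) (x : X) : (S - T).1 x = S.1 x - T.1 x := rfl

theorem norm_apply_le (T : Adj B X) (x : X) : ‖T.1 x‖ ≤ ‖T‖ * ‖x‖ := T.1.le_opNorm x

theorem norm_le_of_apply {T : Adj B X} {C : ℝ} (hC : 0 ≤ C) (h : ∀ x, ‖T.1 x‖ ≤ C * ‖x‖) :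
    ‖T‖ ≤ C := ContinuousLinearMap.opNorm_le_bound T.1 hC h

theorem domain_eq_resolvent (x : D.domain) :
    (resolvent hD).1 (D x + Complex.I • (x : X)) = x :=
  congrArg Subtype.val (hD.inv_unique Complex.I (.inl rfl) rfl)

/-- `f(D) D x = (t f)(D) x` on the domain of `D`. -/
theorem funcCalc_apply_D (hf : LimAt f l) (hxf : LimAt (fun x : ℝ => (x : ℂ) * f x) m)
    (x : D.domain) :
    (funcCalc hD f).1 (D x) = (funcCalc hD fun t : ℝ => (t : ℂ) * f t).1 x := by
  set y := D x + Complex.I • (x : X) with hy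
  have hx : (resolvent hD).1 y = x := domain_eq_resolvent hD x
  have h1 : D x = y - Complex.I • (resolvent hD).1 y := by rw [hx, hy]; abel
  have hr := limAt_inv_add_I
  -- With the vector written as (D + i)⁻¹ y, the claim becomes the scalar identity f - i f / (t + i)
  -- = t f / (t + i).
  have e : funcCalc hD f - Complex.I • (funcCalc hD f * resolvent hD) =
      (funcCalc hD fun t : ℝ => (t : ℂ) * f t) * resolvent hD := by
    rw [resolvent_eq_funcCalc, ← funcCalc_mul hD hf hr, ← funcCalc_smul hD _ (hf.mul hr),
      ← funcCalc_sub hD hf ((LimAt.const _).mul (hf.mul hr)), ← funcCalc_mul hD hxf hr]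
    congr 1
    funext t
    have := add_I_ne_zero t
    field_simp
    ring
  rw [h1, ← hx, ← coe_mul_apply, ← e, map_sub, map_smul]
  rfl

theorem LimAt.id_mul_of_abs_gt (hf : Continuous f) {R : ℝ} (h : ∀ x, R < |x| → f x = 0) :
    LimAt (fun x : ℝ => (x : ℂ) * f x) 0 :=
  limAt_of_abs_gt (R := R) (by fun_prop) fun x hx => by rw [h x hx, mul_zero]

/-- Compression of the commutator `[D, T]` by a compactly supported function of `D`. -/
theorem funcCalc_commutator (hf : Continuous f) {R : ℝ} (h0 : ∀ x, R < |x| → f x = 0)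
    {T S : Adj B X} (hTS : IsCommutator D T S) :
    (funcCalc hD fun t : ℝ => (t : ℂ) * f t) * T * funcCalc hD f -
      funcCalc hD f * T * (funcCalc hD fun t : ℝ => (t : ℂ) * f t) =
      funcCalc hD f * S * funcCalc hD f := by
  obtain ⟨hT, hS⟩ := hTS
  apply Subtype.ext
  ext y
  obtain ⟨hm, hv⟩ := funcCalc_mem_domain hD hf (hasCompactSupport_of_abs_gt h0) y
  have h1 := funcCalc_apply_D hD (limAt_of_abs_gt hf h0) (LimAt.id_mul_of_abs_gt hf h0)
    ⟨T.1 ((funcCalc hD f).1 y), hT ⟨_, hm⟩⟩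
  have h2 := hS ⟨_, hm⟩
  rw [hv] at h2
  simp only [coe_sub_apply, coe_mul_apply]
  change (funcCalc hD fun t : ℝ => (t : ℂ) * f t).1 (T.1 ((funcCalc hD f).1 y)) -
    (funcCalc hD f).1 (T.1 ((funcCalc hD fun t : ℝ => (t : ℂ) * f t).1 y)) =
    (funcCalc hD f).1 (S.1 ((funcCalc hD f).1 y))
  rw [← h2, map_sub, h1]

/-- A continuous cut-off function, equal to `1` on `[-n, n]` and supported in `[-n-1, n+1]`. -/
def cutoff (n : ℝ) (x : ℝ) : ℝ := max 0 (min 1 (n + 1 - |x|))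

theorem continuous_cutoff (n : ℝ) : Continuous (cutoff n) := by unfold cutoff; fun_prop

theorem cutoff_nonneg (n x : ℝ) : 0 ≤ cutoff n x := le_max_left _ _

theorem cutoff_le_one (n x : ℝ) : cutoff n x ≤ 1 := max_le zero_le_one (min_le_left _ _)

theorem cutoff_eq_one {n x : ℝ} (h : |x| ≤ n) : cutoff n x = 1 := by
  rw [cutoff, min_eq_left (by linarith), max_eq_right zero_le_one]

theorem cutoff_eq_zero {n x : ℝ} (h : n + 1 < |x|) : cutoff n x = 0 :=
  max_eq_left ((min_le_right _ _).trans (by linarith))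

theorem continuous_cutoff_complex (n : ℝ) : Continuous fun x => (cutoff n x : ℂ) :=
  Complex.continuous_ofReal.comp (continuous_cutoff n)

theorem limAt_cutoff (n : ℝ) : LimAt (fun x => (cutoff n x : ℂ)) 0 :=
  limAt_of_abs_gt (R := n + 1) (continuous_cutoff_complex n) fun x hx => by
    rw [cutoff_eq_zero hx, Complex.ofReal_zero]

theorem norm_cutoff_le (n x : ℝ) : ‖(cutoff n x : ℂ)‖ ≤ 1 := by
  rw [Complex.norm_real, Real.norm_of_nonneg (cutoff_nonneg n x)]; exact cutoff_le_one n x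

theorem tendsto_cutoff_mul (hf : LimAt f 0) :
    Tendsto (fun n : ℕ => funcCalc hD fun x => (cutoff n x : ℂ) * f x) atTop
      (𝓝 (funcCalc hD f)) := by
  rw [Metric.tendsto_atTop]
  intro ε hε
  have h1 := (Metric.tendsto_nhds.1 hf.2) (ε / 2) (by positivity)
  rw [← Metric.cobounded_eq_cocompact, (Metric.hasBasis_cobounded_compl_closedBall 0).eventually_iff] at h1
  obtain ⟨R, -, hR⟩ := h1
  obtain ⟨N, hN⟩ := exists_nat_ge R
  refine ⟨N, fun n hn => ?_⟩
  have hl : LimAt (fun x => (cutoff n x : ℂ) * f x) (0 * 0) := (limAt_cutoff n).mul hf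
  rw [dist_eq_norm, ← funcCalc_sub hD hl hf]
  refine lt_of_le_of_lt (norm_funcCalc_le hD (hl.sub hf) (C := ε / 2) fun x => ?_) (by linarith)
  by_cases hx : |x| ≤ n
  · rw [cutoff_eq_one hx]; simp; positivity
  · have hnN : (N : ℝ) ≤ n := by exact_mod_cast hn
    have h2 : dist (f x) 0 < ε / 2 := hR (by
      simp only [Set.mem_compl_iff, Metric.mem_closedBall, dist_zero_right, Real.norm_eq_abs]
      push Not at hx ⊢; linarith)
    have h3 : (cutoff n x : ℂ) * f x - f x = -((1 - cutoff n x : ℝ) : ℂ) * f x := by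
      push_cast; ring
    rw [h3, norm_mul, norm_neg, Complex.norm_real,
      Real.norm_of_nonneg (by linarith [cutoff_le_one n x])]
    rw [dist_zero_right] at h2
    calc _ ≤ 1 * ‖f x‖ := by gcongr; linarith [cutoff_nonneg n x]
      _ ≤ _ := by linarith

/-- A compactly supported function is 1 / (t + i) times a bounded one, so it gives a multiple of the
compact resolvent; functions vanishing at infinity are uniform limits of such functions. -/
theorem funcCalc_mem_compacts (hc : resolvent hD ∈ (compacts B X).carrier) (hf : LimAt f 0) :
    funcCalc hD f ∈ (compacts B X).carrier := by
  refine (compacts B X).isClosed.mem_of_tendsto (tendsto_cutoff_mul hD hf)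
    (Eventually.of_forall fun n => ?_)
  have h0 : ∀ x : ℝ, (n : ℝ) + 1 < |x| →
      ((x : ℂ) + Complex.I) * ((cutoff n x : ℂ) * f x) = 0 := fun x hx => by
    rw [cutoff_eq_zero hx]; simp
  have hcont := continuous_cutoff_complex n
  have hfc := hf.1
  have hl := limAt_of_abs_gt (by fun_prop) h0
  have e : (funcCalc hD fun x => (cutoff n x : ℂ) * f x) = resolvent hD *
      funcCalc hD (fun x : ℝ => ((x : ℂ) + Complex.I) * ((cutoff n x : ℂ) * f x)) := by
    rw [resolvent_eq_funcCalc, ← funcCalc_mul hD limAt_inv_add_I hl]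
    congr 1
    funext x
    rw [inv_mul_cancel_left₀ (add_I_ne_zero x)]
  change funcCalc hD (fun x => (cutoff n x : ℂ) * f x) ∈ (compacts B X).carrier
  rw [e]
  exact (compacts B X).mul_mem_right _ hc

/-- The cut-off functions of `D` converge strongly to the identity. -/
theorem tendsto_cutoff_apply (y : X) :
    Tendsto (fun n : ℕ => (funcCalc hD fun x => (cutoff n x : ℂ)).1 y) atTop (𝓝 y) := by
  set χ : ℕ → Adj B X := fun n => funcCalc hD fun x => (cutoff n x : ℂ) with hχ
  have hn (n : ℕ) : ‖χ n‖ ≤ 1 := norm_funcCalc_le hD (limAt_cutoff n) (norm_cutoff_le n)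
  rw [Metric.tendsto_atTop]
  intro ε hε
  obtain ⟨x, hx, hxy⟩ := Metric.dense_iff.1 hD.dense_domain y (ε / 4) (by positivity)
  rw [Metric.mem_ball, dist_eq_norm] at hx
  set z := D ⟨x, hxy⟩ + Complex.I • x
  have hz : (resolvent hD).1 z = x := domain_eq_resolvent hD ⟨x, hxy⟩
  -- On the dense domain x = (D + i)⁻¹ z, so convergence there follows from norm convergence of χ_n
  -- (D + i)⁻¹. The contractions χ_n carry it over to all of `X`.
  have h1 : Tendsto (fun n : ℕ => (χ n).1 x) atTop (𝓝 x) := by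
    have h2 := tendsto_cutoff_mul hD limAt_inv_add_I
    have h3 : Tendsto (fun n : ℕ => (funcCalc hD fun x =>
        (cutoff n x : ℂ) * ((x : ℂ) + Complex.I)⁻¹).1 z) atTop (𝓝 ((resolvent hD).1 z)) := by
      rw [resolvent_eq_funcCalc]
      rw [tendsto_iff_norm_sub_tendsto_zero] at h2 ⊢
      refine squeeze_zero (fun _ => norm_nonneg _) (fun n => norm_apply_le
        ((funcCalc hD fun x : ℝ => (cutoff n x : ℂ) * ((x : ℂ) + Complex.I)⁻¹) -
          funcCalc hD fun x : ℝ => ((x : ℂ) + Complex.I)⁻¹) z) ?_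
      simpa using h2.mul_const ‖z‖
    rw [hz] at h3
    refine h3.congr fun n => ?_
    rw [funcCalc_mul hD (limAt_cutoff n) limAt_inv_add_I, ← resolvent_eq_funcCalc,
      coe_mul_apply, hz]
  obtain ⟨N, hN⟩ := Metric.tendsto_atTop.1 h1 (ε / 4) (by positivity)
  refine ⟨N, fun n hnN => ?_⟩
  have h4 := hN n hnN
  rw [dist_eq_norm] at h4 ⊢
  have h5 : (χ n).1 y - y = -(χ n).1 (x - y) + ((χ n).1 x - x) + (x - y) := by
    rw [map_sub]; abel
  have h6 : ‖(χ n).1 (x - y)‖ ≤ ‖x - y‖ := (norm_apply_le _ _).trans (by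
    have := hn n; nlinarith [norm_nonneg (x - y)])
  rw [h5]
  calc _ ≤ ‖-(χ n).1 (x - y)‖ + ‖(χ n).1 x - x‖ + ‖x - y‖ := norm_add₃_le
    _ < ε := by rw [norm_neg]; linarith

/-- Norm continuity of the functional calculus in families with uniform compact support. -/
theorem continuous_funcCalc_family {Y : Type*} [TopologicalSpace Y] {F : Y → ℝ → ℂ}
    (hF : Continuous fun p : Y × ℝ => F p.1 p.2) {R : ℝ} (h0 : ∀ t x, R < |x| → F t x = 0) :
    Continuous fun t => funcCalc hD (F t) := by
  have hl (t : Y) : LimAt (F t) 0 := limAt_of_abs_gt (by fun_prop) (h0 t)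
  -- Joint continuity makes the curried map continuous for the compact-open topology, which is
  -- uniform convergence on [-R, R]; outside that interval all members vanish.
  let G : C(Y, C(ℝ, ℂ)) := ContinuousMap.curry ⟨fun p : Y × ℝ => F p.1 p.2, hF⟩
  rw [continuous_iff_continuousAt]
  intro t
  have h1 := (ContinuousMap.tendsto_iff_forall_isCompact_tendstoUniformlyOn.1
    (G.continuous.tendsto t)) (Set.Icc (-R) R) isCompact_Icc
  rw [Metric.tendstoUniformlyOn_iff] at h1
  rw [ContinuousAt, Metric.tendsto_nhds]
  intro ε hε
  filter_upwards [h1 (ε / 2) (by positivity)] with s hs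
  rw [dist_eq_norm, ← funcCalc_sub hD (hl s) (hl t)]
  refine lt_of_le_of_lt (norm_funcCalc_le hD ((hl s).sub (hl t)) (C := ε / 2) fun x => ?_)
    (by linarith)
  by_cases hx : |x| ≤ R
  · have := hs x (abs_le.1 hx)
    rw [dist_comm, dist_eq_norm] at this
    exact this.le
  · rw [h0 s x (not_le.1 hx), h0 t x (not_le.1 hx)]; simp; positivity

end FuncCalc

/-! ### Fourier transform of localizing functions, convexity, and existence. -/

section Fourier

open scoped FourierTransform ContDiff

variable {φ ψ : ℝ → ℝ}

theorem sqrt_two_pi_pos : 0 < Real.sqrt (2 * Real.pi) := Real.sqrt_pos.2 (by positivity)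

/-- Conversion to the normalization of `𝓕`, whose kernel is exp(-2πixw) with no prefactor. -/
theorem fourierT_eq (f : ℝ → ℝ) (p : ℝ) :
    fourierT f p = (1 / Real.sqrt (2 * Real.pi) : ℝ) *
      𝓕 (fun x : ℝ => (f x : ℂ)) (p / (2 * Real.pi)) := by
  rw [fourierT, Real.fourier_real_eq_integral_exp_smul]
  congr 2
  funext x
  rw [smul_eq_mul, mul_comm]
  congr 2
  have h : (Real.pi : ℂ) ≠ 0 := by exact_mod_cast Real.pi_ne_zero
  push_cast
  field_simp

theorem continuous_fourierT (hφ : Integrable φ) : Continuous (fourierT φ) := by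
  have h1 : Continuous (𝓕 (fun x : ℝ => (φ x : ℂ))) :=
    VectorFourier.fourierIntegral_continuous Real.continuous_fourierChar
      (by fun_prop) hφ.ofReal
  have h2 : fourierT φ = fun p => (1 / Real.sqrt (2 * Real.pi) : ℝ) *
      𝓕 (fun x : ℝ => (φ x : ℂ)) (p / (2 * Real.pi)) := funext (fourierT_eq φ)
  rw [h2]
  fun_prop

/-- The transform is continuous, hence bounded on [-1, 1], and for |p| ≥ 1 it is dominated by the
integrable function |p φ̂(p)|. Integrability is what Fourier inversion requires. -/
theorem IsLocalizing.integrable_fourierT (hφ : IsLocalizing φ) : Integrable (fourierT φ) := by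
  have hc := continuous_fourierT hφ.integrable
  obtain ⟨M, hM⟩ := (isCompact_Icc (a := (-1 : ℝ)) (b := 1)).exists_bound_of_continuousOn
    hc.continuousOn
  have h1 : Integrable ((Set.Icc (-1 : ℝ) 1).indicator fun _ => M) := by
    rw [integrable_indicator_iff measurableSet_Icc]
    exact integrableOn_const (by simp)
  refine (h1.add hφ.integrable_fourier.norm).mono' hc.aestronglyMeasurable
    (Eventually.of_forall fun p => ?_)
  by_cases hp : p ∈ Set.Icc (-1 : ℝ) 1
  · simp only [Pi.add_apply, Set.indicator_of_mem hp]
    have := hM p hp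
    have := norm_nonneg ((p : ℂ) * fourierT φ p)
    linarith
  · simp only [Pi.add_apply, Set.indicator_of_notMem hp, zero_add, norm_mul, Complex.norm_real]
    have h2 : 1 ≤ ‖p‖ := by
      rw [Real.norm_eq_abs]
      by_contra h
      exact hp (abs_le.1 (not_le.1 h).le)
    nlinarith [norm_nonneg (fourierT φ p)]

/-- Fourier inversion for localizing functions. -/
theorem IsLocalizing.inversion (hφ : IsLocalizing φ) (x : ℝ) :
    (φ x : ℂ) = (1 / Real.sqrt (2 * Real.pi) : ℝ) *
      ∫ p : ℝ, fourierT φ p * Complex.exp (Complex.I * p * x) := by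
  have hs := sqrt_two_pi_pos
  set f : ℝ → ℂ := fun x => (φ x : ℂ) with hf
  have hfc : Continuous f := Complex.continuous_ofReal.comp hφ.continuous
  have e1 (w : ℝ) : 𝓕 f w = (Real.sqrt (2 * Real.pi) : ℝ) * fourierT φ (w * (2 * Real.pi)) := by
    rw [fourierT_eq, ← mul_assoc, ← Complex.ofReal_mul, mul_one_div_cancel hs.ne',
      mul_div_cancel_right₀ _ (by positivity), Complex.ofReal_one, one_mul]
  have hF : Integrable (𝓕 f) := by
    have : 𝓕 f = fun w => (Real.sqrt (2 * Real.pi) : ℝ) * fourierT φ (w * (2 * Real.pi)) :=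
      funext e1
    rw [this]
    exact (hφ.integrable_fourierT.comp_mul_right' (by positivity)).const_mul _
  have h := hφ.integrable.ofReal.fourierInv_fourier_eq hF hfc.continuousAt (v := x)
  change 𝓕⁻ (𝓕 f) x = f x at h
  change f x = _
  rw [← h, Real.fourierInv_eq']
  have e2 : (fun v : ℝ => Complex.exp (↑(2 * Real.pi * inner ℝ v x) * Complex.I) • 𝓕 f v) =
      fun v => (fun p : ℝ => (Real.sqrt (2 * Real.pi) : ℝ) * (fourierT φ p *
        Complex.exp (Complex.I * p * x))) (v * (2 * Real.pi)) := by
    funext v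
    rw [e1, smul_eq_mul]
    have : (↑(2 * Real.pi * inner ℝ v x) * Complex.I : ℂ) =
        Complex.I * ((v * (2 * Real.pi) : ℝ) : ℂ) * x := by
      simp; ring
    rw [this]
    ring
  rw [e2, Measure.integral_comp_mul_right (fun p : ℝ => (Real.sqrt (2 * Real.pi) : ℝ) *
      (fourierT φ p * Complex.exp (Complex.I * p * x))), integral_const_mul, abs_of_pos (by positivity),
    Complex.real_smul, ← mul_assoc, ← Complex.ofReal_mul]
  congr 2
  rw [inv_mul_eq_div, div_eq_div_iff (by positivity) hs.ne',
    Real.mul_self_sqrt (by positivity), one_mul]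

theorem cConst_nonneg (φ : ℝ → ℝ) : 0 ≤ cConst φ := by
  unfold cConst
  have : 0 ≤ ∫ p : ℝ, ‖(p : ℂ) * fourierT φ p‖ := integral_nonneg fun _ => norm_nonneg _
  positivity

theorem fourierT_convex (hφ : Integrable φ) (hψ : Integrable ψ) (s : ℝ) (p : ℝ) :
    fourierT (fun x => (1 - s) * φ x + s * ψ x) p =
      (1 - s : ℝ) * fourierT φ p + (s : ℝ) * fourierT ψ p := by
  have h : ∀ {f : ℝ → ℝ}, Integrable f →
      Integrable fun x : ℝ => (f x : ℂ) * Complex.exp (-Complex.I * x * p) := fun {f} hf => by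
    refine hf.norm.mono' (hf.ofReal.aestronglyMeasurable.mul
      (Continuous.aestronglyMeasurable (by fun_prop))) (Eventually.of_forall fun x => ?_)
    have : -Complex.I * x * p = ((-(x * p) : ℝ) : ℂ) * Complex.I := by push_cast; ring
    rw [norm_mul, this, Complex.norm_exp_ofReal_mul_I, mul_one, Complex.norm_real]
  have e : ∫ x : ℝ, (((1 - s) * φ x + s * ψ x : ℝ) : ℂ) * Complex.exp (-Complex.I * x * p) =
      ((1 - s : ℝ) : ℂ) * (∫ x : ℝ, (φ x : ℂ) * Complex.exp (-Complex.I * x * p)) +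
      (s : ℂ) * ∫ x : ℝ, (ψ x : ℂ) * Complex.exp (-Complex.I * x * p) := by
    rw [← integral_const_mul, ← integral_const_mul,
      ← integral_add ((h hφ).const_mul _) ((h hψ).const_mul _)]
    congr 1
    funext x
    push_cast
    ring
  simp only [fourierT]
  rw [e]
  ring

/-- Convexity supplies the segment along which two localizing functions are deformed into each
other. -/
theorem IsLocalizing.convex (hφ : IsLocalizing φ) (hψ : IsLocalizing ψ) {s : ℝ}
    (hs : s ∈ Set.Icc (0 : ℝ) 1) : IsLocalizing (fun x => (1 - s) * φ x + s * ψ x) := by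
  have h0 := hs.1
  have h1 : 0 ≤ 1 - s := sub_nonneg.2 hs.2
  refine ⟨?_, ?_, ?_, ?_, ?_, ?_, ?_, ?_⟩
  · have := hφ.continuous
    have := hψ.continuous
    fun_prop
  · exact (hφ.integrable.const_mul _).add (hψ.integrable.const_mul _)
  · exact fun x => (convex_Icc (0 : ℝ) 1) (hφ.mem_Icc x) (hψ.mem_Icc x) h1 h0 (by ring)
  · intro x
    rw [hφ.even, hψ.even]
  · intro x hx
    by_contra hx'
    have e1 : φ x = 0 := by_contra fun h => hx' (hφ.support_subset h)
    have e2 : ψ x = 0 := by_contra fun h => hx' (hψ.support_subset h)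
    exact hx (by simp [e1, e2])
  · intro x hx
    rw [hφ.eq_one x hx, hψ.eq_one x hx]; ring
  · intro x₀ x₁ h h'
    have := hφ.antitone _ _ h h'
    have := hψ.antitone _ _ h h'
    gcongr
  · refine ((hφ.integrable_fourier.const_mul ((1 - s : ℝ) : ℂ)).add
      (hψ.integrable_fourier.const_mul (s : ℂ))).congr (Eventually.of_forall fun p => ?_)
    simp only [fourierT_convex hφ.integrable hψ.integrable, Pi.add_apply]
    ring

/-- The constant is a weighted L¹ norm of a linear transform, hence convex. The bound by the maximum
keeps admissibility under control along a segment of localizing functions. -/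
theorem cConst_convex_le (hφ : IsLocalizing φ) (hψ : IsLocalizing ψ) {s : ℝ}
    (hs : s ∈ Set.Icc (0 : ℝ) 1) :
    cConst (fun x => (1 - s) * φ x + s * ψ x) ≤ max (cConst φ) (cConst ψ) := by
  have h0 := hs.1
  have h1 : 0 ≤ 1 - s := sub_nonneg.2 hs.2
  have key : ∫ p : ℝ, ‖(p : ℂ) * fourierT (fun x => (1 - s) * φ x + s * ψ x) p‖ ≤
      (1 - s) * (∫ p : ℝ, ‖(p : ℂ) * fourierT φ p‖) + s * ∫ p : ℝ, ‖(p : ℂ) * fourierT ψ p‖ := by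
    rw [← integral_const_mul, ← integral_const_mul, ← integral_add
      (hφ.integrable_fourier.norm.const_mul _) (hψ.integrable_fourier.norm.const_mul _)]
    refine integral_mono (hφ.convex hψ hs).integrable_fourier.norm
      ((hφ.integrable_fourier.norm.const_mul _).add
        (hψ.integrable_fourier.norm.const_mul _)) fun p => ?_
    simp only [fourierT_convex hφ.integrable hψ.integrable, mul_add, mul_left_comm (p : ℂ)]
    refine (norm_add_le _ _).trans (le_of_eq ?_)
    rw [norm_mul, norm_mul ((s : ℝ) : ℂ), Complex.norm_real, Complex.norm_real,
      Real.norm_of_nonneg h0, Real.norm_of_nonneg h1]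
  have h2 : cConst (fun x => (1 - s) * φ x + s * ψ x) ≤ (1 - s) * cConst φ + s * cConst ψ := by
    simp only [cConst]
    rw [← mul_div_assoc, ← mul_div_assoc, ← add_div]
    gcongr
    linarith
  refine h2.trans ?_
  calc _ ≤ (1 - s) * max (cConst φ) (cConst ψ) + s * max (cConst φ) (cConst ψ) := by
        gcongr
        · exact le_max_left _ _
        · exact le_max_right _ _
    _ = _ := by ring

/-- A smooth compactly supported function is a Schwartz function, and so is its Fourier transform.
-/
theorem integrable_mul_fourierT {f : ℝ → ℝ} (hf : ContDiff ℝ ∞ f) (hc : HasCompactSupport f) :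
    Integrable fun p : ℝ => (p : ℂ) * fourierT f p := by
  have hc' : HasCompactSupport fun x : ℝ => (f x : ℂ) := hc.comp_left (g := Complex.ofReal) rfl
  let S := hc'.toSchwartzMap (Complex.ofRealCLM.contDiff.comp hf)
  have h1 := (𝓕 S).integrable_pow_mul volume 1
  have h2 : Integrable fun p : ℝ => (p : ℂ) * 𝓕 (fun x : ℝ => (f x : ℂ)) p := by
    refine h1.mono' (Continuous.aestronglyMeasurable ?_) (Eventually.of_forall fun p => ?_)
    · have := (𝓕 S).continuous
      exact Complex.continuous_ofReal.mul this
    · rw [norm_mul, pow_one, Complex.norm_real]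
      exact le_rfl
  have hpi : (2 * Real.pi) ≠ 0 := by positivity
  have h3 := (h2.comp_div hpi).const_mul
    (((2 * Real.pi) * (1 / Real.sqrt (2 * Real.pi)) : ℝ) : ℂ)
  refine h3.congr (Eventually.of_forall fun p => ?_)
  simp only [fourierT_eq]
  have : (p : ℂ) = ((2 * Real.pi : ℝ) : ℂ) * ((p / (2 * Real.pi) : ℝ) : ℂ) := by
    rw [← Complex.ofReal_mul, mul_div_cancel₀ _ hpi]
  rw [this]
  push_cast
  ring

theorem exists_isLocalizing : ∃ φ : ℝ → ℝ, IsLocalizing φ := by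
  -- The transition is 0 for arguments ≤ 0 and 1 for arguments ≥ 1. The factor 4/3 is the inverse of
  -- 1 - (1/2)², so the argument reaches 1 exactly at |x| = 1/2.
  set φ : ℝ → ℝ := fun x => Real.smoothTransition ((1 - x ^ 2) * (4 / 3)) with hφ
  have hs : ContDiff ℝ ∞ φ := Real.smoothTransition.contDiff.comp (by fun_prop)
  have h0 : Function.support φ ⊆ Set.Icc (-1) 1 := by
    intro x hx
    rw [Set.mem_Icc, ← abs_le]
    by_contra h
    refine hx (Real.smoothTransition.zero_of_nonpos ?_)
    have : 1 < x ^ 2 := (one_lt_sq_iff_one_lt_abs x).2 (not_le.1 h)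
    linarith
  have hc : HasCompactSupport φ := HasCompactSupport.of_support_subset_isCompact isCompact_Icc h0
  refine ⟨φ, hs.continuous, hs.continuous.integrable_of_hasCompactSupport hc,
    fun x => ⟨Real.smoothTransition.nonneg _, Real.smoothTransition.le_one _⟩,
    fun x => by simp [hφ], h0, fun x hx => Real.smoothTransition.one_of_one_le ?_,
    fun x₀ x₁ h h' => Real.smoothTransition.monotone (by gcongr), integrable_mul_fourierT hs hc⟩
  nlinarith [hx.1, hx.2]

end Fourier

/-! ### Commutator estimates for functions of a bounded selfadjoint element. -/

section ExpCommutator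

variable {A : Type*} [CStarAlgebra A]

/-- `exp(i t b)` is unitary for selfadjoint `b`. -/
theorem exp_mem_unitary {b : A} (hb : IsSelfAdjoint b) (t : ℝ) :
    NormedSpace.exp ((t : ℝ) • (Complex.I • b)) ∈ unitary A := by
  have h : (t : ℝ) • (Complex.I • b) = Complex.I • (t • b) := smul_comm _ _ _
  rw [h]
  exact (selfAdjoint.expUnitary ⟨t • b, (IsSelfAdjoint.all t).smul hb⟩).2

/-- With u_s = exp(isb), the curve u_s y u_{-s} has derivative i u_s [b, y] u_{-s}, of norm ‖[b,
y]‖. The mean value inequality bounds u_t y u_{-t} - y, and multiplying by the unitary u_t turns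
this into the commutator. -/
theorem norm_exp_commutator_le {b y : A} (hb : IsSelfAdjoint b) (t : ℝ) :
    ‖NormedSpace.exp (t • (Complex.I • b)) * y - y * NormedSpace.exp (t • (Complex.I • b))‖ ≤
      |t| * ‖b * y - y * b‖ := by
  set c : A := Complex.I • b with hc
  set u : ℝ → A := fun t => NormedSpace.exp (t • c) with hu
  have hmem (s : ℝ) : u s ∈ unitary A := exp_mem_unitary hb s
  have hinv (s : ℝ) : u (-s) * u s = 1 := by
    let +nondep : NormedAlgebra ℚ A := .restrictScalars ℚ ℂ A
    have h : Commute (-s • c) (s • c) := ((Commute.refl c).smul_left _).smul_right _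
    simp only [hu]
    rw [← NormedSpace.exp_add_of_commute h]
    simp
  have hd (s : ℝ) : HasDerivAt (fun s => u s * y * u (-s))
      (u s * c * y * u (-s) + u s * y * (-(c * u (-s)))) s := by
    have h1 : HasDerivAt u (u s * c) s := hasDerivAt_exp_smul_const c s
    have h2 : HasDerivAt u (c * u (-s)) (-s) := hasDerivAt_exp_smul_const' c (-s)
    have h3 : HasDerivAt (fun s => u (-s)) (-(c * u (-s))) s := by
      have := h2.scomp s (hasDerivAt_neg s)
      rw [neg_one_smul] at this
      exact this
    exact (h1.mul_const y).mul h3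
  have hbound (s : ℝ) : ‖u s * c * y * u (-s) + u s * y * (-(c * u (-s)))‖ ≤
      ‖b * y - y * b‖ := by
    have : u s * c * y * u (-s) + u s * y * (-(c * u (-s))) =
        u s * (Complex.I • (b * y - y * b)) * u (-s) := by
      rw [smul_sub, ← smul_mul_assoc, ← mul_smul_comm, ← hc]
      noncomm_ring
    rw [this, CStarRing.norm_mul_mem_unitary _ (hmem _), CStarRing.norm_mem_unitary_mul _ (hmem _),
      norm_smul, Complex.norm_I, one_mul]
  have h := convex_univ.norm_image_sub_le_of_norm_hasDerivWithin_le
    (fun s _ => (hd s).hasDerivWithinAt) (fun s _ => hbound s) (Set.mem_univ 0) (Set.mem_univ t)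
  have e : u t * y - y * u t = (u t * y * u (-t) - u 0 * y * u (-0)) * u t := by
    have h0 : u 0 = 1 := by simp [hu]
    rw [neg_zero, h0, sub_mul, mul_assoc (u t * y), hinv, mul_one, one_mul, mul_one]
  change ‖u t * y - y * u t‖ ≤ _
  rw [e, CStarRing.norm_mul_mem_unitary _ (hmem _)]
  refine h.trans (le_of_eq ?_)
  rw [sub_zero, Real.norm_eq_abs, mul_comm]

variable {φ : ℝ → ℝ}

/-- Operator form of Fourier inversion: it holds pointwise on the real spectrum, and the functional
calculus commutes with the integral because |φ̂| is an integrable bound. -/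
theorem IsLocalizing.hasIntegral_cfc (hφ : IsLocalizing φ) {b : A} (hb : IsSelfAdjoint b)
    (r : ℝ) :
    Integrable (fun p : ℝ => fourierT φ p • NormedSpace.exp ((p * r) • (Complex.I • b))) ∧
    cfc (fun z : ℂ => (φ (z.re * r) : ℂ)) b = ((1 / Real.sqrt (2 * Real.pi) : ℝ) : ℂ) •
      ∫ p : ℝ, fourierT φ p • NormedSpace.exp ((p * r) • (Complex.I • b)) := by
  have hn : IsStarNormal b := hb.isStarNormal
  have hre {z : ℂ} (hz : z ∈ spectrum ℂ b) : z = (z.re : ℂ) := hb.mem_spectrum_eq_re hz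
  set F : ℝ → ℂ → ℂ := fun p z => fourierT φ p * Complex.exp (((p * r : ℝ) * Complex.I) * z)
    with hF
  have hFc : Continuous (Function.uncurry F) := by
    have := continuous_fourierT hφ.integrable
    change Continuous fun q : ℝ × ℂ =>
      fourierT φ q.1 * Complex.exp (((q.1 * r : ℝ) * Complex.I) * q.2)
    fun_prop
  have hexp (p : ℝ) : cfc (F p) b =
      fourierT φ p • NormedSpace.exp ((p * r) • (Complex.I • b)) := by
    have h1 : (p * r) • (Complex.I • b) = (((p * r : ℝ) : ℂ) * Complex.I) • b := by
      rw [mul_smul ((p * r : ℝ) : ℂ), Complex.coe_smul]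
    rw [h1, ← CFC.complex_exp_eq_normedSpace_exp, 
      ← cfc_comp_smul (((p * r : ℝ) : ℂ) * Complex.I) Complex.exp b (by fun_prop) hn, hF]
    exact cfc_const_mul _ _ _ (by fun_prop)
  have hbd : ∀ᵐ p : ℝ, ∀ z ∈ spectrum ℂ b, ‖F p z‖ ≤ ‖fourierT φ p‖ :=
    Eventually.of_forall fun p z hz => by
      rw [hre hz, hF, norm_mul]
      have : (((p * r : ℝ) : ℂ) * Complex.I) * (z.re : ℂ) =
        ((p * r * z.re : ℝ) : ℂ) * Complex.I := by push_cast; ring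
      rw [this, Complex.norm_exp_ofReal_mul_I, mul_one]
  have hfin := hφ.integrable_fourierT.norm.hasFiniteIntegral
  have hI := integrable_cfc F (fun p => ‖fourierT φ p‖) b hFc.continuousOn hbd hfin
  have hE := cfc_integral F (fun p => ‖fourierT φ p‖) b hFc.continuousOn hbd hfin
  simp only [hexp] at hI hE
  refine ⟨hI, ?_⟩
  -- On real arguments the integral is, by inversion, a constant multiple of the continuous function
  -- φ(x r).
  have hcont : ContinuousOn (fun z => ∫ p : ℝ, F p z) (spectrum ℂ b) := by
    have hdom : Continuous fun x : ℝ => ∫ p : ℝ, F p x := by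
      have h2 (x : ℝ) : ∫ p : ℝ, F p x = (Real.sqrt (2 * Real.pi) : ℝ) * (φ (x * r) : ℂ) := by
        rw [hφ.inversion, ← mul_assoc, ← Complex.ofReal_mul,
          mul_one_div_cancel sqrt_two_pi_pos.ne', Complex.ofReal_one, one_mul]
        congr 1
        funext p
        simp only [hF]
        congr 2
        push_cast
        ring
      simp only [h2]
      have := hφ.continuous
      fun_prop
    refine (hdom.comp Complex.continuous_re).continuousOn.congr fun z hz => ?_
    rw [hre hz]
    simp
  rw [← hE, ← cfc_const_mul _ (fun z => ∫ p : ℝ, F p z) b hcont]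
  refine cfc_congr fun z hz => ?_
  rw [hre hz]
  simp only [Complex.ofReal_re]
  rw [hφ.inversion]
  congr 2
  funext p
  rw [hF]
  congr 2
  push_cast
  ring

/-- The commutator of `y` with `φ(r b)` is controlled by the commutator of `y` with `b`. -/
theorem IsLocalizing.norm_cfc_commutator_le (hφ : IsLocalizing φ) {b : A}
    (hb : IsSelfAdjoint b) (y : A) {r : ℝ} (hr : 0 ≤ r) :
    ‖cfc (fun z : ℂ => (φ (z.re * r) : ℂ)) b * y - y * cfc (fun z : ℂ => (φ (z.re * r) : ℂ)) b‖ ≤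
      cConst φ / 2 * r * ‖b * y - y * b‖ := by
  obtain ⟨hI, hE⟩ := hφ.hasIntegral_cfc hb r
  have hs := sqrt_two_pi_pos
  set U : ℝ → A := fun p => NormedSpace.exp ((p * r) • (Complex.I • b)) with hU
  have e : cfc (fun z : ℂ => (φ (z.re * r) : ℂ)) b * y -
      y * cfc (fun z : ℂ => (φ (z.re * r) : ℂ)) b =
      ((1 / Real.sqrt (2 * Real.pi) : ℝ) : ℂ) •
        ∫ p : ℝ, fourierT φ p • (U p * y - y * U p) := by
    have h1 := (ContinuousLinearMap.mul ℂ A).flip y |>.integral_comp_comm hI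
    have h2 := (ContinuousLinearMap.mul ℂ A) y |>.integral_comp_comm hI
    simp only [ContinuousLinearMap.flip_apply, ContinuousLinearMap.mul_apply'] at h1 h2
    rw [hE, smul_mul_assoc, mul_smul_comm, ← smul_sub, ← h1, ← h2, ← integral_sub]
    · simp only [smul_mul_assoc, mul_smul_comm, smul_sub, hU]
    · exact ((ContinuousLinearMap.mul ℂ A).flip y).integrable_comp hI
    · exact ((ContinuousLinearMap.mul ℂ A) y).integrable_comp hI
  rw [e, norm_smul, Complex.norm_real, Real.norm_of_nonneg (by positivity)]
  have h3 : ‖∫ p : ℝ, fourierT φ p • (U p * y - y * U p)‖ ≤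
      ∫ p : ℝ, ‖(p : ℂ) * fourierT φ p‖ * (r * ‖b * y - y * b‖) := by
    refine norm_integral_le_of_norm_le (hφ.integrable_fourier.norm.mul_const _)
      (Eventually.of_forall fun p => ?_)
    rw [norm_smul]
    calc _ ≤ ‖fourierT φ p‖ * (|p * r| * ‖b * y - y * b‖) := by
          gcongr; exact norm_exp_commutator_le hb _
      _ = _ := by
          rw [norm_mul, Complex.norm_real, Real.norm_eq_abs, abs_mul, abs_of_nonneg hr]; ring
  rw [integral_mul_const] at h3
  calc _ ≤ 1 / Real.sqrt (2 * Real.pi) * ((∫ p : ℝ, ‖(p : ℂ) * fourierT φ p‖) *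
        (r * ‖b * y - y * b‖)) := by gcongr
    _ = _ := by rw [cConst]; ring

end ExpCommutator

/-! ### The commutator of Φ_ρ with a Lipschitz operator. -/

section CommutatorBound

variable {B X : Type*} [NonUnitalCStarAlgebra B] [PartialOrder B] [StarOrderedRing B]
  [SMul B X] [NormedAddCommGroup X] [NormedSpace ℂ X] [CStarModule B X] [CompleteSpace X]
  {K : KasparovModule B X} {φ : ℝ → ℝ}

theorem IsLocalizing.eq_zero_of_one_lt (hφ : IsLocalizing φ) {x : ℝ} (h : 1 < |x|) : φ x = 0 := by
  by_contra h0
  exact absurd (abs_le.2 (hφ.support_subset h0)) (not_le.2 h)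

theorem IsLocalizing.scaled_eq_zero (hφ : IsLocalizing φ) {ρ : ℝ} (hρ : 0 < ρ) {x : ℝ}
    (h : ρ < |x|) : (φ (x / ρ) : ℂ) = 0 := by
  rw [hφ.eq_zero_of_one_lt (by rwa [abs_div, abs_of_pos hρ, one_lt_div hρ]), Complex.ofReal_zero]

theorem IsLocalizing.limAt (hφ : IsLocalizing φ) {ρ : ℝ} (hρ : 0 < ρ) :
    LimAt (fun x => (φ (x / ρ) : ℂ)) 0 :=
  limAt_of_abs_gt (R := ρ)
    (Complex.continuous_ofReal.comp (hφ.continuous.comp (by fun_prop)))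
    fun _ hx => hφ.scaled_eq_zero hρ hx

theorem IsLocalizing.limAt_id_mul (hφ : IsLocalizing φ) {ρ : ℝ} (hρ : 0 < ρ) :
    LimAt (fun x : ℝ => (x : ℂ) * (φ (x / ρ) : ℂ)) 0 :=
  LimAt.id_mul_of_abs_gt (R := ρ) (hφ.limAt hρ).1 fun _ hx => hφ.scaled_eq_zero hρ hx

/-- The bounded estimate is applied to a truncation `b` of `D` and to the compression χ T χ. Since b
χ = D χ, the commutator [b, χ T χ] equals χ S χ, whose norm is at most ‖S‖ for every `n`. -/
theorem norm_cutoff_commutator_le (hφ : IsLocalizing φ) {ρ : ℝ} (hρ : 0 < ρ) {T S : Adj B X}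
    (hTS : IsCommutator K.D T S) {n : ℝ} (hn : ρ ≤ n) :
    ‖Phi K φ ρ * T * (funcCalc K.regular fun x => (cutoff n x : ℂ)) -
      (funcCalc K.regular fun x => (cutoff n x : ℂ)) * T * Phi K φ ρ‖ ≤
      cConst φ / (2 * ρ) * ‖S‖ := by
  set hD := K.regular
  set χ := funcCalc hD fun x => (cutoff n x : ℂ) with hχ
  have lχ := limAt_cutoff n
  have lxχ : LimAt (fun x : ℝ => (x : ℂ) * (cutoff n x : ℂ)) 0 :=
    LimAt.id_mul_of_abs_gt (R := n + 1) (continuous_cutoff_complex n) fun x hx => by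
      rw [cutoff_eq_zero hx, Complex.ofReal_zero]
  have hβ : Continuous fun x : ℝ => x * cutoff (n + 1) x :=
    continuous_id.mul (continuous_cutoff _)
  have lβ : LimAt (fun x : ℝ => ((x * cutoff (n + 1) x : ℝ) : ℂ)) 0 :=
    limAt_of_abs_gt (R := n + 1 + 1) (Complex.continuous_ofReal.comp hβ) fun x hx => by
      rw [cutoff_eq_zero hx, mul_zero, Complex.ofReal_zero]
  -- The cut-off at `n + 1` is identically 1 on the support [-n-1, n+1] of the cut-off at `n`; this
  -- is what makes `b` agree with `D` next to χ.
  set b := funcCalc hD fun x : ℝ => ((x * cutoff (n + 1) x : ℝ) : ℂ) with hb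
  have hbs : IsSelfAdjoint b := isSelfAdjoint_funcCalc hD lβ
  have hxχ (x : ℝ) : ((x * cutoff (n + 1) x : ℝ) : ℂ) * (cutoff n x : ℂ) =
      (x : ℂ) * (cutoff n x : ℂ) := by
    by_cases hx : |x| ≤ n + 1
    · rw [cutoff_eq_one hx, mul_one]
    · rw [cutoff_eq_zero (not_le.1 hx)]; simp
  have hbχ : b * χ = funcCalc hD fun x : ℝ => (x : ℂ) * (cutoff n x : ℂ) := by
    rw [← funcCalc_mul hD lβ lχ]
    simp only [hxχ]
  have hχb : χ * b = funcCalc hD fun x : ℝ => (x : ℂ) * (cutoff n x : ℂ) := by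
    rw [← (funcCalc_commute hD lβ lχ).eq, hbχ]
  have hcomm : b * (χ * T * χ) - χ * T * χ * b = χ * S * χ := by
    have := funcCalc_commutator hD (continuous_cutoff_complex n) (R := n + 1) (fun x hx => by
      rw [cutoff_eq_zero hx, Complex.ofReal_zero]) hTS
    rw [← this, ← mul_assoc, ← mul_assoc, hbχ, mul_assoc _ χ b, hχb]
  have hχ1 : ‖χ‖ ≤ 1 := norm_funcCalc_le hD lχ (norm_cutoff_le n)
  have hnorm : ‖χ * S * χ‖ ≤ ‖S‖ := by
    calc _ ≤ ‖χ‖ * ‖S‖ * ‖χ‖ := (norm_mul_le _ _).trans (by gcongr; exact norm_mul_le _ _)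
      _ ≤ 1 * ‖S‖ * 1 := by gcongr
      _ = _ := by ring
  have hk : Continuous fun z : ℂ => (φ (z.re * ρ⁻¹) : ℂ) := by
    have := hφ.continuous
    fun_prop
  have hcfc := (funcCalc_comp hD lβ hk).symm
  -- Here Ψ = φ(b/ρ), which is not Φ_ρ: far out the truncated coordinate is 0, where φ is 1.
  -- Multiplication by χ removes that region, and ρ ≤ n ensures that χ is 1 on the support of φ_ρ.
  set Ψ := funcCalc hD fun x : ℝ =>
    (fun z : ℂ => (φ (z.re * ρ⁻¹) : ℂ)) ((x * cutoff (n + 1) x : ℝ) : ℂ) with hΨ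
  have lΨ := lβ.comp hk
  have hpt (x : ℝ) : (fun z : ℂ => (φ (z.re * ρ⁻¹) : ℂ)) ((x * cutoff (n + 1) x : ℝ) : ℂ) *
      (cutoff n x : ℂ) = (φ (x / ρ) : ℂ) := by
    simp only [Complex.ofReal_re]
    by_cases hx : |x| ≤ n
    · rw [cutoff_eq_one hx, cutoff_eq_one (hx.trans (by linarith)), mul_one, Complex.ofReal_one,
        mul_one, div_eq_mul_inv]
    · rw [hφ.scaled_eq_zero hρ (hn.trans_lt (not_le.1 hx))]
      by_cases hx' : |x| ≤ n + 1
      · rw [cutoff_eq_one hx', mul_one, ← div_eq_mul_inv,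
          hφ.scaled_eq_zero hρ (hn.trans_lt (not_le.1 hx)), zero_mul]
      · rw [cutoff_eq_zero (n := n) (not_le.1 hx'), Complex.ofReal_zero, mul_zero]
  have hΨχ : Ψ * χ = Phi K φ ρ := by
    rw [Phi, ← funcCalc_mul hD lΨ lχ]
    exact congrArg _ (funext hpt)
  have hχΨ : χ * Ψ = Phi K φ ρ := by
    rw [← (funcCalc_commute hD lΨ lχ).eq, hΨχ]
  have h := hφ.norm_cfc_commutator_le hbs (χ * T * χ) (inv_nonneg.2 hρ.le)
  rw [hcfc, hcomm, ← mul_assoc, ← mul_assoc, hΨχ, mul_assoc _ χ Ψ, hχΨ] at h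
  refine h.trans ?_
  have hc := cConst_nonneg φ
  calc _ ≤ cConst φ / 2 * ρ⁻¹ * ‖S‖ := by gcongr
    _ = _ := by field_simp

/-- `‖[Φ_ρ, T]‖ ≤ c_φ ‖[D, T]‖ / (2 ρ)`. -/
theorem norm_Phi_commutator_le (hφ : IsLocalizing φ) {ρ : ℝ} (hρ : 0 < ρ) {T S : Adj B X}
    (hTS : IsCommutator K.D T S) :
    ‖Phi K φ ρ * T - T * Phi K φ ρ‖ ≤ cConst φ / (2 * ρ) * ‖S‖ := by
  have hc := cConst_nonneg φ
  refine norm_le_of_apply (by positivity) fun y => ?_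
  have hcont (R : Adj B X) : Continuous fun x : X => R.1 x := R.1.continuous
  -- The bound with cut-offs is uniform in `n`, so it survives the strong limit in which the
  -- cut-offs tend to the identity.
  have t1 : Tendsto (fun n : ℕ => (Phi K φ ρ).1 (T.1
      ((funcCalc K.regular fun x => (cutoff n x : ℂ)).1 y)) -
      (funcCalc K.regular fun x => (cutoff n x : ℂ)).1 (T.1 ((Phi K φ ρ).1 y))) atTop
      (𝓝 ((Phi K φ ρ).1 (T.1 y) - T.1 ((Phi K φ ρ).1 y))) :=
    ((((hcont (Phi K φ ρ)).comp (hcont T)).tendsto y).comp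
      (tendsto_cutoff_apply K.regular y)).sub (tendsto_cutoff_apply K.regular _)
  obtain ⟨N, hN⟩ := exists_nat_ge ρ
  refine le_of_tendsto t1.norm (eventually_atTop.2 ⟨N, fun n hn => ?_⟩)
  have hρn : ρ ≤ n := hN.trans (by exact_mod_cast hn)
  refine le_trans (norm_apply_le (Phi K φ ρ * T * (funcCalc K.regular fun x => (cutoff n x : ℂ)) -
    (funcCalc K.regular fun x => (cutoff n x : ℂ)) * T * Phi K φ ρ) y) ?_
  gcongr
  exact norm_cutoff_commutator_le hφ hρ hTS hρn

end CommutatorBound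

/-! ### Operator inequalities in a unital C⋆-algebra. -/

section Order

/-- The order is only a tool inside proofs about 𝕃(X), so the spectral order is introduced there
locally. -/
theorem exists_starOrderedRing (A : Type*) [CStarAlgebra A] :
    ∃ _ : PartialOrder A, StarOrderedRing A :=
  ⟨CStarAlgebra.spectralOrder A, CStarAlgebra.spectralOrderedRing A⟩

variable {A : Type*} [CStarAlgebra A] [PartialOrder A] [StarOrderedRing A]

/-- Conjugating (H⁻¹)² ≤ ‖H⁻¹‖² by H gives 1 ≤ ‖H⁻¹‖² H². The case ‖H⁻¹‖ = 0 is that of the zero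
algebra, where the left side is 0 by the convention 0⁻¹ = 0. -/
theorem gap_sq_le_mul_self {H : A} (hs : IsSelfAdjoint H) (hu : IsUnit H) :
    algebraMap ℝ A (‖Ring.inverse H‖⁻¹ ^ 2) ≤ H * H := by
  set K := Ring.inverse H
  have hKs : IsSelfAdjoint K := hs.ringInverse
  have h1 : star K * K ≤ algebraMap ℝ A (‖K‖ ^ 2) := CStarAlgebra.star_mul_le_algebraMap_norm_sq
  have h2 := hs.conjugate_le_conjugate h1
  have e1 : H * (star K * K) * H = 1 := by
    rw [hKs.star_eq, ← mul_assoc, Ring.mul_inverse_cancel _ hu, one_mul,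
      Ring.inverse_mul_cancel _ hu]
  have e2 : H * algebraMap ℝ A (‖K‖ ^ 2) * H = (‖K‖ ^ 2) • (H * H) := by
    rw [← Algebra.commutes, mul_assoc, Algebra.smul_def]
  rw [e1, e2] at h2
  by_cases h0 : ‖K‖ = 0
  · rw [h0]
    simp only [inv_zero, ne_eq, OfNat.ofNat_ne_zero, not_false_eq_true, zero_pow, map_zero]
    have := star_mul_self_nonneg H
    rwa [hs.star_eq] at this
  · have h3 := smul_le_smul_of_nonneg_left h2 (by positivity : 0 ≤ ‖K‖⁻¹ ^ 2)
    rw [smul_smul, ← mul_pow, inv_mul_cancel₀ h0, one_pow, one_smul] at h3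
    rwa [Algebra.algebraMap_eq_smul_one]

/-- Only the compression F E F is assumed selfadjoint. Replacing E by its real part changes neither
the compression nor the norm bound, and a selfadjoint element is at least minus its norm. -/
theorem neg_smul_le_conjugate {F E : A} (hF : IsSelfAdjoint F) (hE : IsSelfAdjoint (F * E * F))
    {C : ℝ} (hC : ‖E‖ ≤ C) : -(C • (F * F)) ≤ F * E * F := by
  set S : A := (2⁻¹ : ℝ) • (E + star E) with hS
  have hSs : IsSelfAdjoint S := (IsSelfAdjoint.all _).smul (IsSelfAdjoint.add_star_self E)
  have hSn : ‖S‖ ≤ C := by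
    rw [hS, norm_smul]
    have : ‖E + star E‖ ≤ ‖E‖ + ‖E‖ := (norm_add_le _ _).trans (by rw [norm_star])
    norm_num
    linarith
  have e1 : F * S * F = F * E * F := by
    have h : F * star E * F = F * E * F := by
      have := hE.star_eq
      rwa [star_mul, star_mul, hF.star_eq, ← mul_assoc] at this
    rw [hS, mul_smul_comm, smul_mul_assoc, mul_add, add_mul, h, ← two_smul ℝ, smul_smul]
    norm_num
  have h1 : -(algebraMap ℝ A C) ≤ S :=
    (neg_le_neg (algebraMap_mono A hSn)).trans hSs.neg_algebraMap_norm_le_self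
  have h2 := hF.conjugate_le_conjugate h1
  rw [e1] at h2
  convert h2 using 1
  rw [mul_neg, neg_mul, ← Algebra.commutes, mul_assoc, Algebra.smul_def]

/-- An element above a strictly positive one is invertible, and an element with invertible square is
invertible. -/
theorem isUnit_of_algebraMap_le_mul_self {b : A} {ε : ℝ} (hε : 0 < ε)
    (h : algebraMap ℝ A ε ≤ b * b) : IsUnit b := by
  have h1 : IsStrictlyPositive (algebraMap ℝ A ε) :=
    IsStrictlyPositive.iff_of_unital.2 ⟨by
      have := algebraMap_mono A hε.le
      rwa [map_zero] at this, (IsUnit.mk0 ε hε.ne').map (algebraMap ℝ A)⟩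
  exact isUnit_mul_self_iff.1 (CStarAlgebra.isUnit_of_le _ h h1)

theorem cfc_sqrt_eq {a b : A} (hb : 0 ≤ b) (h : b * b = a) : cfc Real.sqrt a = b := by
  have hbs : IsSelfAdjoint b := .of_nonneg hb
  rw [← h, ← pow_two, ← cfc_comp_pow Real.sqrt 2 b (by fun_prop) hbs]
  calc cfc (fun x => Real.sqrt (x ^ 2)) b = cfc (fun x : ℝ => x) b :=
        cfc_congr fun x hx => Real.sqrt_sq (spectrum_nonneg_of_nonneg hb hx)
    _ = b := cfc_id' ℝ b

end Order

/-! ### The spectral localizer: its square, invertibility, and compactness of the difference. -/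

section Localizer

variable {B X : Type*} [NonUnitalCStarAlgebra B] [PartialOrder B] [StarOrderedRing B]
  [SMul B X] [NormedAddCommGroup X] [NormedSpace ℂ X] [CStarModule B X] [CompleteSpace X]

theorem LimAt.sqrt {f : ℝ → ℝ} {l : ℂ} (hf : LimAt (fun x => (f x : ℂ)) l) :
    LimAt (fun x => (Real.sqrt (f x) : ℂ)) (Real.sqrt l.re) := by
  have : Continuous fun z : ℂ => (Real.sqrt z.re : ℂ) := by fun_prop
  exact hf.comp this

theorem funcCalc_nonneg [PartialOrder (Adj B X)] [StarOrderedRing (Adj B X)]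
    {D : X →ₗ.[ℂ] X} (hD : IsSelfAdjointRegular B D) {f : ℝ → ℝ} {l : ℂ}
    (hf : LimAt (fun x => (f x : ℂ)) l) (h0 : ∀ x, 0 ≤ f x) :
    0 ≤ funcCalc hD fun x => (f x : ℂ) := by
  have h : (funcCalc hD fun x => (f x : ℂ)) =
      star (funcCalc hD fun x => (Real.sqrt (f x) : ℂ)) *
        funcCalc hD fun x => (Real.sqrt (f x) : ℂ) := by
    rw [(isSelfAdjoint_funcCalc hD hf.sqrt).star_eq, ← funcCalc_mul hD hf.sqrt hf.sqrt]
    congr 1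
    funext x
    rw [← Complex.ofReal_mul, Real.mul_self_sqrt (h0 x)]
  rw [h]
  exact star_mul_self_nonneg _

theorem algebraMap_le_funcCalc [PartialOrder (Adj B X)] [StarOrderedRing (Adj B X)]
    {D : X →ₗ.[ℂ] X} (hD : IsSelfAdjointRegular B D) {f : ℝ → ℝ} {l : ℂ}
    (hf : LimAt (fun x => (f x : ℂ)) l) {ε : ℝ} (h0 : ∀ x, ε ≤ f x) :
    algebraMap ℝ (Adj B X) ε ≤ funcCalc hD fun x => (f x : ℂ) := by
  have h1 := hf.sub (.const (ε : ℂ))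
  have h2 := funcCalc_sub hD hf (.const (ε : ℂ))
  simp only [← Complex.ofReal_sub] at h1 h2
  have h3 := funcCalc_nonneg hD h1 fun x => sub_nonneg.2 (h0 x)
  rw [h2, funcCalc_const, sub_nonneg] at h3
  exact h3

variable (K : KasparovModule B X) {φ : ℝ → ℝ} {κ ρ : ℝ} {H : Adj B X}

theorem γ_commute_of_even {f : ℝ → ℂ} {l : ℂ} (hf : LimAt f l) (he : ∀ x, f (-x) = f x) :
    K.γ * funcCalc K.regular f = funcCalc K.regular f * K.γ := by
  rw [funcCalc_comp_neg_of_anticomm K.regular hf K.isSelfAdjoint_γ K.γ_mul_γ K.γ_mem K.anticomm]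
  simp only [he]

theorem γ_anticommute_of_odd {f : ℝ → ℂ} {l : ℂ} (hf : LimAt f l) (ho : ∀ x, f (-x) = -f x) :
    K.γ * funcCalc K.regular f = -(funcCalc K.regular f * K.γ) := by
  rw [funcCalc_comp_neg_of_anticomm K.regular hf K.isSelfAdjoint_γ K.γ_mul_γ K.γ_mem K.anticomm]
  have : (fun x => f (-x)) = fun x => (-1 : ℂ) * f x := funext fun x => by rw [ho, neg_one_mul]
  rw [this, funcCalc_smul K.regular _ hf, neg_one_smul, neg_mul]

/-- `(1 - φ_ρ⁴)^{1/2}`. -/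
def tail (φ : ℝ → ℝ) (ρ x : ℝ) : ℝ := Real.sqrt (1 - φ (x / ρ) ^ 4)

theorem IsLocalizing.limAt_one_sub_pow (hφ : IsLocalizing φ) (hρ : 0 < ρ) :
    LimAt (fun x => ((1 - φ (x / ρ) ^ 4 : ℝ) : ℂ)) 1 := by
  have h := hφ.limAt hρ
  have := (LimAt.const 1).sub (h.comp (k := fun z => z ^ 4) (by fun_prop))
  simpa using this

theorem IsLocalizing.limAt_tail (hφ : IsLocalizing φ) (hρ : 0 < ρ) :
    LimAt (fun x => (tail φ ρ x : ℂ)) 1 := by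
  simpa [tail] using (hφ.limAt_one_sub_pow hρ).sqrt

theorem IsLocalizing.pow_four_le (hφ : IsLocalizing φ) (x : ℝ) : φ x ^ 4 ≤ 1 :=
  pow_le_one₀ (hφ.mem_Icc x).1 (hφ.mem_Icc x).2

theorem IsLocalizing.tail_mul_self (hφ : IsLocalizing φ) (ρ x : ℝ) :
    tail φ ρ x * tail φ ρ x = 1 - φ (x / ρ) ^ 4 :=
  Real.mul_self_sqrt (sub_nonneg.2 (hφ.pow_four_le _))

theorem one_sub_Phi_pow (hφ : IsLocalizing φ) (hρ : 0 < ρ) :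
    1 - Phi K φ ρ ^ 4 = funcCalc K.regular fun x => ((1 - φ (x / ρ) ^ 4 : ℝ) : ℂ) := by
  have h := hφ.limAt hρ
  have e : (fun x : ℝ => ((1 - φ (x / ρ) ^ 4 : ℝ) : ℂ)) =
      fun x => 1 - ((φ (x / ρ) : ℂ) * (φ (x / ρ) : ℂ)) * ((φ (x / ρ) : ℂ) * (φ (x / ρ) : ℂ)) := by
    funext x; push_cast; ring
  rw [e, funcCalc_sub K.regular (.const 1) ((h.mul h).mul (h.mul h)), funcCalc_one,
    funcCalc_mul K.regular (h.mul h) (h.mul h), funcCalc_mul K.regular h h, Phi]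
  noncomm_ring

/-- The function `t φ_{2ρ}²`. -/
def dirac (φ : ℝ → ℝ) (ρ x : ℝ) : ℝ := x * φ (x / (2 * ρ)) ^ 2

theorem IsLocalizing.limAt_dirac (hφ : IsLocalizing φ) (hρ : 0 < ρ) :
    LimAt (fun x => (dirac φ ρ x : ℂ)) 0 := by
  have h2 : 0 < 2 * ρ := by positivity
  have hc := hφ.continuous
  refine limAt_of_abs_gt (R := 2 * ρ) (by unfold dirac; fun_prop) fun x hx => ?_
  have := hφ.scaled_eq_zero h2 hx
  rw [Complex.ofReal_eq_zero] at this
  simp [dirac, this]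

/-- With the Dirac term and the square root each expressed as a single function of `D`, products of
the coefficients reduce to pointwise identities on the line. -/
theorem localizer_eq (hφ : IsLocalizing φ) (hρ : 0 < ρ) (κ : ℝ) (H : Adj B X) :
    localizer K H φ κ ρ = Phi K φ ρ * K.γ * H * Phi K φ ρ +
      (κ : ℂ) • (funcCalc K.regular fun x => (dirac φ ρ x : ℂ)) -
      (funcCalc K.regular fun x => (tail φ (2 * ρ) x : ℂ)) * K.γ := by
  have h2 : 0 < 2 * ρ := by positivity
  obtain ⟨_, _⟩ := exists_starOrderedRing (Adj B X)
  have ht := hφ.limAt_tail h2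
  rw [localizer]
  congr 2
  · congr 1
    rw [Phi, DPhi, ← funcCalc_mul K.regular (hφ.limAt h2) (hφ.limAt_id_mul h2)]
    congr 1
    funext x
    simp only [dirac]
    push_cast
    ring
  · refine cfc_sqrt_eq (funcCalc_nonneg _ ht fun x => Real.sqrt_nonneg _) ?_
    rw [one_sub_Phi_pow K hφ h2, ← funcCalc_mul K.regular ht ht]
    simp only [← Complex.ofReal_mul, hφ.tail_mul_self]

theorem IsLocalizing.two_mul_scaled_eq_one (hφ : IsLocalizing φ) (hρ : 0 < ρ) {x : ℝ}
    (h : |x| ≤ ρ) : φ (x / (2 * ρ)) = 1 := by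
  refine hφ.eq_one _ (abs_le.1 ?_)
  rw [abs_div, abs_of_pos (by positivity : 0 < 2 * ρ), div_le_div_iff₀ (by positivity) two_pos]
  linarith

/-- The reason for the two scales ρ and 2ρ: on [-ρ, ρ], which contains the support of φ_ρ, the
function φ_{2ρ} is 1 and the tail vanishes. -/
theorem IsLocalizing.tail_mul (hφ : IsLocalizing φ) (hρ : 0 < ρ) (x : ℝ) :
    (tail φ (2 * ρ) x : ℂ) * (φ (x / ρ) : ℂ) = 0 := by
  by_cases h : |x| ≤ ρ
  · simp [tail, hφ.two_mul_scaled_eq_one hρ h]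
  · rw [hφ.scaled_eq_zero hρ (not_le.1 h), mul_zero]

theorem IsLocalizing.dirac_mul (hφ : IsLocalizing φ) (hρ : 0 < ρ) (x : ℝ) :
    (dirac φ ρ x : ℂ) * (φ (x / ρ) : ℂ) = (x : ℂ) * (φ (x / ρ) : ℂ) := by
  by_cases h : |x| ≤ ρ
  · simp [dirac, hφ.two_mul_scaled_eq_one hρ h]
  · rw [hφ.scaled_eq_zero hρ (not_le.1 h), mul_zero, mul_zero]

/-- The square of the spectral localizer. -/
theorem localizer_sq (hφ : IsLocalizing φ) (hρ : 0 < ρ) (κ : ℝ) (hγ : H * K.γ = K.γ * H)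
    {S : Adj B X} (hS : IsCommutator K.D H S) :
    localizer K H φ κ ρ * localizer K H φ κ ρ =
      Phi K φ ρ * Phi K φ ρ * (H * H) * (Phi K φ ρ * Phi K φ ρ) +
      Phi K φ ρ * ((H * Phi K φ ρ - Phi K φ ρ * H) * Phi K φ ρ * H +
        Phi K φ ρ * H * (Phi K φ ρ * H - H * Phi K φ ρ) - (κ : ℂ) • (K.γ * S)) * Phi K φ ρ +
      ((κ : ℂ) * κ) • ((funcCalc K.regular fun x => (dirac φ ρ x : ℂ)) *
        funcCalc K.regular fun x => (dirac φ ρ x : ℂ)) +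
      (funcCalc K.regular fun x => (tail φ (2 * ρ) x : ℂ)) *
        funcCalc K.regular fun x => (tail φ (2 * ρ) x : ℂ) := by
  have h2 : 0 < 2 * ρ := by positivity
  have lF := hφ.limAt hρ
  have lG := hφ.limAt_dirac hρ
  have lR := hφ.limAt_tail h2
  have lxF := hφ.limAt_id_mul hρ
  rw [localizer_eq K hφ hρ κ H]
  set F := Phi K φ ρ with hF
  set γ := K.γ
  set G := funcCalc K.regular fun x => (dirac φ ρ x : ℂ) with hG
  set R := funcCalc K.regular fun x => (tail φ (2 * ρ) x : ℂ) with hR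
  set E := DPhi K φ ρ with hE
  have γγ : γ * γ = 1 := K.γ_mul_γ
  have γF : γ * F = F * γ := γ_commute_of_even K lF fun x => by rw [neg_div, hφ.even]
  have γR : γ * R = R * γ := γ_commute_of_even K lR fun x => by rw [tail, neg_div, hφ.even, tail]
  have γG : γ * G = -(G * γ) := γ_anticommute_of_odd K lG fun x => by
    rw [dirac, neg_div, hφ.even, dirac]; push_cast; ring
  have γE : γ * E = -(E * γ) := γ_anticommute_of_odd K lxF fun x => by
    rw [neg_div, hφ.even]; push_cast; ring
  have RF : R * F = 0 := by
    rw [hR, hF, Phi, ← funcCalc_mul K.regular lR lF]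
    simp only [hφ.tail_mul hρ, funcCalc_const, map_zero]
  have FR : F * R = 0 := (funcCalc_commute K.regular lF lR).eq.trans RF
  have GF : G * F = E := by
    rw [hG, hF, Phi, ← funcCalc_mul K.regular lG lF]
    simp only [hφ.dirac_mul hρ]
    rfl
  have FG : F * G = E := (funcCalc_commute K.regular lF lG).eq.trans GF
  have GR : G * R = R * G := funcCalc_commute K.regular lG lR
  have hcomm : E * H * F - F * H * E = F * S * F :=
    funcCalc_commutator K.regular (R := ρ) lF.1 (fun x hx => hφ.scaled_eq_zero hρ hx) hS
  set N := F * γ * H * F with hN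
  have NR : N * (R * γ) = 0 := by
    calc N * (R * γ) = F * γ * H * (F * R) * γ := by simp only [hN, mul_assoc]
      _ = 0 := by rw [FR]; simp
  have RN : R * γ * N = 0 := by
    calc R * γ * N = R * (γ * F) * γ * H * F := by simp only [hN, mul_assoc]
      _ = (R * F) * γ * γ * H * F := by rw [γF]; simp only [mul_assoc]
      _ = 0 := by rw [RF]; simp
  -- G and R commute as functions of `D`, while the odd function G anticommutes with γ.
  have GRγ : G * (R * γ) + R * γ * G = 0 := by
    rw [← mul_assoc, GR, mul_assoc R γ G, γG]
    noncomm_ring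
  have RR : R * γ * (R * γ) = R * R := by
    calc R * γ * (R * γ) = R * (γ * R) * γ := by simp only [mul_assoc]
      _ = R * R * (γ * γ) := by rw [γR]; simp only [mul_assoc]
      _ = R * R := by rw [γγ, mul_one]
  -- Pulling γ to the left past the odd operator G F = D Φ_ρ produces a sign, so the anticommutator
  -- becomes γ (F H E - E H F), a compressed commutator with `D`.
  have NG : N * G + G * N = -(F * (γ * S) * F) := by
    have a1 : N * G = γ * (F * H * E) := by
      calc N * G = F * γ * H * (F * G) := by simp only [hN, mul_assoc]
        _ = γ * (F * H * E) := by rw [FG, ← γF]; simp only [mul_assoc]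
    have a2 : G * N = -(γ * (E * H * F)) := by
      calc G * N = G * F * γ * H * F := by simp only [hN, mul_assoc]
        _ = (E * γ) * H * F := by rw [GF]
        _ = _ := by rw [eq_neg_of_add_eq_zero_left (by rw [γE]; simp : E * γ + γ * E = 0)]
                    simp only [mul_assoc, neg_mul]
    have a3 : F * (γ * S) * F = γ * (F * S * F) := by
      rw [← mul_assoc F, ← γF]; simp only [mul_assoc]
    rw [a1, a2, a3, ← hcomm]
    noncomm_ring
  have NN : N * N = F * H * F * F * H * F := by
    calc N * N = (F * γ) * H * F * (F * γ) * H * F := by simp only [hN, mul_assoc]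
      _ = F * (γ * H) * (F * F) * γ * H * F := by simp only [mul_assoc]
      _ = F * H * (γ * F) * F * γ * H * F := by rw [← hγ]; simp only [mul_assoc]
      _ = F * H * (F * γ) * F * γ * H * F := by rw [γF]
      _ = F * H * F * (γ * F) * γ * H * F := by simp only [mul_assoc]
      _ = F * H * F * (F * γ) * γ * H * F := by rw [γF]
      _ = F * H * F * F * (γ * γ) * H * F := by simp only [mul_assoc]
      _ = _ := by rw [γγ, mul_one]
  have expand : (N + (κ : ℂ) • G - R * γ) * (N + (κ : ℂ) • G - R * γ) =
      N * N + (κ : ℂ) • (N * G + G * N) + ((κ : ℂ) * κ) • (G * G) -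
      N * (R * γ) - R * γ * N - (κ : ℂ) • (G * (R * γ) + R * γ * G) + R * γ * (R * γ) := by
    rw [mul_smul (κ : ℂ) (κ : ℂ)]
    simp only [sub_mul, add_mul, mul_sub, mul_add, smul_add, smul_sub, smul_mul_assoc,
      mul_smul_comm, mul_assoc]
    abel
  -- It remains to see that F H F² H F - F² H² F² is the sum of the two terms containing [F, H]; the
  -- mixed term F² H F H F cancels.
  rw [expand, NN, NG, NR, RN, GRγ, RR]
  simp only [smul_zero, sub_zero, smul_neg, mul_sub, sub_mul, mul_add, add_mul, mul_smul_comm,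
    smul_mul_assoc, mul_assoc]
  abel

theorem isSelfAdjoint_localizer (hφ : IsLocalizing φ) (hρ : 0 < ρ) (κ : ℝ)
    (hH : IsSelfAdjoint H) (hγ : H * K.γ = K.γ * H) :
    IsSelfAdjoint (localizer K H φ κ ρ) := by
  have h2 : 0 < 2 * ρ := by positivity
  have hF : IsSelfAdjoint (Phi K φ ρ) := isSelfAdjoint_funcCalc K.regular (hφ.limAt hρ)
  have hR := isSelfAdjoint_funcCalc K.regular (hφ.limAt_tail h2)
  rw [localizer_eq K hφ hρ κ H]
  refine IsSelfAdjoint.sub (IsSelfAdjoint.add ?_ ?_) ?_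
  · have hγH : IsSelfAdjoint (K.γ * H) := by
      rw [IsSelfAdjoint, star_mul, hH.star_eq, K.isSelfAdjoint_γ.star_eq, hγ]
    have := hγH.conjugate_self hF
    rwa [← mul_assoc] at this
  · refine IsSelfAdjoint.smul ?_ (isSelfAdjoint_funcCalc K.regular (hφ.limAt_dirac hρ))
    simp [IsSelfAdjoint]
  · rw [IsSelfAdjoint, star_mul, hR.star_eq, K.isSelfAdjoint_γ.star_eq]
    exact γ_commute_of_even K (hφ.limAt_tail h2) fun x => by rw [tail, neg_div, hφ.even, tail]

/-- The tail tends to 1 at infinity, so -γ is split off and only 1 - tail remains; every remaining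
term has a factor that is a function of `D` vanishing at infinity. -/
theorem neg_γ_sub_localizer_mem (hφ : IsLocalizing φ) (hρ : 0 < ρ) (κ : ℝ) (H : Adj B X) :
    -K.γ - localizer K H φ κ ρ ∈ (compacts B X).carrier := by
  have h2 : 0 < 2 * ρ := by positivity
  have lR := (LimAt.const 1).sub (hφ.limAt_tail h2)
  rw [sub_self] at lR
  have m1 : Phi K φ ρ ∈ (compacts B X).carrier :=
    funcCalc_mem_compacts K.regular K.compact_resolvent (hφ.limAt hρ)
  have m2 := funcCalc_mem_compacts K.regular K.compact_resolvent (hφ.limAt_dirac hρ)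
  have m3 := funcCalc_mem_compacts K.regular K.compact_resolvent lR
  have e : -K.γ - localizer K H φ κ ρ =
      -(Phi K φ ρ * K.γ * H * Phi K φ ρ) -
      (κ : ℂ) • (funcCalc K.regular fun x => (dirac φ ρ x : ℂ)) -
      (funcCalc K.regular fun x => 1 - (tail φ (2 * ρ) x : ℂ)) * K.γ := by
    rw [localizer_eq K hφ hρ κ H, funcCalc_sub K.regular (.const 1) (hφ.limAt_tail h2),
      funcCalc_one, sub_mul, one_mul]
    abel
  rw [e]
  exact Submodule.sub_mem _ (Submodule.sub_mem _
    (Submodule.neg_mem _ ((compacts B X).mul_mem_left _ m1)) (Submodule.smul_mem _ _ m2))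
    ((compacts B X).mul_mem_right _ m3)

theorem norm_Phi_le_one (hφ : IsLocalizing φ) (hρ : 0 < ρ) : ‖Phi K φ ρ‖ ≤ 1 :=
  norm_funcCalc_le K.regular (hφ.limAt hρ) fun x => by
    rw [Complex.norm_real, Real.norm_of_nonneg (hφ.mem_Icc _).1]
    exact (hφ.mem_Icc _).2

theorem norm_γ_le_one : ‖K.γ‖ ≤ 1 := by
  have h := CStarRing.norm_star_mul_self (x := K.γ)
  rw [K.isSelfAdjoint_γ.star_eq, K.γ_mul_γ] at h
  have h1 : ‖(1 : Adj B X)‖ ≤ 1 := norm_le_of_apply zero_le_one fun x => by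
    rw [one_mul]; exact le_rfl
  nlinarith [norm_nonneg K.γ]

/-- The pointwise lower bound behind the invertibility of the spectral localizer. -/
theorem IsLocalizing.lower_bound (hφ : IsLocalizing φ) (hρ : 0 < ρ) {C g : ℝ} (hC : 0 ≤ C)
    (x : ℝ) :
    min (min (g ^ 2 - C) (κ ^ 2 * ρ ^ 2 / 4 - C)) 1 ≤
      g ^ 2 * φ (x / ρ) ^ 4 - C * φ (x / ρ) ^ 2 + κ ^ 2 * dirac φ ρ x ^ 2 +
        (1 - φ (x / (2 * ρ)) ^ 4) := by
  set a := φ (x / ρ) with ha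
  set ε := min (min (g ^ 2 - C) (κ ^ 2 * ρ ^ 2 / 4 - C)) 1 with hε
  have ε1 : ε ≤ g ^ 2 - C := (min_le_left _ _).trans (min_le_left _ _)
  have ε2 : ε ≤ κ ^ 2 * ρ ^ 2 / 4 - C := (min_le_left _ _).trans (min_le_right _ _)
  have ε3 : ε ≤ 1 := min_le_right _ _
  have hψ := hφ.pow_four_le (x / (2 * ρ))
  have hψ0 : 0 ≤ φ (x / (2 * ρ)) ^ 4 := by positivity
  have ha0 : 0 ≤ a := (hφ.mem_Icc _).1
  have ha1 : a ≤ 1 := (hφ.mem_Icc _).2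
  have ha2 : a ^ 2 ≤ 1 := pow_le_one₀ ha0 ha1
  have hd : κ ^ 2 * dirac φ ρ x ^ 2 = κ ^ 2 * x ^ 2 * φ (x / (2 * ρ)) ^ 4 := by
    rw [dirac]; ring
  -- Near zero φ_ρ is 1, so the gap term g² absorbs C and the remaining terms are nonnegative.
  by_cases h1 : |x| ≤ ρ / 2
  · have : a = 1 := by
      refine hφ.eq_one _ (abs_le.1 ?_)
      rw [abs_div, abs_of_pos hρ, div_le_div_iff₀ hρ two_pos]
      linarith
    rw [this]
    have : 0 ≤ κ ^ 2 * dirac φ ρ x ^ 2 := by positivity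
    linarith
  · have hx2 : ρ ^ 2 / 4 ≤ x ^ 2 := by
      rw [← sq_abs x]
      nlinarith [not_le.1 h1]
    have hκ : κ ^ 2 * ρ ^ 2 / 4 ≤ κ ^ 2 * x ^ 2 := by nlinarith [sq_nonneg κ]
    rw [hd]
    -- For ρ/2 < |x| ≤ ρ the term κ² x² ≥ κ² ρ² / 4 absorbs C. Beyond ρ the C-term is gone, and what
    -- is left is a convex combination of κ² x² and 1 with weight φ_{2ρ}⁴.
    by_cases h2 : |x| ≤ ρ
    · rw [hφ.two_mul_scaled_eq_one hρ h2]
      have : 0 ≤ g ^ 2 * a ^ 4 := by positivity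
      nlinarith
    · have : a = 0 := hφ.eq_zero_of_one_lt (by
        rw [abs_div, abs_of_pos hρ, one_lt_div hρ]; exact not_le.1 h2)
      rw [this]
      nlinarith

/-- The square dominates a function of `D` obtained by replacing H² with g² and the error F E F with
-C F²; admissibility says precisely that the first two entries of the minimum in
`IsLocalizing.lower_bound` are positive. -/
theorem isUnit_localizer (hφ : IsLocalizing φ) {H : LipEv K} (hs : IsSelfAdjoint H.op)
    (hu : IsUnit H.op) (hadm : Admissible H φ κ ρ) : IsUnit (localizer K H.op φ κ ρ) := by
  obtain ⟨hκ, hρ, hadm⟩ := hadm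
  have h2 : 0 < 2 * ρ := by positivity
  have hγ : H.op * K.γ = K.γ * H.op := H.2.2
  obtain ⟨_, _⟩ := exists_starOrderedRing (Adj B X)
  have lF := hφ.limAt hρ
  have lG := hφ.limAt_dirac hρ
  have lR := hφ.limAt_tail h2
  have hcφ := cConst_nonneg φ
  have hsq := localizer_sq K hφ hρ κ hγ H.d_spec
  have hcomm := norm_Phi_commutator_le hφ hρ H.d_spec
  have hFs : IsSelfAdjoint (Phi K φ ρ) := isSelfAdjoint_funcCalc K.regular lF
  have hGs := isSelfAdjoint_funcCalc K.regular lG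
  have hRs := isSelfAdjoint_funcCalc K.regular lR
  have hF1 := norm_Phi_le_one K hφ hρ
  have hγ1 := norm_γ_le_one K
  have hLs := isSelfAdjoint_localizer K hφ hρ κ hs hγ
  set L := localizer K H.op φ κ ρ
  set F := Phi K φ ρ with hF
  set G := funcCalc K.regular fun x => (dirac φ ρ x : ℂ) with hG
  set R := funcCalc K.regular fun x => (tail φ (2 * ρ) x : ℂ) with hR
  set E := (H.op * F - F * H.op) * F * H.op + F * H.op * (F * H.op - H.op * F) -
    (κ : ℂ) • (K.γ * H.d) with hE
  set C := CConst H φ κ ρ with hC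
  set g := gap H.op with hg
  have hC0 : 0 ≤ C := by rw [hC, CConst]; positivity
  -- Each of the two commutator terms contributes c_φ ‖H‖ ‖d(H)‖ / (2ρ), which explains the factor 2
  -- in c_φ; the last term contributes κ ‖d(H)‖.
  have hEC : ‖E‖ ≤ C := by
    have n1 : ‖(H.op * F - F * H.op) * F * H.op‖ ≤
        cConst φ / (2 * ρ) * ‖H.d‖ * 1 * ‖H.op‖ := by
      rw [norm_sub_rev] at hcomm
      refine (norm_mul_le _ _).trans ?_
      gcongr
      refine (norm_mul_le _ _).trans ?_
      gcongr
    have n2 : ‖F * H.op * (F * H.op - H.op * F)‖ ≤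
        1 * ‖H.op‖ * (cConst φ / (2 * ρ) * ‖H.d‖) := by
      refine (norm_mul_le _ _).trans ?_
      gcongr
      refine (norm_mul_le _ _).trans ?_
      gcongr
    have n3 : ‖(κ : ℂ) • (K.γ * H.d)‖ ≤ κ * (1 * ‖H.d‖) := by
      rw [norm_smul, Complex.norm_real, Real.norm_of_nonneg hκ.le]
      gcongr
      refine (norm_mul_le _ _).trans ?_
      gcongr
    calc ‖E‖ ≤ _ + _ + _ := (norm_sub_le _ _).trans (add_le_add (norm_add_le _ _) le_rfl)
      _ ≤ cConst φ / (2 * ρ) * ‖H.d‖ * 1 * ‖H.op‖ +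
          1 * ‖H.op‖ * (cConst φ / (2 * ρ) * ‖H.d‖) + κ * (1 * ‖H.d‖) := by gcongr
      _ = C := by rw [hC, CConst]; field_simp; ring
  have hκs : IsSelfAdjoint ((κ : ℂ) * κ) := by simp [IsSelfAdjoint]
  have hFFs : IsSelfAdjoint (F * F) := by rw [IsSelfAdjoint, star_mul, hFs.star_eq]
  have sqs {T : Adj B X} (hT : IsSelfAdjoint T) : IsSelfAdjoint (T * T) := by
    rw [IsSelfAdjoint, star_mul, hT.star_eq]
  -- Selfadjointness is read off from the formula for the square, in which all other terms are
  -- selfadjoint.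
  have hFEF : IsSelfAdjoint (F * E * F) := by
    have e : F * E * F = L * L - F * F * (H.op * H.op) * (F * F) - ((κ : ℂ) * κ) • (G * G) -
        R * R := by rw [hsq]; abel
    rw [e]
    exact (((sqs hLs).sub ((sqs hs).conjugate_self hFFs)).sub (hκs.smul (sqs hGs))).sub (sqs hRs)
  have low1 := hFFs.conjugate_le_conjugate (gap_sq_le_mul_self hs hu)
  have low2 := neg_smul_le_conjugate hFs hFEF hEC
  have hlow : algebraMap ℝ (Adj B X) (g ^ 2) * (F * F * (F * F)) - C • (F * F) +
      ((κ : ℂ) * κ) • (G * G) + R * R ≤ L * L := by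
    rw [hsq, sub_eq_add_neg]
    gcongr
    refine le_trans (le_of_eq ?_) low1
    rw [← Algebra.commutes, mul_assoc]
    rfl
  set h : ℝ → ℝ := fun x => g ^ 2 * φ (x / ρ) ^ 4 - C * φ (x / ρ) ^ 2 + κ ^ 2 * dirac φ ρ x ^ 2 +
        (1 - φ (x / (2 * ρ)) ^ 4) with hh
  have eh : (fun x => (h x : ℂ)) = fun x =>
      ((g ^ 2 : ℝ) : ℂ) * (((φ (x / ρ) : ℂ) * (φ (x / ρ) : ℂ)) *
        ((φ (x / ρ) : ℂ) * (φ (x / ρ) : ℂ))) - (C : ℂ) * ((φ (x / ρ) : ℂ) * (φ (x / ρ) : ℂ)) +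
      ((κ : ℂ) * κ) * ((dirac φ ρ x : ℂ) * (dirac φ ρ x : ℂ)) +
      (tail φ (2 * ρ) x : ℂ) * (tail φ (2 * ρ) x : ℂ) := by
    funext x
    rw [← Complex.ofReal_mul (tail φ (2 * ρ) x), hφ.tail_mul_self, hh]
    push_cast
    ring
  have lFF := lF.mul lF
  have l1 := (LimAt.const ((g ^ 2 : ℝ) : ℂ)).mul (lFF.mul lFF)
  have l2 := (LimAt.const (C : ℂ)).mul lFF
  have l3 := (LimAt.const ((κ : ℂ) * κ)).mul (lG.mul lG)
  have l4 := lR.mul lR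
  have lh := ((l1.sub l2).add l3).add l4
  rw [← eh] at lh
  have hfc : (funcCalc K.regular fun x => (h x : ℂ)) =
      algebraMap ℝ (Adj B X) (g ^ 2) * (F * F * (F * F)) - C • (F * F) +
      ((κ : ℂ) * κ) • (G * G) + R * R := by
    rw [eh, funcCalc_add _ ((l1.sub l2).add l3) l4, funcCalc_add _ (l1.sub l2) l3,
      funcCalc_sub _ l1 l2, funcCalc_smul _ _ (lFF.mul lFF), funcCalc_smul _ _ lFF,
      funcCalc_smul _ _ (lG.mul lG), funcCalc_mul _ lFF lFF, funcCalc_mul _ lF lF,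
      funcCalc_mul _ lG lG, funcCalc_mul _ lR lR, Complex.coe_smul, Complex.coe_smul,
      ← Algebra.smul_def]
    rfl
  have hε : 0 < min (min (g ^ 2 - C) (κ ^ 2 * ρ ^ 2 / 4 - C)) 1 :=
    lt_min (lt_min (sub_pos.2 (hadm.trans_le (min_le_left _ _)))
      (sub_pos.2 (hadm.trans_le (min_le_right _ _)))) one_pos
  refine isUnit_of_algebraMap_le_mul_self hε ?_
  refine (algebraMap_le_funcCalc K.regular lh fun x => ?_).trans (hfc.trans_le hlow)
  exact hφ.lower_bound hρ hC0 x

/-- Invertibility is needed inside the double, so the inverse pair (-γ, L⁻¹) must also differ by a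
compact operator: -γ - L⁻¹ = γ (-γ - L) L⁻¹. -/
theorem isDoubleInv_localizer (hφ : IsLocalizing φ) {H : LipEv K} (hs : IsSelfAdjoint H.op)
    (hu : IsUnit H.op) (hadm : Admissible H φ κ ρ) :
    IsDoubleInv (compacts B X) (-K.γ) (localizer K H.op φ κ ρ) := by
  have hm := neg_γ_sub_localizer_mem K hφ hadm.2.1 κ H.op
  have hLs := isSelfAdjoint_localizer K hφ hadm.2.1 κ hs H.2.2
  obtain ⟨u, hu⟩ := isUnit_localizer K hφ hs hu hadm
  set L := localizer K H.op φ κ ρ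
  have hm' : (-K.γ, ((u⁻¹ : (Adj B X)ˣ) : Adj B X)) ∈ double (Adj B X) (compacts B X) := by
    change -K.γ - ((u⁻¹ : (Adj B X)ˣ) : Adj B X) ∈ (compacts B X).carrier
    have e : -K.γ - ((u⁻¹ : (Adj B X)ˣ) : Adj B X) =
        K.γ * (-K.γ - L) * ((u⁻¹ : (Adj B X)ˣ) : Adj B X) := by
      rw [mul_sub, mul_neg, K.γ_mul_γ, sub_mul, mul_assoc K.γ, ← hu, Units.mul_inv]
      noncomm_ring
    rw [e]
    exact (compacts B X).mul_mem_right _ ((compacts B X).mul_mem_left _ hm)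
  refine ⟨hm, ?_, ⟨⟨⟨(-K.γ, L), hm⟩, ⟨_, hm'⟩, ?_, ?_⟩, rfl⟩⟩
  · exact Subtype.ext (Prod.ext (by
      change star (-K.γ) = -K.γ
      rw [star_neg, K.isSelfAdjoint_γ.star_eq]) hLs)
  · refine Subtype.ext (Prod.ext ?_ ?_)
    · change -K.γ * -K.γ = 1
      rw [neg_mul_neg, K.γ_mul_γ]
    · change L * ((u⁻¹ : (Adj B X)ˣ) : Adj B X) = 1
      rw [← hu, Units.mul_inv]
  · refine Subtype.ext (Prod.ext ?_ ?_)
    · change -K.γ * -K.γ = 1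
      rw [neg_mul_neg, K.γ_mul_γ]
    · change ((u⁻¹ : (Adj B X)ˣ) : Adj B X) * L = 1
      rw [← hu, Units.inv_mul]

end Localizer

/-! ### Continuity of the localizer and homotopy invariance of its class. -/

section Homotopy

/-- A path without stabilization is a stable homotopy with added blocks of size zero. -/
theorem IsDoubleInv.toK0_eq_of_joined {L : Type*} [CStarAlgebra L] {A : ClosedStarIdeal L}
    {x y x' y' : L} (h : IsDoubleInv A x y) (h' : IsDoubleInv A x' y')
    (hj : Joined h.toW h'.toW) : h.toK0 = h'.toK0 := by
  refine Quotient.sound ?_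
  let G : SelfAdjInv (Fin 0) L := ⟨1, star_one _, isUnit_one⟩
  refine stablyHomotopic_of_joined A (Equiv.refl _) (Equiv.refl _) G G ?_
  exact joined_map (SelfAdjInv.continuous_reindex _)
    (joined_map (SelfAdjInv.continuous_sum_left _) hj)

theorem IsDoubleInv.toK0_eq_of_path {L : Type*} [CStarAlgebra L] {A : ClosedStarIdeal L}
    {x y : unitInterval → L} (hx : Continuous x) (hy : Continuous y)
    (h : ∀ t, IsDoubleInv A (x t) (y t)) : (h 0).toK0 = (h 1).toK0 := by
  refine IsDoubleInv.toK0_eq_of_joined (h 0) (h 1) ⟨⟨⟨fun t => (h t).toW, ?_⟩, rfl, rfl⟩⟩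
  refine Continuous.subtype_mk ?_ _
  refine Continuous.matrix_diagonal (continuous_pi fun _ => ?_)
  exact Continuous.subtype_mk (hx.prodMk hy) _

variable {B X : Type*} [NonUnitalCStarAlgebra B] [PartialOrder B] [StarOrderedRing B]
  [SMul B X] [NormedAddCommGroup X] [NormedSpace ℂ X] [CStarModule B X] [CompleteSpace X]
  (K : KasparovModule B X)

/-- The bound `M` on ρ gives the coefficient functions a common compact support, as norm continuity
of the calculus requires here. The tail has no compact support, so 1 - tail is used instead. -/
theorem continuous_localizer {Y : Type*} [TopologicalSpace Y] {φ : Y → ℝ → ℝ}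
    (hφc : Continuous fun p : Y × ℝ => φ p.1 p.2) (hφ : ∀ t, IsLocalizing (φ t))
    {κ ρ : Y → ℝ} (hκ : Continuous κ) (hρ : Continuous ρ) (hρ0 : ∀ t, 0 < ρ t) {M : ℝ}
    (hM : ∀ t, ρ t ≤ M) {H : Y → Adj B X} (hH : Continuous H) :
    Continuous fun t => localizer K (H t) (φ t) (κ t) (ρ t) := by
  have h2 (t : Y) : 0 < 2 * ρ t := mul_pos two_pos (hρ0 t)
  have hφ1 : Continuous fun p : Y × ℝ => φ p.1 (p.2 / ρ p.1) :=
    hφc.comp (continuous_fst.prodMk (continuous_snd.div (by fun_prop) fun p => (hρ0 p.1).ne'))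
  have hφ2 : Continuous fun p : Y × ℝ => φ p.1 (p.2 / (2 * ρ p.1)) :=
    hφc.comp (continuous_fst.prodMk (continuous_snd.div (by fun_prop) fun p => (h2 p.1).ne'))
  have c1 : Continuous fun t => Phi K (φ t) (ρ t) :=
    continuous_funcCalc_family K.regular (R := M)
      (F := fun t x => (φ t (x / ρ t) : ℂ)) (Complex.continuous_ofReal.comp hφ1)
      fun t x hx => (hφ t).scaled_eq_zero (hρ0 t) ((hM t).trans_lt hx)
  have z2 (t : Y) (x : ℝ) (hx : 2 * M < |x|) : φ t (x / (2 * ρ t)) = 0 := by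
    have := (hφ t).scaled_eq_zero (h2 t) (lt_of_le_of_lt (by linarith [hM t]) hx)
    exact_mod_cast this
  have c2 : Continuous fun t => funcCalc K.regular fun x => (dirac (φ t) (ρ t) x : ℂ) :=
    continuous_funcCalc_family K.regular (R := 2 * M)
      (F := fun t x => (dirac (φ t) (ρ t) x : ℂ))
      (Complex.continuous_ofReal.comp (continuous_snd.mul (hφ2.pow 2)))
      fun t x hx => by simp [dirac, z2 t x hx]
  have c3 : Continuous fun t => funcCalc K.regular fun x =>
      1 - (tail (φ t) (2 * ρ t) x : ℂ) :=
    continuous_funcCalc_family K.regular (R := 2 * M)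
      (F := fun t x => 1 - (tail (φ t) (2 * ρ t) x : ℂ))
      (continuous_const.sub (Complex.continuous_ofReal.comp
        (Real.continuous_sqrt.comp (continuous_const.sub (hφ2.pow 4)))))
      fun t x hx => by simp [tail, z2 t x hx]
  have e (t : Y) : localizer K (H t) (φ t) (κ t) (ρ t) =
      Phi K (φ t) (ρ t) * K.γ * H t * Phi K (φ t) (ρ t) +
      (κ t : ℂ) • (funcCalc K.regular fun x => (dirac (φ t) (ρ t) x : ℂ)) -
      (1 - funcCalc K.regular fun x => 1 - (tail (φ t) (2 * ρ t) x : ℂ)) * K.γ := by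
    rw [localizer_eq K (hφ t) (hρ0 t), funcCalc_sub _ (.const 1) ((hφ t).limAt_tail (h2 t)),
      funcCalc_one, sub_sub_cancel]
  simp only [e]
  have hκ' : Continuous fun t => (κ t : ℂ) := Complex.continuous_ofReal.comp hκ
  exact (((c1.mul continuous_const).mul hH).mul c1).add (hκ'.smul c2) |>.sub
    ((continuous_const.sub c3).mul continuous_const)

variable {K}

theorem LipEv.continuous_op : Continuous (LipEv.op : LipEv K → Adj B X) :=
  have h : Continuous fun T : LipEv K => (T.op, T.d) := continuous_induced_dom
  continuous_fst.comp h

theorem LipEv.continuous_d : Continuous (LipEv.d : LipEv K → Adj B X) :=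
  have h : Continuous fun T : LipEv K => (T.op, T.d) := continuous_induced_dom
  continuous_snd.comp h

theorem toK0_localizer_eq_of_path {φ : unitInterval → ℝ → ℝ}
    (hφc : Continuous fun p : unitInterval × ℝ => φ p.1 p.2) (hφ : ∀ t, IsLocalizing (φ t))
    {κ ρ : unitInterval → ℝ} (hκ : Continuous κ) (hρ : Continuous ρ)
    {H : unitInterval → LipEv K} (hH : Continuous H) (hs : ∀ t, IsSelfAdjoint (H t).op)
    (hu : ∀ t, IsUnit (H t).op) (hadm : ∀ t, Admissible (H t) (φ t) (κ t) (ρ t)) :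
    (isDoubleInv_localizer K (hφ 0) (hs 0) (hu 0) (hadm 0)).toK0 =
      (isDoubleInv_localizer K (hφ 1) (hs 1) (hu 1) (hadm 1)).toK0 := by
  obtain ⟨M, hM⟩ := (isCompact_range hρ).bddAbove
  exact IsDoubleInv.toK0_eq_of_path continuous_const
    (continuous_localizer K hφc hφ hκ hρ (fun t => (hadm t).2.1)
      (fun t => hM (Set.mem_range_self t)) (LipEv.continuous_op.comp hH))
    fun t => isDoubleInv_localizer K (hφ t) (hs t) (hu t) (hadm t)

/-- Admissible pairs need not form a convex set, so admissibility along the segment is a hypothesis;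
it is checked separately for segments in ρ alone and for segments in φ and κ. -/
theorem IsLocalizing.toK0_eq_of_affine {φ₀ φ₁ : ℝ → ℝ} (hφ₀ : IsLocalizing φ₀)
    (hφ₁ : IsLocalizing φ₁) {κ₀ κ₁ ρ₀ ρ₁ : ℝ} {H : LipEv K} (hs : IsSelfAdjoint H.op)
    (hu : IsUnit H.op)
    (hadm : ∀ t ∈ Set.Icc (0 : ℝ) 1, Admissible H (fun x => (1 - t) * φ₀ x + t * φ₁ x)
      ((1 - t) * κ₀ + t * κ₁) ((1 - t) * ρ₀ + t * ρ₁))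
    (h₀ : IsDoubleInv (compacts B X) (-K.γ) (localizer K H.op φ₀ κ₀ ρ₀))
    (h₁ : IsDoubleInv (compacts B X) (-K.γ) (localizer K H.op φ₁ κ₁ ρ₁)) :
    h₀.toK0 = h₁.toK0 := by
  have hc₀ := hφ₀.continuous
  have hc₁ := hφ₁.continuous
  have h := toK0_localizer_eq_of_path (K := K)
    (φ := fun t x => (1 - (t : ℝ)) * φ₀ x + t * φ₁ x) (by fun_prop)
    (fun t => hφ₀.convex hφ₁ t.2) (κ := fun t => (1 - (t : ℝ)) * κ₀ + t * κ₁)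
    (ρ := fun t => (1 - (t : ℝ)) * ρ₀ + t * ρ₁) (by fun_prop) (by fun_prop)
    (H := fun _ => H) continuous_const (fun _ => hs) (fun _ => hu) (fun t => hadm t t.2)
  simpa using h

end Homotopy

/-! ### The numerical geometry of admissible pairs and the comparison of classes. -/

section Admissible

/-- The numerical condition underlying admissibility. -/
def IsAdm (c h d g κ ρ : ℝ) : Prop :=
  0 < κ ∧ 0 < ρ ∧ (κ + c * h / ρ) * d < min (g ^ 2) (κ ^ 2 * ρ ^ 2 / 4)

variable {c c' h h' d d' g g' κ ρ ρ' : ℝ}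

/-- For fixed κ, a larger ρ lowers the left side and raises the right side. Worst-case constants can
therefore replace the actual ones. -/
theorem IsAdm.mono (H : IsAdm c h d g κ ρ) (hc0 : 0 ≤ c') (hc : c' ≤ c) (hh0 : 0 ≤ h')
    (hh : h' ≤ h) (hd0 : 0 ≤ d') (hd : d' ≤ d) (hg0 : 0 ≤ g) (hg : g ≤ g') (hρ : ρ ≤ ρ') :
    IsAdm c' h' d' g' κ ρ' := by
  obtain ⟨hκ, hρ0, H⟩ := H
  have hc1 : 0 ≤ c := hc0.trans hc
  have hh1 : 0 ≤ h := hh0.trans hh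
  refine ⟨hκ, hρ0.trans_le hρ, lt_of_le_of_lt ?_ (H.trans_le ?_)⟩ <;> gcongr

/-- This is the part of admissibility that does not involve ρ; by `eventually_isAdm` it is also
sufficient, for positive κ, once ρ is large. -/
theorem IsAdm.mul_lt (H : IsAdm c h d g κ ρ) (hc : 0 ≤ c) (hh : 0 ≤ h) (hd : 0 ≤ d) :
    κ * d < g ^ 2 := by
  obtain ⟨hκ, hρ, H⟩ := H
  refine lt_of_le_of_lt ?_ (H.trans_le (min_le_left _ _))
  gcongr
  have : 0 ≤ c * h / ρ := by positivity
  linarith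

/-- As ρ → ∞ the left side at κ₁ tends to κ₁ d < g², while κ₀² ρ² / 4 exceeds g². The two endpoints
control all κ between them, so one ρ serves the whole interval. -/
theorem eventually_isAdm (c h : ℝ) (hd : 0 ≤ d) {κ₀ κ₁ : ℝ}
    (hκ₀ : 0 < κ₀) (hκ₁ : κ₁ * d < g ^ 2) :
    ∀ᶠ ρ in atTop, ∀ κ ∈ Set.Icc κ₀ κ₁, IsAdm c h d g κ ρ := by
  have t1 : Tendsto (fun ρ : ℝ => (κ₁ + c * h / ρ) * d) atTop (𝓝 ((κ₁ + 0) * d)) :=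
    (tendsto_const_nhds.add (tendsto_const_nhds.div_atTop tendsto_id)).mul_const d
  rw [add_zero] at t1
  have t2 : Tendsto (fun ρ : ℝ => κ₀ ^ 2 * ρ ^ 2 / 4) atTop atTop :=
    ((tendsto_pow_atTop two_ne_zero).const_mul_atTop (by positivity)).atTop_div_const
      (by norm_num)
  filter_upwards [t1.eventually_lt_const hκ₁, t2.eventually_ge_atTop (g ^ 2),
    eventually_gt_atTop 0] with ρ h1 h2 hρ κ hκ
  have hκ0 : 0 < κ := hκ₀.trans_le hκ.1
  refine ⟨hκ0, hρ, ?_⟩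
  have h3 : (κ + c * h / ρ) * d ≤ (κ₁ + c * h / ρ) * d := by
    have := hκ.2
    gcongr
  have h4 : κ₀ ^ 2 * ρ ^ 2 / 4 ≤ κ ^ 2 * ρ ^ 2 / 4 := by
    have := hκ.1
    gcongr
  exact lt_min (by linarith) (by linarith)

variable {B X : Type*} [NonUnitalCStarAlgebra B] [PartialOrder B] [StarOrderedRing B]
  [SMul B X] [NormedAddCommGroup X] [NormedSpace ℂ X] [CStarModule B X] [CompleteSpace X]
  {K : KasparovModule B X}

theorem admissible_iff {H : LipEv K} {φ : ℝ → ℝ} :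
    Admissible H φ κ ρ ↔ IsAdm (cConst φ) ‖H.op‖ ‖H.d‖ (gap H.op) κ ρ := Iff.rfl

theorem gap_nonneg (H : Adj B X) : 0 ≤ gap H := inv_nonneg.2 (norm_nonneg _)

theorem toK0_localizer_eq {H : LipEv K} (hs : IsSelfAdjoint H.op) (hu : IsUnit H.op)
    {φ₀ φ₁ : ℝ → ℝ} (hφ₀ : IsLocalizing φ₀) (hφ₁ : IsLocalizing φ₁) {κ₀ κ₁ ρ₀ ρ₁ : ℝ}
    (hadm₀ : Admissible H φ₀ κ₀ ρ₀) (hadm₁ : Admissible H φ₁ κ₁ ρ₁)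
    (h₀ : IsDoubleInv (compacts B X) (-K.γ) (localizer K H.op φ₀ κ₀ ρ₀))
    (h₁ : IsDoubleInv (compacts B X) (-K.γ) (localizer K H.op φ₁ κ₁ ρ₁)) :
    h₀.toK0 = h₁.toK0 := by
  have n1 := norm_nonneg H.op
  have n2 := norm_nonneg H.d
  have hg := gap_nonneg H.op
  have hm := le_max_left κ₀ κ₁
  have hκd : max κ₀ κ₁ * ‖H.d‖ < gap H.op ^ 2 := by
    rcases max_choice κ₀ κ₁ with h | h <;> rw [h]
    · exact (admissible_iff.1 hadm₀).mul_lt (cConst_nonneg _) n1 n2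
    · exact (admissible_iff.1 hadm₁).mul_lt (cConst_nonneg _) n1 n2
  -- A common radius beyond both given ones, so large that every κ between κ₀ and κ₁ is admissible
  -- for every convex combination of φ₀ and φ₁.
  obtain ⟨ρ, hlarge, hρ₀, hρ₁⟩ := ((eventually_isAdm (max (cConst φ₀) (cConst φ₁)) ‖H.op‖
    n2 (lt_min hadm₀.1 hadm₁.1) hκd).and
    ((eventually_ge_atTop ρ₀).and (eventually_ge_atTop ρ₁))).exists
  have grow {φ : ℝ → ℝ} (hφ : IsLocalizing φ) {κ r r' : ℝ} (hadm : Admissible H φ κ r)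
      (hr : r ≤ r') : Admissible H φ κ r' :=
    (admissible_iff.1 hadm).mono (cConst_nonneg _) le_rfl n1 le_rfl n2 le_rfl hg le_rfl hr
  have radial {φ : ℝ → ℝ} (hφ : IsLocalizing φ) {κ r : ℝ} (hadm : Admissible H φ κ r)
      (hr : r ≤ ρ) (h : IsDoubleInv (compacts B X) (-K.γ) (localizer K H.op φ κ r))
      (h' : IsDoubleInv (compacts B X) (-K.γ) (localizer K H.op φ κ ρ)) :
      h.toK0 = h'.toK0 := by
    refine hφ.toK0_eq_of_affine hφ hs hu (fun t ht => ?_) h h'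
    have e1 : (fun x => (1 - t) * φ x + t * φ x) = φ := funext fun x => by ring
    have e2 : (1 - t) * κ + t * κ = κ := by ring
    rw [e1, e2]
    refine grow hφ hadm ?_
    nlinarith [ht.1, ht.2]
  have hadm₀' := grow hφ₀ hadm₀ hρ₀
  have hadm₁' := grow hφ₁ hadm₁ hρ₁
  have h₀' := isDoubleInv_localizer K hφ₀ hs hu hadm₀'
  have h₁' := isDoubleInv_localizer K hφ₁ hs hu hadm₁'
  refine (radial hφ₀ hadm₀ hρ₀ h₀ h₀').trans (Eq.trans ?_ (radial hφ₁ hadm₁ hρ₁ h₁ h₁').symm)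
  -- The middle leg: φ and κ move simultaneously at the common radius.
  refine hφ₀.toK0_eq_of_affine hφ₁ hs hu (fun t ht => ?_) h₀' h₁'
  have e : (1 - t) * ρ + t * ρ = ρ := by ring
  rw [e, admissible_iff]
  have hmem : (1 - t) * κ₀ + t * κ₁ ∈ Set.Icc (min κ₀ κ₁) (max κ₀ κ₁) :=
    (convex_Icc _ _) ⟨min_le_left _ _, le_max_left _ _⟩ ⟨min_le_right _ _, le_max_right _ _⟩
      (sub_nonneg.2 ht.2) ht.1 (by ring)
  exact (hlarge _ hmem).mono (cConst_nonneg _) (cConst_convex_le hφ₀ hφ₁ ht) n1 le_rfl n2 le_rfl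
    hg le_rfl le_rfl

theorem isLocalizerClass_toK0 {H : LipEv K} (hs : IsSelfAdjoint H.op) (hu : IsUnit H.op)
    {φ : ℝ → ℝ} (hφ : IsLocalizing φ) (hadm : Admissible H φ κ ρ) :
    IsLocalizerClass H (isDoubleInv_localizer K hφ hs hu hadm).toK0 :=
  fun _ _ _ hφ' hadm' => ⟨isDoubleInv_localizer K hφ' hs hu hadm',
    toK0_localizer_eq hs hu hφ' hφ hadm' hadm _ _⟩

/-- On the zero module the gap would be 0⁻¹ = 0 and no pair would be admissible; this is where X ≠ 0
enters. -/
theorem norm_inverse_pos [Nontrivial X] {H : Adj B X} (hu : IsUnit H) :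
    0 < ‖Ring.inverse H‖ := by
  refine norm_pos_iff.2 fun h0 => ?_
  have h1 := Ring.mul_inverse_cancel H hu
  rw [h0, mul_zero] at h1
  obtain ⟨x, hx⟩ := exists_ne (0 : X)
  exact hx (congrArg (fun T : Adj B X => T.1 x) h1).symm

/-- A single pair `(κ, ρ)` is admissible along a whole path of selfadjoint invertibles. -/
theorem exists_admissible_path [Nontrivial X] {H : unitInterval → LipEv K} (hH : Continuous H)
    (hu : ∀ t, IsUnit (H t).op) (φ : ℝ → ℝ) :
    ∃ κ ρ : ℝ, ∀ t, Admissible (H t) φ κ ρ := by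
  have ch : Continuous fun t => ‖(H t).op‖ := (LipEv.continuous_op.comp hH).norm
  have cd : Continuous fun t => ‖(H t).d‖ := (LipEv.continuous_d.comp hH).norm
  have cg : Continuous fun t => ‖Ring.inverse (H t).op‖ := by
    refine Continuous.norm (continuous_iff_continuousAt.2 fun t => ?_)
    obtain ⟨u, hu⟩ := hu t
    have h1 : ContinuousAt Ring.inverse (H t).op := hu ▸ NormedRing.inverse_continuousAt u
    exact ContinuousAt.comp (f := fun t => (H t).op) h1
      (LipEv.continuous_op.comp hH).continuousAt
  obtain ⟨h, hh⟩ := (isCompact_range ch).bddAbove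
  obtain ⟨d, hd⟩ := (isCompact_range cd).bddAbove
  obtain ⟨m, hm⟩ := (isCompact_range cg).bddAbove
  have hh' (t) : ‖(H t).op‖ ≤ h := hh (Set.mem_range_self t)
  have hd' (t) : ‖(H t).d‖ ≤ d := hd (Set.mem_range_self t)
  have hm' (t) : ‖Ring.inverse (H t).op‖ ≤ m := hm (Set.mem_range_self t)
  have d0 : 0 ≤ d := (norm_nonneg _).trans (hd' 0)
  have m0 : 0 < m := (norm_inverse_pos (hu 0)).trans_le (hm' 0)
  -- Since m⁻¹ is a lower bound for all gaps and d an upper bound for all ‖d(H)‖, this choice gives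
  -- κ d < m⁻²; adding 1 to d covers the case d = 0.
  set κ := m⁻¹ ^ 2 / (d + 1)
  have κ0 : 0 < κ := by positivity
  have hκd : κ * d < m⁻¹ ^ 2 := by
    rw [div_mul_eq_mul_div, div_lt_iff₀ (by positivity)]
    have : 0 < m⁻¹ ^ 2 := by positivity
    nlinarith
  obtain ⟨ρ, hρ⟩ := (eventually_isAdm (cConst φ) h d0 κ0 hκd).exists
  refine ⟨κ, ρ, fun t => admissible_iff.2 ?_⟩
  exact (hρ κ ⟨le_rfl, le_rfl⟩).mono (cConst_nonneg _) le_rfl (norm_nonneg _) (hh' t)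
    (norm_nonneg _) (hd' t) (by positivity) (inv_anti₀ (norm_inverse_pos (hu t)) (hm' t)) le_rfl

end Admissible

end SpecLoc

end

theorem lemmal {B X : Type*} [NonUnitalCStarAlgebra B] [PartialOrder B] [StarOrderedRing B]
    [SMul B X] [NormedAddCommGroup X] [NormedSpace ℂ X] [CStarModule B X] [CompleteSpace X]
    [Nontrivial X] (hB : IsSigmaUnital B) (K : KasparovModule B X) :
    (∀ H : LipEv K, IsSelfAdjoint H.op → IsUnit H.op →
      (∀ φ : ℝ → ℝ, IsLocalizing φ → ∃ κ ρ : ℝ, Admissible H φ κ ρ) ∧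
      ∃! c : K0inv (compacts B X), IsLocalizerClass H c) ∧
    (∀ α : C(unitInterval, LipEv K),
      (∀ t, IsSelfAdjoint (α t).op ∧ IsUnit (α t).op) →
      ∃ c : K0inv (compacts B X), IsLocalizerClass (α 0) c ∧ IsLocalizerClass (α 1) c) := by
  obtain ⟨φ, hφ⟩ := exists_isLocalizing
  refine ⟨fun H hs hu => ?_, fun α hα => ?_⟩
  · have hex (ψ : ℝ → ℝ) : ∃ κ ρ : ℝ, Admissible H ψ κ ρ := by
      obtain ⟨κ, ρ, h⟩ := exists_admissible_path (H := fun _ => H) continuous_const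
        (fun _ => hu) ψ
      exact ⟨κ, ρ, h 0⟩
    obtain ⟨κ, ρ, hadm⟩ := hex φ
    refine ⟨fun ψ _ => hex ψ, _, isLocalizerClass_toK0 hs hu hφ hadm, fun c hc => ?_⟩
    -- Uniqueness rests on the existence of at least one localizing function with an admissible
    -- pair; otherwise the defining condition would be vacuous.
    obtain ⟨_, hc⟩ := hc φ κ ρ hφ hadm
    exact hc.symm
  · have hs := fun t => (hα t).1
    have hu := fun t => (hα t).2
    obtain ⟨κ, ρ, hadm⟩ := exists_admissible_path α.continuous hu φ
    refine ⟨_, isLocalizerClass_toK0 (hs 0) (hu 0) hφ (hadm 0), ?_⟩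
    have hc := hφ.continuous
    -- With φ, κ and ρ fixed, only the operator moves, and the class at time 0 becomes the class at
    -- time 1.
    rw [toK0_localizer_eq_of_path (φ := fun _ => φ) (by fun_prop) (fun _ => hφ)
      (κ := fun _ => κ) (ρ := fun _ => ρ) continuous_const continuous_const α.continuous hs hu
      hadm]
    exact isLocalizerClass_toK0 (hs 1) (hu 1) hφ (hadm 1)
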